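/- All graphs are finite digraphs with a distinguished source. The \emph{statement graphs}, with source $v$, are: the trivial graph; sequence ($v\to w$); if-then ($v\to a$, $v\to b$, $a\to b$); while ($v\to a$, $a\to v$, $v\to t$); repeat ($v\to a$, $a\to v$, $a\to t$); if-then-else ($v\to a_1,a_2$ and $a_1,a_2\to t$); $p$-case, $p\ge 3$ ($v\to a_1,\dots,a_p$ and $a_1,\dots,a_p\to t$). In each non-trivial one the sink is the last vertex listed ($w$, $b$ or $t$). A \emph{Dijkstra graph} is a graph obtained from a single vertex labeled $X$ by repeatedly expanding a vertex $u$ labeled $X$ into a non-trivial statement graph $H$: $u$ is replaced by $H$, whose source receives the in-edges of $u$ and whose sink receives the out-edges of $u$; then the source of $H$ is labeled $R$ (not expansible) and its other vertices are labeled $X$. A \emph{cycle edge} of $G$ is an edge $vw$ such that, in a depth-first search from the source, $v$ is inserted in the stack after $w$ and before the removal of $w$ (for a Dijkstra graph this does not depend on the search). An induced subgraph $H$ of $G$ is \emph{prime} if it is isomorphic to a non-trivial statement graph (cycle edges of $G$ inside $H$ corresponding exactly to the edge entering the source of a while or repeat graph) and closed: only its source $s(H)$ has in-neighbors outside $H$,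 only its sink has out-neighbors outside $H$, and every $u$ such that $u\,s(H)$ is a cycle edge is an out-neighbor of $s(H)$. \emph{Contracting} $H$ means identifying its vertices into $s(H)$ and removing loops and parallel edges. \emph{Encoding algorithm.} Given a Dijkstra graph $G$ with set of cycle edges $E_C$, take a topological sorting $v_1,\dots,v_n$ of $G-E_C$. For $i=n,n-1,\dots,1$ set $C(v_i):=1$ and, if $v_i$ is the source of a prime subgraph $H$ of the current graph, append to $C(v_i)$ the string $C(H)$ and contract $H$ into $v_i$. With the vertices of $H$ named as above, $C(H)$ is: $2\,C(w)$ for sequence; $3\,C(a)\,C(b)$ for if-then; $4\,C(a)\,C(t)$ for while; $5\,C(a)\,C(t)$ for repeat; $6\,\mathrm{lex}(C(a_1),C(a_2))\,C(t)$ for if-then-else; $(p+4)\,\mathrm{lex}(C(a_1),\dots,C(a_p))\,C(t)$ for $p$-case, where $\mathrm{lex}$ concatenates the given strings in non-decreasing lexicographic order. The output is the string $C(G)$, the code of the source of $G$. \textbf{Theorem.} The encoding (isomorphism) algorithm for Dijkstra graphs can be carried out in $O(n)$ time: there are a program for a random access machine with uniform cost (finitely many registers and arrays of natural numbers; the instructions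 are loading a constant, copying, incrementing and decrementing a register, and indirect load and store; control is by sequencing, branching and while-loops on comparisons of registers) and a constant $c$ such that, for every $n$ and every Dijkstra graph $G$ on the vertices $0,\dots,n-1$, given by its source and by adjacency lists in any order, the program halts after at most $c\,n$ steps with output a code $C(G)$ produced by the encoding algorithm for $G$. -/

import Mathlib

/-! ## Rooted digraphs, depth-first search, cycle edges -/

/-- A digraph with a distinguished source vertex `s(G)`. In a flow graph the source reaches every
vertex; for the Dijkstra graphs defined below this is a consequence of their construction. -/
structure RootedDigraph (V : Type) extends Digraph V where
  source : V

namespace RootedDigraph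

/-- Isomorphism of rooted digraphs. -/
structure Iso {V W : Type} (G : RootedDigraph V) (H : RootedDigraph W) where
  toEquiv : V ≃ W
  adj_iff : ∀ v w, H.Adj (toEquiv v) (toEquiv w) ↔ G.Adj v w
  map_source : toEquiv G.source = H.source

/-- `DFSReach G st S`: some depth-first search of `G` started at the source can reach a moment at
which the stack is `st` (top first) and `S` is the set of all vertices inserted so far. -/
inductive DFSReach {V : Type} (G : RootedDigraph V) : List V → Set V → Prop
  | start : DFSReach G [G.source] {G.source}
  | insert {u w : V} {st : List V} {S : Set V} :
      DFSReach G (u :: st) S → G.Adj u w → w ∉ S → DFSReach G (w :: u :: st) (Insert.insert w S)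
  | remove {u : V} {st : List V} {S : Set V} :
      DFSReach G (u :: st) S → (∀ w, G.Adj u w → w ∈ S) → DFSReach G st S

/-- `vw` is a cycle edge: an edge such that, in a depth-first search from the source, `v` is
inserted in the stack after `w` and before the removal of `w`. (In a reducible graph, hence in
every Dijkstra graph, the set of cycle edges is the same for all depth-first searches.) -/
def IsCycleEdge {V : Type} (G : RootedDigraph V) (v w : V) : Prop :=
  G.Adj v w ∧ ∃ (st : List V) (S : Set V), G.DFSReach (v :: st) S ∧ w ∈ st

end RootedDigraph

/-! ## Statement graphs -/

inductive StatementKind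
  | trivial
  | sequence
  | ifThen
  | whileLoop
  | repeatLoop
  | ifThenElse
  | pCase (p : ℕ) (hp : 3 ≤ p)

namespace StatementKind

/-- The number of vertices of the statement graph. Its vertices are numbered from `0`, which is
the source; the last one is the sink. -/
def order : StatementKind → ℕ
  | trivial => 1
  | sequence => 2
  | ifThen => 3
  | whileLoop => 3
  | repeatLoop => 3
  | ifThenElse => 4
  | pCase p _ => p + 2

theorem order_pos (k : StatementKind) : 0 < k.order := by
  cases k <;> simp [order]

/-- The edges of the statement graph. -/
def Edge : StatementKind → ℕ → ℕ → Prop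
  | trivial, _, _ => False
  | sequence, i, j => i = 0 ∧ j = 1
  | ifThen, i, j => (i = 0 ∧ j = 1) ∨ (i = 0 ∧ j = 2) ∨ (i = 1 ∧ j = 2)
  | whileLoop, i, j => (i = 0 ∧ j = 1) ∨ (i = 1 ∧ j = 0) ∨ (i = 0 ∧ j = 2)
  | repeatLoop, i, j => (i = 0 ∧ j = 1) ∨ (i = 1 ∧ j = 0) ∨ (i = 1 ∧ j = 2)
  | ifThenElse, i, j =>
      (i = 0 ∧ j = 1) ∨ (i = 0 ∧ j = 2) ∨ (i = 1 ∧ j = 3) ∨ (i = 2 ∧ j = 3)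
  | pCase p _, i, j => (i = 0 ∧ 1 ≤ j ∧ j ≤ p) ∨ (1 ≤ i ∧ i ≤ p ∧ j = p + 1)

def src (k : StatementKind) : Fin k.order := ⟨0, k.order_pos⟩

def snk (k : StatementKind) : Fin k.order := ⟨k.order - 1, Nat.sub_lt k.order_pos one_pos⟩

/-- The statement graph itself, as a digraph rooted at its source. -/
def graph (k : StatementKind) : RootedDigraph (Fin k.order) where
  Adj i j := k.Edge i j
  source := k.src

end StatementKind

/-! ## Dijkstra graphs -/

/-- Expansible (`X`) and regular (`R`) vertices. -/
inductive VertexLabel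
  | X
  | R

namespace RootedDigraph

open Classical in
/-- Expansion of the vertex `v` of `G` into the statement graph `k`: `v` is replaced by the
statement graph, whose source receives the in-edges of `v` and whose sink the out-edges. -/
noncomputable def expand {V : Type} (G : RootedDigraph V) (v : V) (k : StatementKind) :
    RootedDigraph ({u : V // u ≠ v} ⊕ Fin k.order) where
  Adj
    | .inl a, .inl b => G.Adj a b
    | .inl a, .inr j => j = k.src ∧ G.Adj a v
    | .inr i, .inl b => i = k.snk ∧ G.Adj v b
    | .inr i, .inr j => k.graph.Adj i j
  source := if h : G.source = v then .inr k.src else .inl ⟨G.source, h⟩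

open Classical in
/-- The labels after an expansion into a non-trivial statement graph: the source of the statement
graph is labeled `R`, its other vertices `X`, all old vertices keep their labels. -/
noncomputable def expandLabel {V : Type} (lab : V → VertexLabel) (v : V) (k : StatementKind) :
    {u : V // u ≠ v} ⊕ Fin k.order → VertexLabel
  | .inl a => lab a
  | .inr i => if i = k.src then .R else .X

/-- Labeled Dijkstra graphs: start with a trivial graph labeled `X` and repeatedly expand an
`X`-vertex into a non-trivial statement graph. -/
inductive IsLabeledDijkstra : (V : Type) → RootedDigraph V → (V → VertexLabel) → Prop
  | trivial : IsLabeledDijkstra (Fin StatementKind.trivial.order) StatementKind.trivial.graph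
      (fun _ => .X)
  | expand {V : Type} {G : RootedDigraph V} {lab : V → VertexLabel} (v : V) (k : StatementKind) :
      IsLabeledDijkstra V G lab → lab v = .X → k ≠ StatementKind.trivial →
      IsLabeledDijkstra ({u : V // u ≠ v} ⊕ Fin k.order) (G.expand v k) (expandLabel lab v k)

/-- An (unlabeled) rooted digraph is a Dijkstra graph if it is isomorphic to a labeled one. -/
def IsDijkstra {V : Type} (G : RootedDigraph V) : Prop :=
  ∃ (W : Type) (H : RootedDigraph W) (lab : W → VertexLabel),
    IsLabeledDijkstra W H lab ∧ Nonempty (Iso H G)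

/-! ## Prime subgraphs and contraction -/

/-- `φ` identifies the statement graph `k` with a prime subgraph of `G`: it is an isomorphism onto
the subgraph induced by its range, in the context of flow graphs (that is, cycle edges correspond;
the cycle edge of a while or repeat graph is the one entering its source, and the other statement
graphs have none), the statement graph is non-trivial, and the subgraph is closed. -/
structure IsPrime {V : Type} (G : RootedDigraph V) (k : StatementKind) (φ : Fin k.order → V) :
    Prop where
  nontrivial : k ≠ StatementKind.trivial
  injective : Function.Injective φ
  adj_iff : ∀ i j, G.Adj (φ i) (φ j) ↔ k.graph.Adj i j
  cycle_iff : ∀ i j, G.IsCycleEdge (φ i) (φ j) ↔ k.graph.Adj i j ∧ j = k.src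
  closed_in : ∀ i, i ≠ k.src → ∀ u, G.Adj u (φ i) → u ∈ Set.range φ
  closed_out : ∀ i, i ≠ k.snk → ∀ u, G.Adj (φ i) u → u ∈ Set.range φ
  closed_cycle : ∀ u, G.IsCycleEdge u (φ k.src) → G.Adj (φ k.src) u

open Classical in
/-- The image of a vertex under the contraction of the vertex set `S` into `s`. -/
noncomputable def image {V : Type} (S : Set V) (s u : V) : V := if u ∈ S then s else u

/-- The contraction of the vertex set `S` into its member `s`: the vertices of `S` are coalesced
into `s`, loops and parallel edges are removed. The vertex type is kept: the vertices of `S` other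
than `s` stay behind without any edges, so they are never met by a depth-first search from the
source and belong to no prime subgraph. -/
noncomputable def contract {V : Type} (G : RootedDigraph V) (S : Set V) (s : V) :
    RootedDigraph V where
  Adj x y := x ≠ y ∧ ∃ u w, image S s u = x ∧ image S s w = y ∧ G.Adj u w
  source := image S s G.source

/-- The list `l` is a topological sorting of `G` minus its cycle edges. -/
def IsTopologicalSort {V : Type} (G : RootedDigraph V) (l : List V) : Prop :=
  l.Nodup ∧ (∀ v, v ∈ l) ∧ l.Pairwise (fun a b => ¬ (G.Adj b a ∧ ¬ G.IsCycleEdge b a))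

end RootedDigraph

/-! ## The encoding algorithm -/

/-- `lex` of a family of strings: their concatenation in non-decreasing lexicographic order. -/
def lexConcat (L : List (List ℕ)) : List ℕ :=
  (L.insertionSort (fun a b => a ≤ b)).flatten

namespace StatementKind

/-- The code `C(H)` of a prime subgraph of kind `k`, where `c i` is the code of its `i`-th vertex:
the type of `H`, then the codes of the vertices other than the source in the order fixed by the
kind, those of the alternatives of an if-then-else or `p`-case being sorted lexicographically. -/
def code : (k : StatementKind) → (Fin k.order → List ℕ) → List ℕ
  | trivial, _ => []
  | sequence, c => 2 :: c (1 : Fin 2)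
  | ifThen, c => 3 :: (c (1 : Fin 3) ++ c (2 : Fin 3))
  | whileLoop, c => 4 :: (c (1 : Fin 3) ++ c (2 : Fin 3))
  | repeatLoop, c => 5 :: (c (1 : Fin 3) ++ c (2 : Fin 3))
  | ifThenElse, c => 6 :: (lexConcat [c (1 : Fin 4), c (2 : Fin 4)] ++ c (3 : Fin 4))
  | pCase p _, c =>
      (p + 4) :: (lexConcat (List.ofFn fun i : Fin p => c (i.succ.castSucc : Fin (p + 2))) ++
        c (Fin.last (p + 1)))

end StatementKind

namespace RootedDigraph

/-- The main loop of the encoding algorithm, processing the vertices in the given order.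
`Sweep G C l G' C'`: from the current (contracted) graph `G` and codes `C`, processing `l` can lead
to `G'` and `C'`. A processed vertex `v` gets the code `1`; if it is the source of a prime subgraph
`H` of the current graph, `C(H)` is appended and `H` is contracted into `v`. -/
inductive Sweep {V : Type} [DecidableEq V] :
    RootedDigraph V → (V → List ℕ) → List V → RootedDigraph V → (V → List ℕ) → Prop
  | done (G : RootedDigraph V) (C : V → List ℕ) : Sweep G C [] G C
  | prime {G G' : RootedDigraph V} {C C' : V → List ℕ} {v : V} {l : List V}
      (k : StatementKind) (φ : Fin k.order → V) :
      G.IsPrime k φ → φ k.src = v →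
      Sweep (G.contract (Set.range φ) v)
        (Function.update C v ([1] ++ k.code (fun i => C (φ i)))) l G' C' →
      Sweep G C (v :: l) G' C'
  | skip {G G' : RootedDigraph V} {C C' : V → List ℕ} {v : V} {l : List V} :
      (¬ ∃ (k : StatementKind) (φ : Fin k.order → V), G.IsPrime k φ ∧ φ k.src = v) →
      Sweep G (Function.update C v [1]) l G' C' →
      Sweep G C (v :: l) G' C'

/-- `code` is produced for `G` by a run of the encoding algorithm: choose a topological sorting
`v₁, …, vₙ` of `G` minus its cycle edges, process `vₙ, …, v₁`, return the code of the source. -/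
def Encodes {V : Type} [DecidableEq V] (G : RootedDigraph V) (code : List ℕ) : Prop :=
  ∃ (l : List V) (G' : RootedDigraph V) (C' : V → List ℕ),
    G.IsTopologicalSort l ∧ Sweep G (fun _ => []) l.reverse G' C' ∧ code = C' G.source

/-! ## Adjacency lists -/

/-- `adj` lists the out-neighbors of every vertex, without repetition, in any order. -/
def IsAdjacencyList {V : Type} (G : RootedDigraph V) (adj : V → List V) : Prop :=
  ∀ v, (adj v).Nodup ∧ ∀ w, w ∈ adj v ↔ G.Adj v w

/-- The input word: the number of vertices, the source, and, for each vertex in turn, its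
out-degree followed by its out-neighbors. -/
def inputWord {n : ℕ} (G : RootedDigraph (Fin n)) (adj : Fin n → List (Fin n)) : List ℕ :=
  n :: (G.source : ℕ) ::
    (List.finRange n).flatMap (fun v => (adj v).length :: (adj v).map (fun w => (w : ℕ)))

end RootedDigraph

/-! ## A random access machine

Programs over registers and arrays of natural numbers, with indirect addressing, under the uniform
cost measure. The only arithmetic is increment and decrement, so that in `t` steps no number can
exceed the largest one in the input or in the program by more than `t`. -/

namespace RAM

structure State where
  reg : ℕ → ℕ
  mem : ℕ → ℕ → ℕ

inductive Test
  | eq (a b : ℕ)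
  | lt (a b : ℕ)

def Test.Holds (s : State) : Test → Prop
  | .eq a b => s.reg a = s.reg b
  | .lt a b => s.reg a < s.reg b

/-- Elementary instructions; `d`, `a`, `i` are names of registers, `A` is the name of an array. -/
inductive Instr
  | const (d k : ℕ)
  | copy (d a : ℕ)
  | inc (d : ℕ)
  | dec (d : ℕ)
  | load (d A i : ℕ)
  | store (A i a : ℕ)

def State.setReg (s : State) (d x : ℕ) : State :=
  { s with reg := Function.update s.reg d x }

def State.setMem (s : State) (A i x : ℕ) : State :=
  { s with mem := Function.update s.mem A (Function.update (s.mem A) i x) }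

def Instr.apply (s : State) : Instr → State
  | .const d k => s.setReg d k
  | .copy d a => s.setReg d (s.reg a)
  | .inc d => s.setReg d (s.reg d + 1)
  | .dec d => s.setReg d (s.reg d - 1)
  | .load d A i => s.setReg d (s.mem A (s.reg i))
  | .store A i a => s.setMem A (s.reg i) (s.reg a)

/-- Programs. -/
inductive Program
  | skip
  | instr (c : Instr)
  | seq (P Q : Program)
  | ite (b : Test) (P Q : Program)
  | loop (b : Test) (P : Program)

/-- `Run P s s' t`: started in `s`, the program `P` terminates in `s'` after exactly `t` steps;
every instruction and every evaluation of a test is one step. -/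
inductive Run : Program → State → State → ℕ → Prop
  | skip (s : State) : Run .skip s s 1
  | instr (c : Instr) (s : State) : Run (.instr c) s (c.apply s) 1
  | seq {P Q : Program} {s s' s'' : State} {t t' : ℕ} :
      Run P s s' t → Run Q s' s'' t' → Run (.seq P Q) s s'' (t + t')
  | ite_true {b : Test} {P Q : Program} {s s' : State} {t : ℕ} :
      b.Holds s → Run P s s' t → Run (.ite b P Q) s s' (t + 1)
  | ite_false {b : Test} {P Q : Program} {s s' : State} {t : ℕ} :
      ¬ b.Holds s → Run Q s s' t → Run (.ite b P Q) s s' (t + 1)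
  | loop_true {b : Test} {P : Program} {s s' s'' : State} {t t' : ℕ} :
      b.Holds s → Run P s s' t → Run (.loop b P) s' s'' t' →
      Run (.loop b P) s s'' (t + t' + 1)
  | loop_false {b : Test} {P : Program} {s : State} :
      ¬ b.Holds s → Run (.loop b P) s s 1

/-- The initial state: the input word is in array `0`, everything else is `0`. -/
def initial (input : List ℕ) : State where
  reg _ := 0
  mem A i := if A = 0 then input.getD i 0 else 0

/-- The output word: its length is in register `0`, its letters are in array `1`. -/
def State.output (s : State) : List ℕ :=
  (List.range (s.reg 0)).map (s.mem 1)

end RAM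

/-! A Dijkstra graph is encoded by a parse tree on its own vertices. An expanded vertex `v` is an
inner node whose children are the other vertices of its statement graph; each child is the source of
whatever it is expanded into later. An edge from the `i`-th to the `j`-th vertex of the statement
graph at `v` runs, in the final graph, from the sink of the complete expansion of the `i`-th vertex
(from `v` itself if `i = 0`) to the `j`-th vertex. Induction on the expansions yields such a tree
(`IsDijkstra.exists_parse`), with a numbering `num` that falls from parent to child and along every
edge that does not enter the source of its statement graph.

Correctness. A subtree can be entered only at its root, so the stack of a depth-first search
contains all ancestors of its top and its numbers fall towards the top. Hence the cycle edges are
exactly the edges entering the source of a statement graph (`isCycleEdge_iff`). A node all of whose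
children are leaves is the source of a prime subgraph (`isPrime`), a leaf never is (`not_isPrime`),
and contraction turns such a node into a leaf (`contract_graph`). A sweep by increasing `num`
therefore computes the recursive code of the tree (`encodes`). As the output only has to arise from
some run of the encoding algorithm, it suffices to print this recursive code.

Running time. There are at most `3 * n` edges (`sum_length_adj_le`). A depth-first search finishes
children before parents, and in that order the kind and the last child of a vertex follow from
bounded local data: out-degree, presence of a leaving cycle edge, number of entering forward edges,
first two neighbors, and sinks of the children (`classify_eq`).

It remains to sort the alternatives without writing down the codes of all subtrees, whose total
length need not be linear. As in the classical linear-time test for tree isomorphism, the tree is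
treated level by level from the deepest one, and each vertex gets an integer class representing the
rank of its code within its level. Siblings are ordered by bucket sort on the classes; the classes
of the level above come from refining first by kind and then by the classes of successive children
(`rankIn_keys_append`, `runs_levelStep`). Ranks may stand for codes although `[1]` is a prefix of
every code: each code starts with `1`, while the kind of an inner node exceeds `1`, so
concatenations of equally many codes compare like the sequences of these codes (`Below`,
`Ranks.flatMap`, `Ranks.of_children`). A traversal with an explicit stack then prints the code of
the root (`runs_outputProg`). -/

namespace StatementKind

/-! ### Edges of the statement graphs -/

theorem Edge.lt_left {k : StatementKind} {i j : ℕ} (h : k.Edge i j) : i + 1 < k.order := by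
  cases k <;> simp only [Edge, order] at * <;> omega

theorem Edge.lt_right {k : StatementKind} {i j : ℕ} (h : k.Edge i j) : j < k.order := by
  cases k <;> simp only [Edge, order] at * <;> omega

theorem Edge.ne {k : StatementKind} {i j : ℕ} (h : k.Edge i j) : i ≠ j := by
  cases k <;> simp only [Edge] at * <;> omega

theorem Edge.ne_trivial {k : StatementKind} {i j : ℕ} (h : k.Edge i j) : k ≠ trivial := by
  rintro rfl
  exact h

/-- The vertices are numbered topologically up to the edges into `0`, which are the only candidates
for cycle edges. -/
theorem Edge.lt {k : StatementKind} {i j : ℕ} (h : k.Edge i j) (hj : j ≠ 0) : i < j := by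
  cases k <;> simp only [Edge] at * <;> omega

theorem two_le_order {k : StatementKind} (h : k ≠ trivial) : 2 ≤ k.order := by
  cases k <;> simp [order] at *

theorem ne_trivial_of_lt_order {k : StatementKind} {i : ℕ} (h0 : 0 < i) (h : i < k.order) :
    k ≠ trivial := by
  rintro rfl
  simp [order] at h
  omega

theorem edge_zero_one {k : StatementKind} (h : k ≠ trivial) : k.Edge 0 1 := by
  cases k <;> simp [Edge] at *
  omega

/-- This unique in-neighbor is what betrays an inner vertex: it drives both the exclusion of leaves
as sources of prime subgraphs and the recognition of sequence and repeat. -/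
theorem edge_one_unique {k : StatementKind} {i : ℕ} (h : k.Edge i 1) : i = 0 := by
  cases k <;> simp only [Edge] at * <;> omega

/-- Every vertex of a statement graph is reached from the source by at most two edges. -/
theorem exists_edge_to {k : StatementKind} {j : ℕ} (h0 : 0 < j) (h : j < k.order) :
    k.Edge 0 j ∨ (k.Edge 0 1 ∧ k.Edge 1 j) := by
  cases k <;> simp [order, Edge] at * <;> omega

end StatementKind

/-! ### Parse trees and the digraphs they describe -/

/-- A parse of a Dijkstra graph: every vertex `v` is expanded into a statement graph of kind
`kd v` (possibly trivial) whose `i`-th vertex is expanded further from `ch v i`; `snk v` is the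
sink of the complete expansion of `v`, and `num` decreases along non-cycle edges. -/
structure Parse (V : Type) where
  root : V
  kd : V → StatementKind
  ch : V → ℕ → V
  snk : V → V
  num : V → ℕ

namespace Parse

/-- The vertex from which the expansion of the `i`-th vertex is left. The source of a statement
graph is never expanded again, hence the exception at `0`. -/
def out {V : Type} (P : Parse V) (v : V) (i : ℕ) : V := if i = 0 then v else P.snk (P.ch v i)

/-- The edges not entering the source of a statement graph. -/
def Fwd {V : Type} (P : Parse V) (x y : V) : Prop :=
  ∃ v i j, (P.kd v).Edge i j ∧ j ≠ 0 ∧ x = P.out v i ∧ y = P.ch v j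

/-- The edges entering the source of a statement graph. -/
def Back {V : Type} (P : Parse V) (x y : V) : Prop :=
  ∃ i, (P.kd y).Edge i 0 ∧ x = P.out y i

def Arc {V : Type} (P : Parse V) (x y : V) : Prop :=
  ∃ v i j, (P.kd v).Edge i j ∧ x = P.out v i ∧ y = P.ch v j

def graph {V : Type} (P : Parse V) : RootedDigraph V where
  Adj := P.Arc
  source := P.root

/-- The fields `live` and `num_le_root` are required of inner nodes only: contraction leaves
isolated vertices behind, and validity has to survive it, whereas `Full` does not. The one function
`num` serves both as a measure on the tree and as a topological numbering of the forward arcs. -/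
structure Valid {V : Type} (P : Parse V) : Prop where
  ch_zero : ∀ v, P.ch v 0 = v
  num_ch : ∀ v i, 0 < i → i < (P.kd v).order → P.num (P.ch v i) < P.num v
  num_fwd : ∀ v i j, (P.kd v).Edge i j → j ≠ 0 → P.num (P.ch v j) < P.num (P.out v i)
  ch_inj : ∀ v i w j, 0 < i → i < (P.kd v).order → 0 < j → j < (P.kd w).order →
    P.ch v i = P.ch w j → v = w ∧ i = j
  ch_ne_root : ∀ v i, 0 < i → i < (P.kd v).order → P.ch v i ≠ P.root
  snk_trivial : ∀ v, P.kd v = .trivial → P.snk v = v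
  snk_ch : ∀ v, P.kd v ≠ .trivial → P.snk v = P.snk (P.ch v ((P.kd v).order - 1))
  live : ∀ v, P.kd v ≠ .trivial →
    v = P.root ∨ ∃ w i, 0 < i ∧ i < (P.kd w).order ∧ P.ch w i = v
  num_le_root : ∀ v, P.kd v ≠ .trivial → P.num v ≤ P.num P.root

/-- Every vertex belongs to the parse tree. -/
def Full {V : Type} (P : Parse V) : Prop :=
  ∀ v, P.num v ≤ P.num P.root ∧
    (v = P.root ∨ ∃ w i, 0 < i ∧ i < (P.kd w).order ∧ P.ch w i = v)

theorem out_zero {V : Type} (P : Parse V) (v : V) : P.out v 0 = v := by simp [out]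

theorem out_pos {V : Type} (P : Parse V) (v : V) {i : ℕ} (h : i ≠ 0) :
    P.out v i = P.snk (P.ch v i) := by simp [out, h]

theorem Fwd.arc {V : Type} {P : Parse V} {x y : V} (h : P.Fwd x y) : P.Arc x y := by
  obtain ⟨v, i, j, h1, -, h2, h3⟩ := h
  exact ⟨v, i, j, h1, h2, h3⟩

namespace Valid

variable {V : Type} {P : Parse V}

theorem arc_iff (hP : P.Valid) {x y : V} : P.Arc x y ↔ P.Fwd x y ∨ P.Back x y := by
  constructor
  · rintro ⟨v, i, j, h1, h2, h3⟩
    by_cases hj : j = 0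
    · subst hj
      rw [hP.ch_zero] at h3
      subst h3
      exact .inr ⟨i, h1, h2⟩
    · exact .inl ⟨v, i, j, h1, hj, h2, h3⟩
  · rintro (h | ⟨i, h1, h2⟩)
    · exact h.arc
    · exact ⟨y, i, 0, h1, h2, (hP.ch_zero y).symm⟩

theorem num_lt_of_fwd (hP : P.Valid) {x y : V} (h : P.Fwd x y) : P.num y < P.num x := by
  obtain ⟨v, i, j, h1, hj, rfl, rfl⟩ := h
  exact hP.num_fwd v i j h1 hj

theorem last_lt {v : V} (h : P.kd v ≠ .trivial) :
    0 < (P.kd v).order - 1 ∧ (P.kd v).order - 1 < (P.kd v).order := by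
  have := StatementKind.two_le_order h
  omega

/-- Sinks are leaves. So an exit that is an inner node and an exit that is a sink never coincide,
which makes the out-arcs of each vertex easy to list. -/
theorem kd_snk (hP : P.Valid) (v : V) : P.kd (P.snk v) = .trivial := by
  induction h : P.num v using Nat.strong_induction_on generalizing v with
  | _ m ih =>
    by_cases hv : P.kd v = .trivial
    · rw [hP.snk_trivial v hv, hv]
    · rw [hP.snk_ch v hv]
      obtain ⟨h1, h2⟩ := last_lt hv
      exact ih _ (h ▸ hP.num_ch v _ h1 h2) _ rfl

theorem num_snk_le (hP : P.Valid) (v : V) : P.num (P.snk v) ≤ P.num v := by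
  induction h : P.num v using Nat.strong_induction_on generalizing v with
  | _ m ih =>
    by_cases hv : P.kd v = .trivial
    · rw [hP.snk_trivial v hv, h]
    · rw [hP.snk_ch v hv]
      obtain ⟨h1, h2⟩ := last_lt hv
      have := hP.num_ch v _ h1 h2
      have := ih _ (h ▸ this) _ rfl
      omega

theorem num_lt_of_back (hP : P.Valid) {x y : V} (h : P.Back x y) : P.num x < P.num y := by
  obtain ⟨i, h1, rfl⟩ := h
  have hi := h1.ne
  rw [out_pos _ _ hi]
  have := hP.num_snk_le (P.ch y i)
  have := hP.num_ch y i (by omega) (by have := h1.lt_left; omega)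
  omega

theorem not_arc_self (hP : P.Valid) (x : V) : ¬ P.Arc x x := by
  rw [hP.arc_iff]
  rintro (h | h)
  · exact absurd (hP.num_lt_of_fwd h) (lt_irrefl _)
  · exact absurd (hP.num_lt_of_back h) (lt_irrefl _)

end Valid

end Parse

namespace RootedDigraph

theorem ext_adj {V : Type} {G H : RootedDigraph V} (h : ∀ x y, G.Adj x y ↔ H.Adj x y)
    (hs : G.source = H.source) : G = H := by
  obtain ⟨⟨A⟩, _⟩ := G
  obtain ⟨⟨B⟩, _⟩ := H
  obtain rfl : A = B := by
    funext x y
    exact propext (h x y)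
  simp only at hs
  subst hs
  rfl

end RootedDigraph

/-! ### Relabelling the vertices of a parse -/

namespace Parse

/-- Transport of a parse along an injection; the vertices outside the range get trivial kind. -/
noncomputable def map {V W : Type} (P : Parse V) (e : V → W) : Parse W where
  root := e P.root
  kd := Function.extend e P.kd (fun _ => .trivial)
  ch w i := Function.extend e (fun v => e (P.ch v i)) id w
  snk := Function.extend e (fun v => e (P.snk v)) id
  num := Function.extend e P.num (fun _ => 0)

section map

variable {V W : Type} {P : Parse V} {e : V → W}

theorem map_kd (he : Function.Injective e) (v : V) : (P.map e).kd (e v) = P.kd v := by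
  simp [map, he.extend_apply]

theorem map_ch (he : Function.Injective e) (v : V) (i : ℕ) :
    (P.map e).ch (e v) i = e (P.ch v i) := by
  simp [map, he.extend_apply]

theorem map_snk (he : Function.Injective e) (v : V) : (P.map e).snk (e v) = e (P.snk v) := by
  simp [map, he.extend_apply]

theorem map_num (he : Function.Injective e) (v : V) : (P.map e).num (e v) = P.num v := by
  simp [map, he.extend_apply]

theorem map_out (he : Function.Injective e) (v : V) (i : ℕ) :
    (P.map e).out (e v) i = e (P.out v i) := by
  unfold out
  split_ifs
  · rfl
  · rw [map_ch he, map_snk he]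

theorem exists_of_map_kd {w : W} (h : (P.map e).kd w ≠ .trivial) : ∃ v, e v = w := by
  by_contra hw
  exact h (by simp only [map]; rw [Function.extend_apply' _ _ _ hw])

theorem exists_of_map_order {w : W} {i : ℕ} (h0 : 0 < i) (h : i < ((P.map e).kd w).order) :
    ∃ v, e v = w :=
  exists_of_map_kd (StatementKind.ne_trivial_of_lt_order h0 h)

theorem Valid.map (hP : P.Valid) (he : Function.Injective e) : (P.map e).Valid where
  ch_zero w := by
    by_cases hw : ∃ v, e v = w
    · obtain ⟨v, rfl⟩ := hw
      rw [map_ch he, hP.ch_zero]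
    · simp only [Parse.map]
      rw [Function.extend_apply' _ _ _ hw]
      rfl
  num_ch w i h0 h := by
    obtain ⟨v, rfl⟩ := exists_of_map_order h0 h
    rw [map_ch he, map_num he, map_num he]
    rw [map_kd he] at h
    exact hP.num_ch v i h0 h
  num_fwd w i j h hj := by
    obtain ⟨v, rfl⟩ := exists_of_map_kd h.ne_trivial
    rw [map_ch he, map_out he, map_num he, map_num he]
    rw [map_kd he] at h
    exact hP.num_fwd v i j h hj
  ch_inj v i w j h0 h h0' h' heq := by
    obtain ⟨v, rfl⟩ := exists_of_map_order h0 h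
    obtain ⟨w, rfl⟩ := exists_of_map_order h0' h'
    rw [map_kd he] at h h'
    rw [map_ch he, map_ch he] at heq
    obtain ⟨rfl, rfl⟩ := hP.ch_inj v i w j h0 h h0' h' (he heq)
    exact ⟨rfl, rfl⟩
  ch_ne_root w i h0 h := by
    obtain ⟨v, rfl⟩ := exists_of_map_order h0 h
    rw [map_kd he] at h
    rw [map_ch he]
    exact fun h2 => hP.ch_ne_root v i h0 h (he h2)
  snk_trivial w h := by
    by_cases hw : ∃ v, e v = w
    · obtain ⟨v, rfl⟩ := hw
      rw [map_kd he] at h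
      rw [map_snk he, hP.snk_trivial v h]
    · simp only [Parse.map]
      rw [Function.extend_apply' _ _ _ hw]
      rfl
  snk_ch w h := by
    obtain ⟨v, rfl⟩ := exists_of_map_kd h
    rw [map_kd he] at h ⊢
    rw [map_ch he, map_snk he, map_snk he, hP.snk_ch v h]
  live w h := by
    obtain ⟨v, rfl⟩ := exists_of_map_kd h
    rw [map_kd he] at h
    rcases hP.live v h with h1 | ⟨w, i, h0, h1, h2⟩
    · left
      rw [h1]
      rfl
    · right
      exact ⟨e w, i, h0, by rwa [map_kd he], by rw [map_ch he, h2]⟩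
  num_le_root w h := by
    obtain ⟨v, rfl⟩ := exists_of_map_kd h
    rw [map_kd he] at h
    change (P.map e).num _ ≤ (P.map e).num (e P.root)
    rw [map_num he, map_num he]
    exact hP.num_le_root v h

theorem map_arc (he : Function.Injective e) {x y : W} :
    (P.map e).Arc x y ↔ ∃ v w, P.Arc v w ∧ e v = x ∧ e w = y := by
  constructor
  · rintro ⟨w, i, j, h, rfl, rfl⟩
    obtain ⟨v, rfl⟩ := exists_of_map_kd h.ne_trivial
    rw [map_kd he] at h
    exact ⟨_, _, ⟨v, i, j, h, rfl, rfl⟩, by rw [map_out he], by rw [map_ch he]⟩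
  · rintro ⟨_, _, ⟨v, i, j, h, rfl, rfl⟩, rfl, rfl⟩
    exact ⟨e v, i, j, by rwa [map_kd he], by rw [map_out he], by rw [map_ch he]⟩

theorem Full.map (hP : P.Full) (he : Function.Injective e) (v : V) :
    (P.map e).num (e v) ≤ (P.map e).num (P.map e).root ∧ (e v = (P.map e).root ∨
      ∃ w i, 0 < i ∧ i < ((P.map e).kd w).order ∧ (P.map e).ch w i = e v) := by
  change _ ≤ (P.map e).num (e P.root) ∧ (e v = e P.root ∨ _)
  rw [map_num he, map_num he]
  refine ⟨(hP v).1, ?_⟩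
  rcases (hP v).2 with h | ⟨w, i, h0, h, h2⟩
  · exact .inl (by rw [h])
  · exact .inr ⟨e w, i, h0, by rwa [map_kd he], by rw [map_ch he, h2]⟩

end map

/-! ### Expansion of a leaf of the parse -/

section expand

open Classical in
/-- The parse of the graph in which the vertex `v` has been expanded into `k`. -/
noncomputable def expandLift {V : Type} (v : V) {m : ℕ} (i : Fin m) (x : V) :
    {u : V // u ≠ v} ⊕ Fin m :=
  if h : x = v then .inr i else .inl ⟨x, h⟩

theorem expandLift_self {V : Type} (v : V) {m : ℕ} (i : Fin m) :
    expandLift v i v = .inr i := by simp [expandLift]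

theorem expandLift_of_ne {V : Type} {v : V} {m : ℕ} (i : Fin m) {x : V} (h : x ≠ v) :
    expandLift v i x = .inl ⟨x, h⟩ := by simp [expandLift, h]

theorem expandLift_val {V : Type} {v : V} {m : ℕ} (i : Fin m) (x : {u : V // u ≠ v}) :
    expandLift v i x.1 = .inl x := expandLift_of_ne i x.2

theorem expandLift_injective {V : Type} (v : V) {m : ℕ} (i : Fin m) :
    Function.Injective (expandLift v i) := by
  intro x y h
  by_cases hx : x = v <;> by_cases hy : y = v <;> simp [expandLift, hx, hy] at h ⊢
  exact h

theorem expandLift_eq_inl {V : Type} {v : V} {m : ℕ} {i : Fin m} {x : V} {a : {u : V // u ≠ v}} :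
    expandLift v i x = .inl a ↔ x = a := by
  rw [← expandLift_val i a]
  exact (expandLift_injective v i).eq_iff

theorem expandLift_eq_inr {V : Type} {v : V} {m : ℕ} {i j : Fin m} {x : V} :
    expandLift v i x = .inr j ↔ x = v ∧ j = i := by
  by_cases hx : x = v <;> simp [expandLift, hx, eq_comm]

/-- The parse of the graph in which the vertex `v` has been expanded into `k`. -/
noncomputable def expand {V : Type} (P : Parse V) (v : V) (k : StatementKind) :
    Parse ({u : V // u ≠ v} ⊕ Fin k.order) where
  root := expandLift v k.src P.root
  kd
    | .inl a => P.kd a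
    | .inr i => if i = k.src then k else .trivial
  ch
    | .inl a, j => expandLift v k.src (P.ch a j)
    | .inr i, j => if h : i = k.src ∧ j < k.order then .inr ⟨j, h.2⟩ else .inr i
  snk
    | .inl a => expandLift v k.snk (P.snk a)
    | .inr i => if i = k.src then .inr k.snk else .inr i
  num
    | .inl a => P.num a * k.order
    | .inr i => P.num v * k.order + (k.order - 1 - i)

variable {V : Type} {P : Parse V} {v : V} {k : StatementKind}

theorem expand_snk_lift (hv : P.snk v = v) (x : V) :
    (P.expand v k).snk (expandLift v k.src x) = expandLift v k.snk (P.snk x) := by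
  by_cases hx : x = v
  · subst hx
    rw [expandLift_self, hv, expandLift_self]
    simp [expand]
  · rw [expandLift_of_ne _ hx]
    rfl

theorem expand_out_inl (hv : P.snk v = v) (a : {u : V // u ≠ v}) (i : ℕ) :
    (P.expand v k).out (.inl a) i = expandLift v k.snk (P.out a i) := by
  by_cases hi : i = 0
  · subst hi
    rw [out_zero, out_zero, expandLift_val]
  · rw [out_pos _ _ hi, out_pos _ _ hi]
    exact expand_snk_lift hv _

theorem expand_ch_src {j : ℕ} (hj : j < k.order) :
    (P.expand v k).ch (.inr k.src) j = .inr ⟨j, hj⟩ := by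
  simp [expand, hj]

theorem expand_out_src {j : ℕ} (hj : j < k.order) :
    (P.expand v k).out (.inr k.src) j = .inr ⟨j, hj⟩ := by
  by_cases h0 : j = 0
  · subst h0
    rw [out_zero]
    rfl
  · rw [out_pos _ _ h0, expand_ch_src hj]
    have : (⟨j, hj⟩ : Fin k.order) ≠ k.src := by
      intro h
      exact h0 (congrArg Fin.val h)
    simp [expand, this]

theorem expand_kd_src : (P.expand v k).kd (.inr k.src) = k := by simp [expand]

theorem eq_src_of_expand_kd {i : Fin k.order} (h : (P.expand v k).kd (.inr i) ≠ .trivial) :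
    i = k.src := by
  by_contra hi
  simp [expand, hi] at h

/-- One old vertex needs two lifts: in-arcs of `v` are redirected to the source of the new statement
graph, out-arcs to its sink. The leaf `v` carries no old statement graph, so the new inner node
interferes with none. -/
theorem expand_arc (hv : P.snk v = v) (hk : P.kd v = .trivial)
    {X Y : {u : V // u ≠ v} ⊕ Fin k.order} :
    (P.expand v k).Arc X Y ↔
      (∃ x y, P.Arc x y ∧ X = expandLift v k.snk x ∧ Y = expandLift v k.src y) ∨
      ∃ i j : Fin k.order, k.Edge i j ∧ X = .inr i ∧ Y = .inr j := by
  constructor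
  · rintro ⟨w, i, j, h, rfl, rfl⟩
    rcases w with a | w
    · left
      exact ⟨_, _, ⟨a, i, j, h, rfl, rfl⟩, expand_out_inl hv a i, rfl⟩
    · right
      obtain rfl := eq_src_of_expand_kd h.ne_trivial
      rw [expand_kd_src] at h
      have h1 : i < k.order := by have := h.lt_left; omega
      exact ⟨⟨i, h1⟩, ⟨j, h.lt_right⟩, h, expand_out_src h1, expand_ch_src h.lt_right⟩
  · rintro (⟨_, _, ⟨w, i, j, h, rfl, rfl⟩, rfl, rfl⟩ | ⟨i, j, h, rfl, rfl⟩)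
    · have hw : w ≠ v := by
        rintro rfl
        rw [hk] at h
        exact h
      exact ⟨.inl ⟨w, hw⟩, i, j, h, (expand_out_inl hv ⟨w, hw⟩ i).symm, rfl⟩
    · exact ⟨.inr k.src, i, j, by rwa [expand_kd_src], (expand_out_src i.2).symm,
        (expand_ch_src j.2).symm⟩

/-- Scaling by `k.order` reserves for every old number a block of `k.order` consecutive values.
Blocks are ordered like the old numbers, and both lifts of `x` stay in the block of `x`, so old
strict inequalities persist. -/
theorem expand_num_lift_src (x : V) :
    P.num x * k.order ≤ (P.expand v k).num (expandLift v k.src x) ∧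
    (P.expand v k).num (expandLift v k.src x) < (P.num x + 1) * k.order := by
  have := k.order_pos
  by_cases hx : x = v
  · subst hx
    rw [expandLift_self]
    simp only [expand, add_mul]
    omega
  · rw [expandLift_of_ne _ hx]
    simp only [expand, add_mul]
    omega

theorem expand_num_lift_snk (x : V) :
    P.num x * k.order ≤ (P.expand v k).num (expandLift v k.snk x) ∧
    (P.expand v k).num (expandLift v k.snk x) < (P.num x + 1) * k.order := by
  have := k.order_pos
  by_cases hx : x = v
  · subst hx
    rw [expandLift_self]
    simp only [expand, add_mul]
    omega
  · rw [expandLift_of_ne _ hx]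
    simp only [expand, add_mul]
    omega

/-- Inequalities between different old vertices hold because their blocks are disjoint; inside the
block of `v` the new vertices are numbered downwards from the source. Fullness is proved first,
since it supplies `live` and `num_le_root`. -/
theorem Valid.expand (hP : P.Valid) (hkd : P.kd v = .trivial) (hk : k ≠ .trivial)
    (hF : P.Full) : (P.expand v k).Valid ∧ (P.expand v k).Full := by
  have hv : P.snk v = v := hP.snk_trivial v hkd
  have hpos := k.order_pos
  have hroot : (P.expand v k).root = expandLift v k.src P.root := rfl
  have hfull : (P.expand v k).Full := by
    have key : ∀ x, P.num x ≤ P.num P.root →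
        (P.num x + 1) * k.order ≤ (P.num P.root + 1) * k.order := fun x hx =>
      Nat.mul_le_mul_right _ (by omega)
    rintro (a | i)
    · constructor
      · rw [hroot]
        by_cases hr : P.root = v
        · rw [hr, expandLift_self]
          have := Nat.mul_le_mul_right k.order (hF a).1
          rw [hr] at this
          change P.num a * k.order ≤ P.num v * k.order + _
          omega
        · rw [expandLift_of_ne _ hr]
          exact Nat.mul_le_mul_right k.order (hF a).1
      · rcases (hF a).2 with h | ⟨w, i, h0, h, h2⟩
        · left
          rw [hroot, ← h, expandLift_val]
        · right
          have hw : w ≠ v := by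
            rintro rfl
            exact StatementKind.ne_trivial_of_lt_order h0 h hkd
          refine ⟨.inl ⟨w, hw⟩, i, h0, h, ?_⟩
          change expandLift v k.src (P.ch w i) = _
          rw [h2, expandLift_val]
    · constructor
      · rw [hroot]
        by_cases hr : P.root = v
        · rw [hr, expandLift_self]
          change P.num v * k.order + (k.order - 1 - i) ≤ P.num v * k.order + (k.order - 1 - 0)
          omega
        · rw [expandLift_of_ne _ hr]
          have : P.num v < P.num P.root := by
            rcases (hF v).2 with h | ⟨w, i, h0, h, h2⟩
            · exact absurd h.symm hr
            · rw [← h2]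
              exact lt_of_lt_of_le (hP.num_ch w i h0 h) (hF w).1
          change P.num v * k.order + (k.order - 1 - i) ≤ P.num P.root * k.order
          have := Nat.mul_le_mul_right k.order (Nat.succ_le_of_lt this)
          rw [Nat.succ_mul] at this
          omega
      · by_cases hi : i = k.src
        · subst hi
          rcases (hF v).2 with h | ⟨w, i, h0, h, h2⟩
          · left
            rw [hroot, ← h, expandLift_self]
          · right
            have hw : w ≠ v := by
              rintro rfl
              exact StatementKind.ne_trivial_of_lt_order h0 h hkd
            refine ⟨.inl ⟨w, hw⟩, i, h0, h, ?_⟩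
            change expandLift v k.src (P.ch w i) = _
            rw [h2, expandLift_self]
        · right
          refine ⟨.inr k.src, i, ?_, by rw [expand_kd_src]; exact i.2, expand_ch_src i.2⟩
          by_contra h
          exact hi (Fin.ext (by simpa [StatementKind.src] using h))
  refine ⟨?_, hfull⟩
  constructor
  · rintro (a | i)
    · change expandLift v k.src (P.ch a 0) = _
      rw [hP.ch_zero, expandLift_val]
    · by_cases hi : i = k.src
      · subst hi
        exact expand_ch_src hpos
      · simp [Parse.expand, hi]
  · rintro (a | i) j h0 h
    · have h1 := (expand_num_lift_src (P := P) (v := v) (k := k) (P.ch a j)).2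
      have h2 := hP.num_ch a j h0 h
      change (P.expand v k).num (expandLift v k.src (P.ch a j)) < P.num a * k.order
      exact lt_of_lt_of_le h1 (Nat.mul_le_mul_right _ h2)
    · obtain rfl := eq_src_of_expand_kd (StatementKind.ne_trivial_of_lt_order h0 h)
      rw [expand_kd_src] at h
      rw [expand_ch_src h]
      change P.num v * k.order + (k.order - 1 - j) < P.num v * k.order + (k.order - 1 - 0)
      omega
  · rintro (a | w) i j h hj
    · rw [expand_out_inl hv]
      have h1 := (expand_num_lift_src (P := P) (v := v) (k := k) (P.ch a j)).2
      have h2 := (expand_num_lift_snk (P := P) (v := v) (k := k) (P.out a i)).1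
      have h3 := hP.num_fwd a i j h hj
      exact lt_of_lt_of_le h1 (le_trans (Nat.mul_le_mul_right _ h3) h2)
    · obtain rfl := eq_src_of_expand_kd h.ne_trivial
      rw [expand_kd_src] at h
      have hl := h.lt_left
      have hij := h.lt hj
      rw [expand_ch_src h.lt_right, expand_out_src (by omega)]
      change P.num v * k.order + (k.order - 1 - j) < P.num v * k.order + (k.order - 1 - i)
      have := h.lt_right
      omega
  · have aux : ∀ (a : {u : V // u ≠ v}) (j : ℕ) (l : Fin k.order), 0 < j →
        j < (P.kd a).order → 0 < l.1 →
        (P.expand v k).ch (.inl a) j ≠ .inr l := by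
      intro a j l h0 h hl heq
      change expandLift v k.src (P.ch a j) = _ at heq
      rw [expandLift_eq_inr] at heq
      rw [heq.2] at hl
      exact lt_irrefl _ hl
    rintro (a | x) i (b | y) j h0 h h0' h' heq
    · have := hP.ch_inj a i b j h0 h h0' h' (expandLift_injective _ _ heq)
      exact ⟨congrArg _ (Subtype.ext this.1), this.2⟩
    · obtain rfl := eq_src_of_expand_kd (StatementKind.ne_trivial_of_lt_order h0' h')
      rw [expand_kd_src] at h'
      rw [expand_ch_src h'] at heq
      exact absurd heq (aux a i ⟨j, h'⟩ h0 h h0')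
    · obtain rfl := eq_src_of_expand_kd (StatementKind.ne_trivial_of_lt_order h0 h)
      rw [expand_kd_src] at h
      rw [expand_ch_src h] at heq
      exact absurd heq.symm (aux b j ⟨i, h⟩ h0' h' h0)
    · obtain rfl := eq_src_of_expand_kd (StatementKind.ne_trivial_of_lt_order h0 h)
      obtain rfl := eq_src_of_expand_kd (StatementKind.ne_trivial_of_lt_order h0' h')
      rw [expand_kd_src] at h h'
      rw [expand_ch_src h, expand_ch_src h'] at heq
      refine ⟨rfl, ?_⟩
      simpa using heq
  · rintro (a | x) i h0 h heq
    · exact hP.ch_ne_root a i h0 h (expandLift_injective _ _ heq)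
    · obtain rfl := eq_src_of_expand_kd (StatementKind.ne_trivial_of_lt_order h0 h)
      rw [expand_kd_src] at h
      rw [expand_ch_src h, hroot, eq_comm, expandLift_eq_inr] at heq
      have := congrArg Fin.val heq.2
      simp [StatementKind.src] at this
      omega
  · rintro (a | i) h
    · change expandLift v k.snk (P.snk a) = _
      rw [hP.snk_trivial a h, expandLift_val]
    · have : i ≠ k.src := by
        rintro rfl
        rw [expand_kd_src] at h
        exact hk h
      simp [Parse.expand, this]
  · rintro (a | i) h
    · change expandLift v k.snk (P.snk a) =
        (P.expand v k).snk (expandLift v k.src (P.ch a ((P.kd a).order - 1)))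
      rw [expand_snk_lift hv, ← hP.snk_ch a h]
    · obtain rfl := eq_src_of_expand_kd h
      rw [expand_kd_src, expand_ch_src (Nat.sub_lt hpos one_pos)]
      simp only [Parse.expand, if_true]
      split_ifs <;> rfl
  · exact fun x _ => (hfull x).2
  · exact fun x _ => (hfull x).1

theorem expand_graph (hP : P.Valid) (hkd : P.kd v = .trivial) :
    P.graph.expand v k = (P.expand v k).graph := by
  have hv : P.snk v = v := hP.snk_trivial v hkd
  have hadj : ∀ X Y, (P.graph.expand v k).Adj X Y ↔ (P.expand v k).Arc X Y := by
    intro X Y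
    rw [expand_arc hv hkd]
    rcases X with a | i <;> rcases Y with b | j
    · change P.Arc a b ↔ _
      constructor
      · exact fun h => .inl ⟨a, b, h, (expandLift_val _ _).symm, (expandLift_val _ _).symm⟩
      · rintro (⟨x, y, h, h1, h2⟩ | ⟨i, j, -, h1, -⟩)
        · rw [eq_comm, expandLift_eq_inl] at h1 h2
          rwa [h1, h2] at h
        · simp at h1
    · change (j = k.src ∧ P.Arc a v) ↔ _
      constructor
      · rintro ⟨rfl, h⟩
        exact .inl ⟨a, v, h, (expandLift_val _ _).symm, (expandLift_self _ _).symm⟩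
      · rintro (⟨x, y, h, h1, h2⟩ | ⟨i, j, -, h1, -⟩)
        · rw [eq_comm, expandLift_eq_inl] at h1
          rw [eq_comm, expandLift_eq_inr] at h2
          rw [h1, h2.1] at h
          exact ⟨h2.2, h⟩
        · simp at h1
    · change (i = k.snk ∧ P.Arc v b) ↔ _
      constructor
      · rintro ⟨rfl, h⟩
        exact .inl ⟨v, b, h, (expandLift_self _ _).symm, (expandLift_val _ _).symm⟩
      · rintro (⟨x, y, h, h1, h2⟩ | ⟨i, j, -, -, h1⟩)
        · rw [eq_comm, expandLift_eq_inl] at h2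
          rw [eq_comm, expandLift_eq_inr] at h1
          rw [h2, h1.1] at h
          exact ⟨h1.2, h⟩
        · simp at h1
    · change k.Edge i j ↔ _
      constructor
      · exact fun h => .inr ⟨i, j, h, rfl, rfl⟩
      · rintro (⟨x, y, h, h1, h2⟩ | ⟨i, j, h, h1, h2⟩)
        · rw [eq_comm, expandLift_eq_inr] at h1 h2
          rw [h1.1, h2.1] at h
          exact absurd h (hP.not_arc_self v)
        · simp at h1 h2
          rwa [h1, h2]
  have hsrc : (P.graph.expand v k).source = (P.expand v k).graph.source := by
    rfl
  exact RootedDigraph.ext_adj hadj hsrc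

end expand

end Parse

/-! ### Existence of a parse -/

namespace RootedDigraph

/-- The induction carries along that vertices labeled `X` are leaves of the parse, which is exactly
what permits the next expansion. -/
theorem IsLabeledDijkstra.exists_parse {V : Type} {G : RootedDigraph V} {lab : V → VertexLabel}
    (h : IsLabeledDijkstra V G lab) :
    ∃ P : Parse V, P.Valid ∧ P.Full ∧ P.graph = G ∧ ∀ v, lab v = .X → P.kd v = .trivial := by
  induction h with
  | trivial =>
    refine ⟨⟨StatementKind.src _, fun _ => .trivial, fun v _ => v, id, fun _ => 0⟩, ?_, ?_, ?_,
      fun _ _ => rfl⟩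
    · constructor <;> intros <;> simp_all [StatementKind.order, StatementKind.Edge]
      · omega
      · omega
    · intro v
      exact ⟨le_rfl, .inl (Subsingleton.elim (α := Fin 1) _ _)⟩
    · refine ext_adj (fun x y => ?_) rfl
      constructor
      · rintro ⟨_, _, _, h, -⟩
        exact h.elim
      · exact fun h => False.elim h
  | expand v k _ hv hk ih =>
    obtain ⟨P, hP, hF, rfl, hlab⟩ := ih
    have hkd := hlab v hv
    obtain ⟨h1, h2⟩ := hP.expand hkd hk hF
    refine ⟨P.expand v k, h1, h2, (Parse.expand_graph hP hkd).symm, ?_⟩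
    rintro (a | i) h
    · exact hlab a h
    · have : i ≠ k.src := by
        rintro rfl
        simp [expandLabel] at h
      simp [Parse.expand, this]

theorem IsDijkstra.exists_parse {V : Type} {G : RootedDigraph V} (h : G.IsDijkstra) :
    ∃ P : Parse V, P.Valid ∧ P.Full ∧ P.graph = G := by
  obtain ⟨W, H, lab, hH, ⟨e⟩⟩ := h
  obtain ⟨P, hP, hF, rfl, -⟩ := hH.exists_parse
  have he := e.toEquiv.injective
  refine ⟨P.map e.toEquiv, hP.map he, ?_, ext_adj ?_ e.map_source⟩
  · intro v
    obtain ⟨w, rfl⟩ := e.toEquiv.surjective v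
    exact hF.map he w
  · intro x y
    change (P.map e.toEquiv).Arc x y ↔ _
    rw [Parse.map_arc he]
    constructor
    · rintro ⟨v, w, h, rfl, rfl⟩
      exact (e.adj_iff v w).2 h
    · intro h
      obtain ⟨v, rfl⟩ := e.toEquiv.surjective x
      obtain ⟨w, rfl⟩ := e.toEquiv.surjective y
      exact ⟨v, w, (e.adj_iff v w).1 h, rfl, rfl⟩

end RootedDigraph

/-! ### Subtrees, depth-first stacks and cycle edges -/

namespace Parse

def Child {V : Type} (P : Parse V) (v w : V) : Prop :=
  ∃ i, 0 < i ∧ i < (P.kd v).order ∧ P.ch v i = w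

def Desc {V : Type} (P : Parse V) : V → V → Prop := Relation.ReflTransGen P.Child

/-- The lists (top first) that are simple paths from the root. -/
structure StackPath {V : Type} (P : Parse V) (st : List V) : Prop where
  chain : st.IsChain (fun a b => P.Arc b a)
  nodup : st.Nodup
  last : ∀ h, st.getLast h = P.root

namespace Valid

variable {V : Type} {P : Parse V}

theorem child_unique (hP : P.Valid) {v v' w : V} (h : P.Child v w) (h' : P.Child v' w) :
    v = v' := by
  obtain ⟨i, h0, h1, rfl⟩ := h
  obtain ⟨j, h0', h1', h⟩ := h'
  exact (hP.ch_inj _ _ _ _ h0 h1 h0' h1' h.symm).1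

theorem num_lt_of_child (hP : P.Valid) {v w : V} (h : P.Child v w) : P.num w < P.num v := by
  obtain ⟨i, h0, h1, rfl⟩ := h
  exact hP.num_ch _ _ h0 h1

theorem num_le_of_desc (hP : P.Valid) {v w : V} (h : P.Desc v w) : P.num w ≤ P.num v := by
  induction h with
  | refl => exact le_rfl
  | tail _ h ih => exact (hP.num_lt_of_child h).le.trans ih

theorem child_last {v : V} (h : P.kd v ≠ .trivial) :
    P.Child v (P.ch v ((P.kd v).order - 1)) :=
  ⟨_, (last_lt h).1, (last_lt h).2, rfl⟩

theorem desc_snk (hP : P.Valid) (v : V) : P.Desc v (P.snk v) := by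
  induction h : P.num v using Nat.strong_induction_on generalizing v with
  | _ m ih =>
    by_cases hv : P.kd v = .trivial
    · rw [hP.snk_trivial v hv]
      exact .refl
    · rw [hP.snk_ch v hv]
      have hc := child_last hv
      exact .head hc (ih _ (h ▸ hP.num_lt_of_child hc) _ rfl)

theorem desc_out (hP : P.Valid) {v : V} {i : ℕ} (h : i < (P.kd v).order) :
    P.Desc v (P.out v i) := by
  by_cases hi : i = 0
  · subst hi
    rw [out_zero]
    exact .refl
  · rw [out_pos _ _ hi]
    exact .head ⟨i, by omega, h, rfl⟩ (hP.desc_snk _)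

theorem desc_of_desc_child (hP : P.Valid) {v w x : V} (h : P.Desc v x) (hc : P.Child w x)
    (hne : v ≠ x) : P.Desc v w := by
  rcases Relation.ReflTransGen.cases_tail h with h | ⟨y, h1, h2⟩
  · exact absurd h.symm hne
  · rwa [hP.child_unique hc h2]

/-- A subtree can only be entered at its root. -/
theorem eq_of_arc_of_desc (hP : P.Valid) {v x y : V} (h : P.Arc x y) (hy : P.Desc v y)
    (hx : ¬ P.Desc v x) : y = v := by
  obtain ⟨w, i, j, he, rfl, rfl⟩ := h
  by_contra hne
  -- The tail of the arc lies in the subtree of `w`. Its head is `w` itself or a child of `w`, so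
  -- unless the head is `v`, the subtree of `v` contains `w` and hence the tail.
  refine hx (Relation.ReflTransGen.trans ?_ (hP.desc_out (by have := he.lt_left; omega)))
  by_cases hj : j = 0
  · subst hj
    rwa [hP.ch_zero] at hy
  · exact hP.desc_of_desc_child hy ⟨j, by omega, he.lt_right, rfl⟩ (Ne.symm hne)

theorem eq_of_desc_root (hP : P.Valid) {v : V} (h : P.Desc v P.root) : v = P.root := by
  rcases Relation.ReflTransGen.cases_tail h with h | ⟨y, -, i, h0, h1, h2⟩
  · exact h.symm
  · exact absurd h2 (hP.ch_ne_root y i h0 h1)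

/-- Trace the path back from `x` towards the root: it can leave the subtree of `v` only at `v`, and
it must leave it unless `v` is the root. -/
theorem mem_of_desc (hP : P.Valid) {v x : V} {st : List V}
    (hc : (x :: st).IsChain (fun a b => P.Arc b a))
    (hl : (x :: st).getLast (List.cons_ne_nil _ _) = P.root) (h : P.Desc v x) :
    v ∈ x :: st := by
  induction st generalizing x with
  | nil =>
    simp at hl
    rw [hl] at h ⊢
    rw [hP.eq_of_desc_root h]
    simp
  | cons y st ih =>
    rw [List.isChain_cons_cons] at hc
    by_cases hy : P.Desc v y
    · exact List.mem_cons_of_mem _ (ih hc.2 (by simpa using hl) hy)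
    · rw [hP.eq_of_arc_of_desc hc.1 h hy]
      simp

theorem desc_of_back (hP : P.Valid) {x y : V} (h : P.Back x y) : P.Desc y x := by
  obtain ⟨i, he, rfl⟩ := h
  exact hP.desc_out (by have := he.lt_left; omega)

theorem mem_of_back (hP : P.Valid) {x y : V} {st : List V} (hs : P.StackPath (x :: st))
    (h : P.Back x y) : y ∈ st := by
  have := hP.mem_of_desc hs.chain (hs.last _) (hP.desc_of_back h)
  rcases List.mem_cons.1 this with rfl | h'
  · exact absurd (hP.num_lt_of_back h) (lt_irrefl _)
  · exact h'

end Valid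

theorem StackPath.tail {V : Type} {P : Parse V} {x : V} {st : List V}
    (h : P.StackPath (x :: st)) : P.StackPath st where
  chain := h.chain.tail
  nodup := h.nodup.of_cons
  last hne := by
    have := h.last (List.cons_ne_nil _ _)
    rwa [List.getLast_cons hne] at this

theorem StackPath.cons {V : Type} {P : Parse V} {x y : V} {st : List V}
    (h : P.StackPath (x :: st)) (ha : P.Arc x y) (hy : y ∉ x :: st) :
    P.StackPath (y :: x :: st) where
  chain := List.isChain_cons_cons.2 ⟨ha, h.chain⟩
  nodup := List.nodup_cons.2 ⟨hy, h.nodup⟩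
  last hne := by
    rw [List.getLast_cons (List.cons_ne_nil _ _)]
    exact h.last _

namespace Valid

variable {V : Type} {P : Parse V}

/-- The head of a back arc is an ancestor of its tail, hence already on the stack below it; a simple
path thus never uses a back arc, and forward arcs lower the number. -/
theorem num_lt_of_mem (hP : P.Valid) {x y : V} {st : List V} (hs : P.StackPath (x :: st))
    (h : y ∈ st) : P.num x < P.num y := by
  induction st generalizing x with
  | nil => simp at h
  | cons z st ih =>
    have hz := hs.tail
    have h1 : P.num x < P.num z := by
      have ha := hs.chain
      rw [List.isChain_cons_cons] at ha
      rcases hP.arc_iff.1 ha.1 with hf | hb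
      · exact hP.num_lt_of_fwd hf
      · have := hs.nodup
        rw [List.nodup_cons] at this
        exact absurd (List.mem_cons_of_mem _ (hP.mem_of_back hz hb)) this.1
    rcases List.mem_cons.1 h with rfl | h
    · exact h1
    · exact h1.trans (ih hz h)

theorem not_mem_of_fwd (hP : P.Valid) {x y : V} {st : List V} (hs : P.StackPath (x :: st))
    (h : P.Fwd x y) : y ∉ x :: st := by
  intro hy
  have h1 := hP.num_lt_of_fwd h
  rcases List.mem_cons.1 hy with rfl | hy
  · exact lt_irrefl _ h1
  · exact lt_asymm h1 (hP.num_lt_of_mem hs hy)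

theorem not_fwd_of_back (hP : P.Valid) {x y : V} (h : P.Back x y) : ¬ P.Fwd x y := fun h' =>
  lt_asymm (hP.num_lt_of_back h) (hP.num_lt_of_fwd h')

theorem stackPath_of_dfsReach (_ : P.Valid) {st : List V} {S : Set V}
    (h : P.graph.DFSReach st S) : P.StackPath st ∧ ∀ x ∈ st, x ∈ S := by
  induction h with
  | start =>
    refine ⟨⟨by simp, by simp, fun _ => rfl⟩, fun x hx => by simpa using hx⟩
  | insert _ ha hw ih =>
    refine ⟨ih.1.cons ha fun h => hw (ih.2 _ h), fun x hx => ?_⟩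
    rcases List.mem_cons.1 hx with rfl | hx
    · exact Set.mem_insert _ _
    · exact Set.mem_insert_of_mem _ (ih.2 _ hx)
  | remove _ _ ih => exact ⟨ih.1.tail, fun x hx => ih.2 x (List.mem_cons_of_mem _ hx)⟩

/-- The two claims need a joint induction: the last child may be reachable only through the sink of
the first one, and the sink only through the last child. -/
theorem fwd_reach_snk_and_child (hP : P.Valid) (v : V) :
    Relation.ReflTransGen P.Fwd v (P.snk v) ∧
    ∀ i, i < (P.kd v).order → Relation.ReflTransGen P.Fwd v (P.ch v i) := by
  induction h : P.num v using Nat.strong_induction_on generalizing v with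
  | _ m ih =>
    have hch : ∀ i, i < (P.kd v).order → Relation.ReflTransGen P.Fwd v (P.ch v i) := by
      intro i hi
      by_cases h0 : i = 0
      · subst h0
        rw [hP.ch_zero]
      rcases StatementKind.exists_edge_to (by omega) hi with he | ⟨h1, h2⟩
      · exact .single ⟨v, 0, i, he, h0, (out_zero _ _).symm, rfl⟩
      · refine .tail (.head (b := P.ch v 1) ⟨v, 0, 1, h1, by simp, (out_zero _ _).symm, rfl⟩
          (ih _ (h ▸ hP.num_ch v 1 (by simp) h1.lt_right) _ rfl).1) ?_
        exact ⟨v, 1, i, h2, h0, (out_pos _ _ (by simp)).symm, rfl⟩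
    refine ⟨?_, hch⟩
    by_cases hv : P.kd v = .trivial
    · rw [hP.snk_trivial v hv]
    · rw [hP.snk_ch v hv]
      have hc := last_lt hv
      exact (hch _ hc.2).trans (ih _ (h ▸ hP.num_ch v _ hc.1 hc.2) _ rfl).1

theorem fwd_reach_out (hP : P.Valid) {v : V} {i : ℕ} (h : i < (P.kd v).order) :
    Relation.ReflTransGen P.Fwd v (P.out v i) := by
  by_cases h0 : i = 0
  · subst h0
    rw [out_zero]
  · rw [out_pos _ _ h0]
    exact ((hP.fwd_reach_snk_and_child v).2 i h).trans (hP.fwd_reach_snk_and_child _).1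

/-- Climbing to the parent raises `num`, which is bounded by its value at the root; this is the
measure of the induction, and the reason for the field `num_le_root`. -/
theorem fwd_reach_of_live (hP : P.Valid) {v : V} (hv : P.kd v ≠ .trivial) :
    Relation.ReflTransGen P.Fwd P.root v := by
  induction h : P.num P.root - P.num v using Nat.strong_induction_on generalizing v with
  | _ m ih =>
    rcases hP.live v hv with rfl | ⟨w, i, h0, h1, rfl⟩
    · exact .refl
    · have hw := StatementKind.ne_trivial_of_lt_order h0 h1
      have h2 := hP.num_ch w i h0 h1
      have h3 := hP.num_le_root w hw
      exact (ih _ (by omega) hw rfl).trans ((hP.fwd_reach_snk_and_child w).2 i h1)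

/-- As long as no visited vertex has a smaller number than the top of the stack, the next vertex of
a forward path is new. So some search follows the path without ever removing a vertex. -/
theorem exists_dfsReach (hP : P.Valid) {v u : V} {st : List V} {S : Set V}
    (h : P.graph.DFSReach (v :: st) S) (hS : ∀ x ∈ S, P.num v ≤ P.num x)
    (hr : Relation.ReflTransGen P.Fwd v u) :
    ∃ st' S', P.graph.DFSReach (u :: st') S' ∧ (∀ x ∈ S', P.num u ≤ P.num x) ∧
      ∀ x ∈ v :: st, x ∈ u :: st' := by
  induction hr with
  | refl => exact ⟨st, S, h, hS, fun _ h => h⟩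
  | @tail a b _ hab ih =>
    obtain ⟨st', S', h1, h2, h3⟩ := ih
    have hlt := hP.num_lt_of_fwd hab
    refine ⟨a :: st', insert b S', h1.insert hab.arc fun hb => ?_, ?_, fun x hx =>
      List.mem_cons_of_mem _ (h3 x hx)⟩
    · exact absurd (h2 b hb) (by omega)
    · intro x hx
      rcases Set.mem_insert_iff.1 hx with rfl | hx
      · exact le_rfl
      · exact hlt.le.trans (h2 x hx)

/-- A forward arc cannot end on the stack, since numbers grow towards the bottom. Conversely, for a
back arc some search descends along forward arcs from the root to `w` and on to the exit `u` inside
the expansion of `w`, keeping `w` on the stack. -/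
theorem isCycleEdge_iff (hP : P.Valid) {u w : V} : P.graph.IsCycleEdge u w ↔ P.Back u w := by
  constructor
  · rintro ⟨ha, st, S, h1, h2⟩
    rcases hP.arc_iff.1 ha with h | h
    · exact absurd (List.mem_cons_of_mem _ h2)
        (hP.not_mem_of_fwd (hP.stackPath_of_dfsReach h1).1 h)
    · exact h
  · intro h
    refine ⟨hP.arc_iff.2 (.inr h), ?_⟩
    obtain ⟨i, he, rfl⟩ := id h
    obtain ⟨st, S, h1, h2, -⟩ := hP.exists_dfsReach RootedDigraph.DFSReach.start
      (by intro x hx; rw [Set.mem_singleton_iff.1 hx])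
      (hP.fwd_reach_of_live he.ne_trivial)
    obtain ⟨st', S', h3, -, h4⟩ := hP.exists_dfsReach h1 h2
      (hP.fwd_reach_out (i := i) (by have := he.lt_left; omega))
    refine ⟨st', S', h3, ?_⟩
    rcases List.mem_cons.1 (h4 w (by simp)) with h5 | h5
    · exact absurd (hP.num_lt_of_back h) (by rw [← h5]; exact lt_irrefl _)
    · exact h5

/-! ### Vertices with a common sink -/

/-- A sink is the end of a chain of last children. Two such chains with the same end are comparable
because parents are unique. -/
theorem desc_last_of_snk_eq (hP : P.Valid) {x y : V} (h : P.snk x = P.snk y) :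
    Relation.ReflTransGen (fun a b => P.kd a ≠ .trivial ∧ b = P.ch a ((P.kd a).order - 1)) x y ∨
    Relation.ReflTransGen (fun a b => P.kd a ≠ .trivial ∧ b = P.ch a ((P.kd a).order - 1)) y x := by
  have base : ∀ z, Relation.ReflTransGen
      (fun a b => P.kd a ≠ .trivial ∧ b = P.ch a ((P.kd a).order - 1)) z (P.snk z) := by
    intro z
    induction hm : P.num z using Nat.strong_induction_on generalizing z with
    | _ m ih =>
      by_cases hv : P.kd z = .trivial
      · rw [hP.snk_trivial z hv]
      · rw [hP.snk_ch z hv]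
        exact .head ⟨hv, rfl⟩ (ih _ (hm ▸ hP.num_lt_of_child (child_last hv)) _ rfl)
  have key : ∀ z x y, Relation.ReflTransGen
      (fun a b => P.kd a ≠ .trivial ∧ b = P.ch a ((P.kd a).order - 1)) x z →
      Relation.ReflTransGen
      (fun a b => P.kd a ≠ .trivial ∧ b = P.ch a ((P.kd a).order - 1)) y z →
      Relation.ReflTransGen
      (fun a b => P.kd a ≠ .trivial ∧ b = P.ch a ((P.kd a).order - 1)) x y ∨
      Relation.ReflTransGen
      (fun a b => P.kd a ≠ .trivial ∧ b = P.ch a ((P.kd a).order - 1)) y x := by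
    intro z x y hx
    induction hx generalizing y with
    | refl => exact fun h => .inr h
    | @tail a b hxa hab ih =>
      intro hy
      rcases Relation.ReflTransGen.cases_tail hy with h | ⟨c, hyc, hcb⟩
      · left
        rw [← h]
        exact hxa.tail hab
      · have : a = c := hP.child_unique (w := b) (hab.2 ▸ child_last hab.1)
          (hcb.2 ▸ child_last hcb.1)
        subst this
        exact ih y hyc
  exact key _ x y (base x) (h ▸ base y)

/-- Two children that are not the last ones of their parents have different sinks. -/
theorem eq_of_snk_eq (hP : P.Valid) {v w : V} {i j : ℕ} (hi0 : 0 < i)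
    (hi : i + 1 < (P.kd v).order) (hj0 : 0 < j) (hj : j + 1 < (P.kd w).order)
    (h : P.snk (P.ch v i) = P.snk (P.ch w j)) : v = w ∧ i = j := by
  have aux : ∀ {v w : V} {i j : ℕ}, 0 < i → i + 1 < (P.kd v).order → 0 < j →
      j + 1 < (P.kd w).order →
      Relation.ReflTransGen (fun a b => P.kd a ≠ .trivial ∧ b = P.ch a ((P.kd a).order - 1))
        (P.ch v i) (P.ch w j) → v = w ∧ i = j := by
    intro v w i j hi0 hi hj0 hj h
    -- A non-empty chain of last children would make `P.ch w j` a last child, against `hj`.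
    rcases Relation.ReflTransGen.cases_tail h with h | ⟨a, -, ha, h⟩
    · exact hP.ch_inj _ _ _ _ hi0 (by omega) hj0 (by omega) h.symm
    · have := hP.ch_inj _ _ _ _ hj0 (by omega) (last_lt ha).1 (last_lt ha).2 h
      obtain ⟨rfl, h2⟩ := this
      omega
  rcases hP.desc_last_of_snk_eq h with h | h
  · exact aux hi0 hi hj0 hj h
  · obtain ⟨rfl, rfl⟩ := aux hj0 hj hi0 hi h
    exact ⟨rfl, rfl⟩

/-- The arcs leaving a vertex of non-trivial kind. -/
theorem arc_of_kd_ne (hP : P.Valid) {v y : V} (hv : P.kd v ≠ .trivial) :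
    P.Arc v y ↔ ∃ j, (P.kd v).Edge 0 j ∧ y = P.ch v j := by
  constructor
  · rintro ⟨w, i, j, he, h1, rfl⟩
    by_cases hi : i = 0
    · subst hi
      rw [out_zero] at h1
      subst h1
      exact ⟨j, he, rfl⟩
    · rw [out_pos _ _ hi] at h1
      rw [h1] at hv
      exact absurd (hP.kd_snk _) hv
  · rintro ⟨j, he, rfl⟩
    exact ⟨v, 0, j, he, (out_zero _ _).symm, rfl⟩

/-- The arcs leaving the sink of a child that is not the last one. -/
theorem arc_snk_iff (hP : P.Valid) {v y : V} {i : ℕ} (hi0 : 0 < i)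
    (hi : i + 1 < (P.kd v).order) :
    P.Arc (P.snk (P.ch v i)) y ↔ ∃ j, (P.kd v).Edge i j ∧ y = P.ch v j := by
  constructor
  · rintro ⟨w, i', j, he, h1, rfl⟩
    by_cases h0 : i' = 0
    · subst h0
      rw [out_zero] at h1
      exact absurd (h1 ▸ hP.kd_snk _) he.ne_trivial
    · rw [out_pos _ _ h0] at h1
      obtain ⟨rfl, rfl⟩ := hP.eq_of_snk_eq hi0 hi (by omega) he.lt_left h1
      exact ⟨j, he, rfl⟩
  · rintro ⟨j, he, rfl⟩
    exact ⟨v, i, j, he, (out_pos _ _ (by omega)).symm, rfl⟩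

/-- The arcs leaving a vertex of trivial kind. -/
theorem exists_of_arc_of_kd_eq (_ : P.Valid) {u y : V} (hu : P.kd u = .trivial)
    (h : P.Arc u y) : ∃ w i, 0 < i ∧ i + 1 < (P.kd w).order ∧ u = P.snk (P.ch w i) := by
  obtain ⟨w, i, j, he, h1, -⟩ := h
  by_cases h0 : i = 0
  · subst h0
    rw [out_zero] at h1
    subst h1
    exact absurd hu he.ne_trivial
  · exact ⟨w, i, by omega, he.lt_left, by rw [h1, out_pos _ _ h0]⟩

theorem fwd_ch_iff (hP : P.Valid) {u v : V} {j : ℕ} (h0 : 0 < j) (hj : j < (P.kd v).order) :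
    P.Fwd u (P.ch v j) ↔ ∃ i, (P.kd v).Edge i j ∧ u = P.out v i := by
  constructor
  · rintro ⟨w, i, j', he, hj', rfl, h⟩
    obtain ⟨rfl, rfl⟩ := hP.ch_inj _ _ _ _ h0 hj (by omega) he.lt_right h
    exact ⟨i, he, rfl⟩
  · rintro ⟨i, he, rfl⟩
    exact ⟨v, i, j, he, by omega, rfl, rfl⟩

end Valid

end Parse

/-! ### Prime subgraphs and contraction in terms of the parse -/

namespace StatementKind

theorem Edge.symm_zero {k : StatementKind} {i : ℕ} (h : k.Edge i 0) : k.Edge 0 i := by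
  cases k <;> simp [Edge] at * <;> omega

/-- An edge leaving a vertex other than the source has company: either that vertex has an edge
into the source, or the head of the edge has another in-neighbor. -/
theorem Edge.exists_other {k : StatementKind} {i j : ℕ} (h : k.Edge i j) (hi : 0 < i) :
    k.Edge i 0 ∨ ∃ i', i' ≠ i ∧ k.Edge i' j := by
  cases k with
  | trivial => exact h.elim
  | sequence => simp only [Edge] at h; omega
  | ifThen => right; exact ⟨0, by omega, by simp [Edge] at *; omega⟩
  | whileLoop => left; simp [Edge] at *; omega
  | repeatLoop => left; simp [Edge] at *; omega
  | ifThenElse => right; exact ⟨3 - i, by simp only [Edge] at *; omega⟩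
  | pCase p hp =>
    right
    by_cases h1 : i = 1
    · exact ⟨2, by simp only [Edge] at *; omega⟩
    · exact ⟨1, by simp only [Edge] at *; omega⟩

/-- The string of the source is never read. This matters because the entry of a vertex is still
provisional while its own code is being assembled. -/
theorem code_congr {k : StatementKind} {c c' : Fin k.order → List ℕ}
    (h : ∀ i, i ≠ k.src → c i = c' i) : k.code c = k.code c' := by
  have h' : ∀ i (hi : i < k.order), i ≠ 0 → c ⟨i, hi⟩ = c' ⟨i, hi⟩ := fun i hi h0 =>
    h _ fun e => h0 (congrArg Fin.val e)
  cases k with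
  | trivial => rfl
  | pCase p hp =>
    simp only [code]
    rw [show c (Fin.last (p + 1)) = c' (Fin.last (p + 1)) from h' _ _ (by simp)]
    congr 4
    funext i
    exact h' _ _ (by simp)
  | ifThenElse =>
    simp only [code]
    rw [show c (1 : Fin 4) = c' (1 : Fin 4) from h' _ _ (by decide),
      show c (2 : Fin 4) = c' (2 : Fin 4) from h' _ _ (by decide),
      show c (3 : Fin 4) = c' (3 : Fin 4) from h' _ _ (by decide)]
  | sequence =>
    simp only [code]
    rw [show c (1 : Fin 2) = c' (1 : Fin 2) from h' _ _ (by decide)]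
  | _ =>
    simp only [code]
    rw [show c (1 : Fin 3) = c' (1 : Fin 3) from h' _ _ (by decide),
      show c (2 : Fin 3) = c' (2 : Fin 3) from h' _ _ (by decide)]

end StatementKind

namespace Parse

namespace Valid

variable {V : Type} {P : Parse V}

theorem out_injective (hP : P.Valid) {w : V} {i j : ℕ} (hi : i + 1 < (P.kd w).order)
    (hj : j + 1 < (P.kd w).order) (h : P.out w i = P.out w j) : i = j := by
  have hw : P.kd w ≠ .trivial := by
    intro h
    simp [h, StatementKind.order] at hi
  by_cases hi0 : i = 0 <;> by_cases hj0 : j = 0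
  · omega
  · subst hi0
    rw [out_zero, out_pos _ _ hj0] at h
    exact absurd (h ▸ hP.kd_snk _) hw
  · subst hj0
    rw [out_zero, out_pos _ _ hi0] at h
    exact absurd (h ▸ hP.kd_snk _) hw
  · rw [out_pos _ _ hi0, out_pos _ _ hj0] at h
    exact (hP.eq_of_snk_eq (by omega) hi (by omega) hj h).2

/-- The arcs leaving the sink of a subtree leave the subtree. -/
theorem not_desc_of_arc_snk (hP : P.Valid) {v y : V} (h : P.Arc (P.snk v) y) :
    ¬ P.Desc v y := by
  obtain ⟨w, i, j, he, h1, rfl⟩ := h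
  have hi : i ≠ 0 := by
    rintro rfl
    rw [out_zero] at h1
    exact he.ne_trivial (h1 ▸ hP.kd_snk v)
  rw [out_pos _ _ hi] at h1
  have hil := he.lt_left
  -- The child `P.ch w i` has the same sink as `v` and is not a last child, so it lies at the upper
  -- end of the common chain of last children.
  have hd : P.Desc (P.ch w i) v := by
    rcases hP.desc_last_of_snk_eq h1 with h | h
    · rcases Relation.ReflTransGen.cases_tail h with h | ⟨a, -, ha, h⟩
      · rw [h]
        exact .refl
      · obtain ⟨rfl, h2⟩ := hP.ch_inj _ _ _ _ (by omega) (by omega) (last_lt ha).1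
          (last_lt ha).2 h
        omega
    · exact Relation.ReflTransGen.mono (fun a b hab => hab.2 ▸ child_last hab.1) _ _ h
  intro hy
  have hnum := hP.num_ch w i (by omega) (by omega)
  have hy' := hd.trans hy
  -- An arc back into the subtree of `v` would place `w` below its own child, contradicting `hnum`.
  have : P.Desc (P.ch w i) w := by
    by_cases hj : j = 0
    · subst hj
      rwa [hP.ch_zero] at hy'
    · refine hP.desc_of_desc_child hy' ⟨j, by omega, he.lt_right, rfl⟩ fun h => he.ne ?_
      exact (hP.ch_inj _ _ _ _ (by omega) (by omega) (by omega) he.lt_right h).2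
  have := hP.num_le_of_desc this
  omega

section collapse

variable {v : V} (hv : P.kd v ≠ .trivial)
  (hc : ∀ i, 0 < i → i < (P.kd v).order → P.kd (P.ch v i) = .trivial)

include hc in
theorem out_eq_ch (hP : P.Valid) {i : ℕ} (hi : i < (P.kd v).order) : P.out v i = P.ch v i := by
  by_cases h0 : i = 0
  · subst h0
    rw [out_zero, hP.ch_zero]
  · rw [out_pos _ _ h0, hP.snk_trivial _ (hc i (by omega) hi)]

theorem ch_injective (hP : P.Valid) {i j : ℕ} (hi : i < (P.kd v).order)
    (hj : j < (P.kd v).order) (h : P.ch v i = P.ch v j) : i = j := by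
  by_cases hi0 : i = 0 <;> by_cases hj0 : j = 0
  · omega
  · subst hi0
    have := hP.num_ch v j (by omega) hj
    rw [← h, hP.ch_zero] at this
    omega
  · subst hj0
    have := hP.num_ch v i (by omega) hi
    rw [h, hP.ch_zero] at this
    omega
  · exact (hP.ch_inj _ _ _ _ (by omega) hi (by omega) hj h).2

include hv hc in
theorem arc_ch_out (hP : P.Valid) {i : ℕ} {y : V} (hi : i + 1 < (P.kd v).order) :
    P.Arc (P.ch v i) y ↔ ∃ j, (P.kd v).Edge i j ∧ y = P.ch v j := by
  by_cases h0 : i = 0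
  · subst h0
    rw [hP.ch_zero]
    exact hP.arc_of_kd_ne hv
  · have := hP.arc_snk_iff (y := y) (Nat.pos_of_ne_zero h0) hi
    rwa [hP.snk_trivial _ (hc i (by omega) (by omega))] at this

include hv hc in
theorem arc_ch_ch (hP : P.Valid) {i j : ℕ} (hi : i < (P.kd v).order) (hj : j < (P.kd v).order) :
    P.Arc (P.ch v i) (P.ch v j) ↔ (P.kd v).Edge i j := by
  constructor
  · intro h
    by_cases hl : i + 1 < (P.kd v).order
    · obtain ⟨j', he, h2⟩ := (hP.arc_ch_out hv hc hl).1 h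
      rwa [hP.ch_injective hj he.lt_right h2]
    · have hil : i = (P.kd v).order - 1 := by omega
      have : P.snk v = P.ch v i := by
        rw [hP.snk_ch v hv, ← hil, hP.snk_trivial]
        exact hc i (hil ▸ (last_lt hv).1) hi
      rw [← this] at h
      refine absurd ?_ (hP.not_desc_of_arc_snk h)
      by_cases h0 : j = 0
      · subst h0
        rw [hP.ch_zero]
        exact .refl
      · exact .single ⟨j, by omega, hj, rfl⟩
  · intro he
    exact ⟨v, i, j, he, (hP.out_eq_ch hc hi).symm, rfl⟩

include hv hc in
/-- A vertex all of whose children have trivial kind is the source of a prime subgraph. -/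
theorem isPrime (hP : P.Valid) :
    P.graph.IsPrime (P.kd v) (fun i : Fin (P.kd v).order => P.ch v i) where
  nontrivial := hv
  injective i j h := Fin.ext (hP.ch_injective i.2 j.2 h)
  adj_iff i j := hP.arc_ch_ch hv hc i.2 j.2
  cycle_iff i j := by
    rw [hP.isCycleEdge_iff]
    constructor
    · intro h
      have he := (hP.arc_ch_ch hv hc i.2 j.2).1 (hP.arc_iff.2 (.inr h))
      refine ⟨he, ?_⟩
      by_contra hj
      have hj' : (j : ℕ) ≠ 0 := fun h => hj (Fin.ext h)
      exact hP.not_fwd_of_back h ⟨v, i, j, he, hj', (hP.out_eq_ch hc i.2).symm, rfl⟩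
    · rintro ⟨he, rfl⟩
      refine ⟨i, ?_, ?_⟩
      · change (P.kd (P.ch v 0)).Edge i 0
        rw [hP.ch_zero]
        exact he
      · change _ = P.out (P.ch v 0) i
        rw [hP.ch_zero, hP.out_eq_ch hc i.2]
  closed_in i hi u h := by
    have hi' : 0 < (i : ℕ) := Nat.pos_of_ne_zero fun h => hi (Fin.ext h)
    rcases hP.arc_iff.1 h with h | ⟨i', he, -⟩
    · obtain ⟨i', he, rfl⟩ := (hP.fwd_ch_iff hi' i.2).1 h
      have hl : i' < (P.kd v).order := by have := he.lt_left; omega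
      exact ⟨⟨i', hl⟩, (hP.out_eq_ch hc hl).symm⟩
    · exact absurd (hc i hi' i.2) he.ne_trivial
  closed_out i hi u h := by
    have hi' : (i : ℕ) + 1 < (P.kd v).order := by
      have := i.2
      have : (i : ℕ) ≠ (P.kd v).order - 1 := fun h => hi (Fin.ext h)
      omega
    obtain ⟨j, he, rfl⟩ := (hP.arc_ch_out hv hc hi').1 h
    exact ⟨⟨j, he.lt_right⟩, rfl⟩
  closed_cycle u h := by
    change P.Arc (P.ch v 0) u
    change P.graph.IsCycleEdge u (P.ch v 0) at h
    rw [hP.ch_zero] at h ⊢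
    rw [hP.isCycleEdge_iff] at h
    obtain ⟨i, he, rfl⟩ := h
    rw [hP.out_eq_ch hc (by have := he.lt_left; omega)]
    exact (hP.arc_of_kd_ne hv).2 ⟨i, he.symm_zero, rfl⟩

/-- A leaf with an out-arc is the sink of a non-last child of some `w`, so by `exists_other` its arc
has company. If that is an arc back to `w`, closedness puts `w` in the prime subgraph, whose only
cycle edges enter its source; then the leaf would be `w` itself. If it is a second arc into the same
head, this contradicts the uniqueness of the in-neighbor of vertex `1`, as that vertex is such a
head. -/
theorem not_isPrime (hP : P.Valid) {u : V} (hu : P.kd u = .trivial) :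
    ¬ ∃ (k : StatementKind) (φ : Fin k.order → V), P.graph.IsPrime k φ ∧ φ k.src = u := by
  rintro ⟨k, φ, h, rfl⟩
  have h2 := StatementKind.two_le_order h.nontrivial
  have he1 := StatementKind.edge_zero_one h.nontrivial
  have hsrc : k.src ≠ k.snk := by
    intro h
    have := congrArg Fin.val h
    simp [StatementKind.src, StatementKind.snk] at this
    omega
  have harc : P.Arc (φ k.src) (φ ⟨1, h2⟩) := (h.adj_iff k.src ⟨1, h2⟩).2 he1
  have huniq : ∀ x, P.Arc x (φ ⟨1, h2⟩) → x = φ k.src := by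
    intro x hx
    obtain ⟨i, rfl⟩ := h.closed_in ⟨1, h2⟩ (by simp [StatementKind.src, Fin.ext_iff]) x hx
    have := StatementKind.edge_one_unique ((h.adj_iff i ⟨1, h2⟩).1 hx)
    congr 1
    exact Fin.ext this
  obtain ⟨w, i, hi0, hi, huw⟩ := hP.exists_of_arc_of_kd_eq hu harc
  have harc' := harc
  rw [huw, hP.arc_snk_iff hi0 hi] at harc'
  obtain ⟨j, he, hj⟩ := harc'
  have hnb : ¬ (P.kd w).Edge i 0 := by
    intro he0
    have hb : P.Back (φ k.src) w := ⟨i, he0, by rw [huw, out_pos _ _ (by omega)]⟩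
    obtain ⟨l, hl⟩ := h.closed_out k.src hsrc w (hP.arc_iff.2 (.inr hb))
    rw [← hl, ← hP.isCycleEdge_iff, h.cycle_iff] at hb
    obtain rfl := hb.2
    have hb' : P.Back (φ k.src) w := ⟨i, he0, by rw [huw, out_pos _ _ (by omega)]⟩
    rw [hl] at hb'
    exact absurd (hP.num_lt_of_back hb') (lt_irrefl _)
  rcases he.exists_other hi0 with h | ⟨i', hne, he'⟩
  · exact hnb h
  · have := huniq (P.out w i') (by rw [hj]; exact ⟨w, i', j, he', rfl, rfl⟩)
    rw [huw, ← out_pos _ _ (by omega : i ≠ 0)] at this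
    exact hne (hP.out_injective he'.lt_left hi this)

end collapse

end Valid

open Classical in
/-- The parse after the contraction of the complete expansion of `v`, all of whose children have
trivial kind. -/
noncomputable def collapse {V : Type} (P : Parse V) (v : V) : Parse V where
  root := P.root
  kd w := if w = v then .trivial else P.kd w
  ch := P.ch
  snk x := if P.Child v x then x
    else if P.snk x = P.ch v ((P.kd v).order - 1) then v else P.snk x
  num := P.num

namespace Valid

variable {V : Type} {P : Parse V} {v : V} (hv : P.kd v ≠ .trivial)
  (hc : ∀ i, 0 < i → i < (P.kd v).order → P.kd (P.ch v i) = .trivial)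

theorem collapse_kd_of_ne {w : V} (h : w ≠ v) : (P.collapse v).kd w = P.kd w := by
  simp [collapse, h]

theorem ne_of_collapse_kd {w : V} (h : (P.collapse v).kd w ≠ .trivial) : w ≠ v := by
  rintro rfl
  simp [collapse] at h

theorem ne_of_collapse_order {w : V} {i : ℕ} (h0 : 0 < i)
    (h : i < ((P.collapse v).kd w).order) : w ≠ v ∧ i < (P.kd w).order := by
  have := ne_of_collapse_kd (StatementKind.ne_trivial_of_lt_order h0 h)
  exact ⟨this, by rwa [collapse_kd_of_ne this] at h⟩

include hc in
theorem kd_of_child {x : V} (h : P.Child v x) : P.kd x = .trivial := by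
  obtain ⟨i, h0, h1, rfl⟩ := h
  exact hc i h0 h1

include hv hc in
theorem snk_eq_last (hP : P.Valid) : P.snk v = P.ch v ((P.kd v).order - 1) := by
  rw [hP.snk_ch v hv, hP.snk_trivial]
  exact hc _ (last_lt hv).1 (last_lt hv).2

include hv hc in
/-- The exits of an expanded vertex other than `v`, before and after the collapse. -/
theorem collapse_out (hP : P.Valid) {w : V} {i : ℕ} (hw : w ≠ v)
    (hi : i + 1 < (P.kd w).order) :
    ((P.out w i = P.ch v ((P.kd v).order - 1) ∧ (P.collapse v).out w i = v) ∨
    ((∀ j, j < (P.kd v).order → P.out w i ≠ P.ch v j) ∧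
      (P.collapse v).out w i = P.out w i)) := by
  have hkw : P.kd w ≠ .trivial := by
    intro h
    simp [h, StatementKind.order] at hi
  by_cases h0 : i = 0
  · subst h0
    right
    rw [out_zero, out_zero]
    refine ⟨fun j hj hwj => ?_, rfl⟩
    by_cases hj0 : j = 0
    · subst hj0
      rw [hP.ch_zero] at hwj
      exact hw hwj
    · exact hkw (hwj ▸ hc j (by omega) hj)
  · rw [out_pos _ _ h0, out_pos _ _ h0]
    have hnc : ¬ P.Child v (P.ch w i) := by
      rintro ⟨j, hj0, hj, h⟩
      exact hw (hP.ch_inj _ _ _ _ hj0 hj (by omega) (by omega) h).1.symm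
    by_cases hl : P.snk (P.ch w i) = P.ch v ((P.kd v).order - 1)
    · left
      exact ⟨hl, by simp [collapse, hnc, hl]⟩
    · right
      refine ⟨fun j hj h => ?_, by simp [collapse, hnc, hl]⟩
      by_cases hj0 : j = 0
      · subst hj0
        rw [hP.ch_zero] at h
        exact hv (h ▸ hP.kd_snk _)
      · by_cases hjl : j + 1 < (P.kd v).order
        -- A non-last child of `v` is its own sink, and sinks of non-last children determine the
        -- parent.
        · rw [← hP.snk_trivial _ (hc j (by omega) hj)] at h
          exact hw (hP.eq_of_snk_eq (by omega) hi (by omega) hjl h).1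
        · exact hl (by rw [h]; congr 1; omega)

include hv hc in
-- Only exits that went through the last child of `v` change: they now leave from `v`, whose number
-- is larger, so forward arcs still descend. The former children become isolated leaves and must be
-- their own sinks.
theorem collapse (hP : P.Valid) : (P.collapse v).Valid where
  ch_zero := hP.ch_zero
  num_ch w i h0 h := hP.num_ch w i h0 (ne_of_collapse_order h0 h).2
  num_fwd w i j he hj := by
    have hw := ne_of_collapse_kd he.ne_trivial
    rw [collapse_kd_of_ne hw] at he
    have h1 := hP.num_fwd w i j he hj
    rcases hP.collapse_out hv hc hw he.lt_left with ⟨h2, h3⟩ | ⟨-, h3⟩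
    · rw [h3]
      rw [h2] at h1
      exact h1.trans (hP.num_ch v _ (last_lt hv).1 (last_lt hv).2)
    · rw [h3]
      exact h1
  ch_inj x i y j h0 h h0' h' heq :=
    hP.ch_inj x i y j h0 (ne_of_collapse_order h0 h).2 h0' (ne_of_collapse_order h0' h').2 heq
  ch_ne_root w i h0 h := hP.ch_ne_root w i h0 (ne_of_collapse_order h0 h).2
  snk_trivial w hw := by
    by_cases hwv : w = v
    · subst hwv
      have : ¬ P.Child w w := fun h => lt_irrefl _ (hP.num_lt_of_child h)
      simp [Parse.collapse, this, hP.snk_eq_last hv hc]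
    · rw [collapse_kd_of_ne hwv] at hw
      have h1 := hP.snk_trivial w hw
      by_cases hcw : P.Child v w
      · simp [Parse.collapse, hcw]
      · have : w ≠ P.ch v ((P.kd v).order - 1) := by
          rintro rfl
          exact hcw (child_last hv)
        simp [Parse.collapse, hcw, h1, this]
  snk_ch w hw := by
    have hwv := ne_of_collapse_kd hw
    rw [collapse_kd_of_ne hwv] at hw ⊢
    have h1 : ¬ P.Child v w := fun h => hw (kd_of_child hc h)
    have h2 : ¬ P.Child v (P.ch w ((P.kd w).order - 1)) := fun h =>
      hwv (hP.child_unique (child_last hw) h)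
    simp only [Parse.collapse, h1, h2, if_false]
    rw [← hP.snk_ch w hw]
  live w hw := by
    have hwv := ne_of_collapse_kd hw
    rw [collapse_kd_of_ne hwv] at hw
    rcases hP.live w hw with h | ⟨p, i, h0, h1, h2⟩
    · exact .inl h
    · refine .inr ⟨p, i, h0, ?_, h2⟩
      rw [collapse_kd_of_ne]
      · exact h1
      · rintro rfl
        exact hw (h2 ▸ hc i h0 h1)
  num_le_root w hw := hP.num_le_root w (by rwa [collapse_kd_of_ne (ne_of_collapse_kd hw)] at hw)

include hv hc in
-- The arcs inside the statement graph of `v` become loops and are discarded. For every other inner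
-- node, coalescing moves an exit only if it was the last child of `v`, and moves no entrance, which
-- is precisely the effect of `Parse.collapse`.
theorem contract_graph (hP : P.Valid) :
    P.graph.contract (Set.range fun i : Fin (P.kd v).order => P.ch v i) v =
      (P.collapse v).graph := by
  have hpos := (P.kd v).order_pos
  set S := Set.range fun i : Fin (P.kd v).order => P.ch v i with hS
  have hmem : ∀ {i}, i < (P.kd v).order → P.ch v i ∈ S := fun {i} hi => ⟨⟨i, hi⟩, rfl⟩
  have hvS : v ∈ S := by
    have := hmem hpos
    rwa [hP.ch_zero] at this
  have himg : ∀ {x}, x ∈ S → RootedDigraph.image S v x = v := fun h => by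
    simp [RootedDigraph.image, h]
  have hout : ∀ {w i}, w ≠ v → i + 1 < (P.kd w).order →
      RootedDigraph.image S v (P.out w i) = (P.collapse v).out w i := by
    intro w i hw hi
    rcases hP.collapse_out hv hc hw hi with ⟨h2, h3⟩ | ⟨h2, h3⟩
    · rw [h3, h2]
      exact himg (hmem (last_lt hv).2)
    · rw [h3]
      have : P.out w i ∉ S := by
        rintro ⟨j, hj⟩
        exact h2 j j.2 hj.symm
      simp [RootedDigraph.image, this]
  have hch : ∀ {w j}, w ≠ v → P.kd w ≠ .trivial → j < (P.kd w).order →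
      RootedDigraph.image S v (P.ch w j) = P.ch w j := by
    intro w j hw hwk hj
    by_cases hm : P.ch w j ∈ S
    · rw [himg hm]
      obtain ⟨⟨i, hi⟩, hij⟩ := hm
      simp only at hij
      by_cases hi0 : i = 0
      · subst hi0
        rw [← hij, hP.ch_zero]
      · exfalso
        by_cases hj0 : j = 0
        · subst hj0
          rw [hP.ch_zero] at hij
          exact hwk (hij ▸ hc i (by omega) hi)
        · exact hw (hP.ch_inj _ _ _ _ (by omega) hi (by omega) hj hij).1.symm
    · simp [RootedDigraph.image, hm]
  refine RootedDigraph.ext_adj (fun x y => ?_) ?_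
  · constructor
    · rintro ⟨hne, _, _, rfl, rfl, w, i, j, he, rfl, rfl⟩
      by_cases hw : w = v
      · subst hw
        refine absurd ?_ hne
        rw [hP.out_eq_ch hc (by have := he.lt_left; omega), himg (hmem he.lt_right),
          himg (hmem (by have := he.lt_left; omega))]
      · rw [hout hw he.lt_left, hch hw he.ne_trivial he.lt_right]
        exact ⟨w, i, j, by rwa [collapse_kd_of_ne hw], rfl, rfl⟩
    · intro h
      refine ⟨?_, ?_⟩
      · rintro rfl
        exact (hP.collapse hv hc).not_arc_self x h
      · obtain ⟨w, i, j, he, rfl, rfl⟩ := h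
        have hw := ne_of_collapse_kd he.ne_trivial
        rw [collapse_kd_of_ne hw] at he
        exact ⟨_, _, hout hw he.lt_left, hch hw he.ne_trivial he.lt_right, w, i, j, he, rfl, rfl⟩
  · change RootedDigraph.image S v P.root = P.root
    by_cases hm : P.root ∈ S
    · rw [himg hm]
      obtain ⟨⟨i, hi⟩, hir⟩ := hm
      simp only at hir
      by_cases hi0 : i = 0
      · subst hi0
        rw [← hir, hP.ch_zero]
      · exact absurd hir (hP.ch_ne_root v i (by omega) hi)
    · simp [RootedDigraph.image, hm]

end Valid

/-! ### The sweep computes the recursive code -/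

/-- `code` satisfies the recursion of the encoding along the parse `P`. -/
def IsCode {V : Type} (P : Parse V) (code : V → List ℕ) : Prop :=
  ∀ v, code v = [1] ++ (P.kd v).code (fun i => code (P.ch v i))

namespace Valid

variable {V : Type} {P : Parse V}

/-- The current parse `Q` differs from `P` only in kinds and sinks: unprocessed vertices keep their
kind, processed ones have become leaves and own their final code. With `num` non-decreasing along
`l`, the children of the next vertex are already processed, so an inner node is prime and its
collapse restores the invariant. -/
theorem sweep [DecidableEq V] {code : V → List ℕ} (hcode : P.IsCode code) (l : List V) :
    ∀ (Q : Parse V) (C : V → List ℕ), Q.Valid → Q.ch = P.ch → Q.num = P.num → Q.root = P.root →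
    (∀ v ∈ l, Q.kd v = P.kd v) → (∀ v, v ∉ l → Q.kd v = .trivial ∧ C v = code v) →
    l.Pairwise (fun a b => P.num a ≤ P.num b) → l.Nodup →
    ∃ G' C', RootedDigraph.Sweep Q.graph C l G' C' ∧ ∀ v, C' v = code v := by
  induction l with
  | nil =>
    intro Q C hQ _ _ _ _ h _ _
    exact ⟨_, _, .done _ _, fun v => (h v (by simp)).2⟩
  | cons v l ih =>
    intro Q C hQ hch hnum hroot hl hn hs hnd
    have hkv := hl v (by simp)
    rw [List.pairwise_cons] at hs
    rw [List.nodup_cons] at hnd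
    by_cases hv : Q.kd v = .trivial
    · have hside : ∀ w, w ∉ l →
          Q.kd w = .trivial ∧ Function.update C v [1] w = code w := by
        intro w hw
        by_cases hwv : w = v
        · subst hwv
          refine ⟨hv, ?_⟩
          rw [Function.update_self, hcode w, ← hkv, hv]
          rfl
        · rw [Function.update_of_ne hwv]
          exact hn w (by simp [hwv, hw])
      obtain ⟨G', C', h1, h2⟩ := ih Q (Function.update C v [1]) hQ hch hnum hroot
        (fun w hw => hl w (List.mem_cons_of_mem _ hw)) hside hs.2 hnd.2
      exact ⟨G', C', .skip (hQ.not_isPrime hv) h1, h2⟩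
    · have hnot : ∀ i, 0 < i → i < (Q.kd v).order → Q.ch v i ∉ v :: l := by
        intro i h0 hi hm
        have h1 := hQ.num_ch v i h0 hi
        rw [hnum] at h1
        rcases List.mem_cons.1 hm with h | h
        · rw [h] at h1
          exact lt_irrefl _ h1
        · exact absurd (hs.1 _ h) (by omega)
      have hc : ∀ i, 0 < i → i < (Q.kd v).order → Q.kd (Q.ch v i) = .trivial := fun i h0 hi =>
        (hn _ (hnot i h0 hi)).1
      have hside : ∀ w, w ∉ l → (Q.collapse v).kd w = .trivial ∧
          Function.update C v ([1] ++ (Q.kd v).code fun i => C (Q.ch v i)) w = code w := by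
        intro w hw
        by_cases hwv : w = v
        · subst hwv
          refine ⟨by simp [Parse.collapse], ?_⟩
          rw [Function.update_self, hcode w, ← hkv, ← hch]
          congr 1
          refine StatementKind.code_congr fun i hi => ?_
          refine (hn _ (hnot i ?_ i.2)).2
          exact Nat.pos_of_ne_zero fun h => hi (Fin.ext h)
        · rw [Function.update_of_ne hwv, collapse_kd_of_ne hwv]
          exact hn w (by simp [hwv, hw])
      have hkd : ∀ w ∈ l, (Q.collapse v).kd w = P.kd w := by
        intro w hw
        rw [collapse_kd_of_ne]
        · exact hl w (List.mem_cons_of_mem _ hw)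
        · rintro rfl
          exact hnd.1 hw
      obtain ⟨G', C', h1, h2⟩ := ih (Q.collapse v)
        (Function.update C v ([1] ++ (Q.kd v).code fun i => C (Q.ch v i)))
        (hQ.collapse hv hc) hch hnum hroot hkd hside hs.2 hnd.2
      refine ⟨G', C', .prime (Q.kd v) (fun i => Q.ch v i) (hQ.isPrime hv hc) (hQ.ch_zero v) ?_,
        h2⟩
      rw [hQ.contract_graph hv hc]
      exact h1

/-- The code given by the parse is produced by the encoding algorithm. -/
theorem encodes [Fintype V] [DecidableEq V] (hP : P.Valid) {code : V → List ℕ}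
    (hcode : P.IsCode code) : P.graph.Encodes (code P.root) := by
  -- Forward arcs lower `num`, so listing by increasing `num` gives the reverse of a topological
  -- sorting.
  let l := (Finset.univ : Finset V).toList.insertionSort (fun a b => P.num a ≤ P.num b)
  have hperm : l.Perm (Finset.univ : Finset V).toList := List.perm_insertionSort _ _
  have hmem : ∀ v, v ∈ l := fun v => by
    rw [hperm.mem_iff]
    simp
  have hnd : l.Nodup := hperm.nodup_iff.2 (Finset.nodup_toList _)
  have hs : l.Pairwise (fun a b => P.num a ≤ P.num b) := by
    have : Std.Total (fun a b : V => P.num a ≤ P.num b) := ⟨fun a b => le_total _ _⟩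
    have : IsTrans V (fun a b : V => P.num a ≤ P.num b) := ⟨fun a b c => le_trans⟩
    exact List.pairwise_insertionSort _ _
  obtain ⟨G', C', h1, h2⟩ := sweep hcode l P (fun _ => []) hP rfl rfl rfl (fun _ _ => rfl)
    (fun v hv => absurd (hmem v) hv) hs hnd
  refine ⟨l.reverse, G', C', ⟨List.nodup_reverse.2 hnd, fun v => List.mem_reverse.2 (hmem v), ?_⟩,
    by rwa [List.reverse_reverse], (h2 _).symm⟩
  rw [List.pairwise_reverse]
  refine hs.imp fun {a b} hab h => ?_
  rw [hP.isCycleEdge_iff] at h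
  rcases hP.arc_iff.1 h.1 with h' | h'
  · have := hP.num_lt_of_fwd h'
    omega
  · exact h.2 h'

theorem exists_isCode (hP : P.Valid) : ∃ code : V → List ℕ, P.IsCode code := by
  refine ⟨(measure P.num).wf.fix fun v rec => [1] ++ (P.kd v).code fun i =>
    -- The default is taken only at `i = 0`, whose string does not enter the code.
    if h : P.num (P.ch v i) < P.num v then rec _ h else [], fun v => ?_⟩
  rw [WellFounded.fix_eq]
  congr 1
  refine StatementKind.code_congr fun i hi => ?_
  exact dif_pos (hP.num_ch v i (Nat.pos_of_ne_zero fun h => hi (Fin.ext h)) i.2)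

end Valid

end Parse

/-! ## Reasoning about programs -/

namespace RAM

namespace State

@[simp] theorem setReg_reg (s : State) (d x r : ℕ) :
    (s.setReg d x).reg r = if r = d then x else s.reg r := by
  simp [setReg, Function.update_apply]

@[simp] theorem setReg_mem (s : State) (d x : ℕ) : (s.setReg d x).mem = s.mem := rfl

@[simp] theorem setMem_reg (s : State) (A i x : ℕ) : (s.setMem A i x).reg = s.reg := rfl

@[simp] theorem setMem_mem (s : State) (A i x B : ℕ) :
    (s.setMem A i x).mem B = if B = A then Function.update (s.mem A) i x else s.mem B := by
  by_cases h : B = A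
  · subst h
    simp [setMem]
  · simp [setMem, h]

end State

namespace Program

/-- Sequential composition of a list of programs. -/
def block : List Program → Program
  | [] => skip
  | P :: L => seq P (block L)

/-- The registers written by a program. -/
def regs : Program → List ℕ
  | skip => []
  | instr (.const d _) => [d]
  | instr (.copy d _) => [d]
  | instr (.inc d) => [d]
  | instr (.dec d) => [d]
  | instr (.load d _ _) => [d]
  | instr (.store _ _ _) => []
  | seq P Q => P.regs ++ Q.regs
  | ite _ P Q => P.regs ++ Q.regs
  | loop _ P => P.regs

/-- The arrays written by a program. -/
def arrs : Program → List ℕ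
  | instr (.store A _ _) => [A]
  | seq P Q => P.arrs ++ Q.arrs
  | ite _ P Q => P.arrs ++ Q.arrs
  | loop _ P => P.arrs
  | _ => []

end Program

/-- The states agree on everything that `P` does not write. -/
structure Same (P : Program) (s s' : State) : Prop where
  reg : ∀ r, r ∉ P.regs → s'.reg r = s.reg r
  mem : ∀ A, A ∉ P.arrs → s'.mem A = s.mem A

theorem Same.refl (P : Program) (s : State) : Same P s s := ⟨fun _ _ => rfl, fun _ _ => rfl⟩

theorem Same.trans {P : Program} {s s' s'' : State} (h : Same P s s') (h' : Same P s' s'') :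
    Same P s s'' :=
  ⟨fun r hr => (h'.reg r hr).trans (h.reg r hr), fun A hA => (h'.mem A hA).trans (h.mem A hA)⟩

theorem Same.mono {P Q : Program} {s s' : State} (h : Same P s s') (hr : P.regs ⊆ Q.regs)
    (ha : P.arrs ⊆ Q.arrs) : Same Q s s' :=
  ⟨fun r h' => h.reg r fun h'' => h' (hr h''), fun A h' => h.mem A fun h'' => h' (ha h'')⟩

theorem Run.same {P : Program} {s s' : State} {t : ℕ} (h : Run P s s' t) : Same P s s' := by
  induction h with
  | skip s => exact .refl _ _
  | instr c s =>
    cases c <;> constructor <;> intro r hr <;>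
      simp_all [Instr.apply, Program.regs, Program.arrs]
  | seq _ _ ih1 ih2 =>
    exact (ih1.mono (by simp [Program.regs]) (by simp [Program.arrs])).trans
      (ih2.mono (by simp [Program.regs]) (by simp [Program.arrs]))
  | ite_true _ _ ih => exact ih.mono (by simp [Program.regs]) (by simp [Program.arrs])
  | ite_false _ _ ih => exact ih.mono (by simp [Program.regs]) (by simp [Program.arrs])
  | loop_true _ _ _ ih1 ih2 =>
    exact (ih1.mono (by simp [Program.regs]) (by simp [Program.arrs])).trans ih2
  | loop_false _ => exact .refl _ _

/-- Started in `s`, the program `P` terminates, and the final state and the number of steps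
satisfy `Q`. -/
def Runs (P : Program) (s : State) (Q : State → ℕ → Prop) : Prop :=
  ∃ s' t, Run P s s' t ∧ Q s' t

/-- The frame condition `Same` is handed to the new postcondition, so specifications need not list
what a program leaves unchanged. -/
theorem Runs.mono {P : Program} {s : State} {Q Q' : State → ℕ → Prop} (h : Runs P s Q)
    (hQ : ∀ s' t, Same P s s' → Q s' t → Q' s' t) : Runs P s Q' := by
  obtain ⟨s', t, h1, h2⟩ := h
  exact ⟨s', t, h1, hQ _ _ h1.same h2⟩

theorem runs_skip {s : State} {Q : State → ℕ → Prop} : Runs .skip s Q ↔ Q s 1 := by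
  constructor
  · rintro ⟨s', t, h, hQ⟩
    cases h
    exact hQ
  · exact fun h => ⟨_, _, .skip s, h⟩

theorem runs_instr {c : Instr} {s : State} {Q : State → ℕ → Prop} :
    Runs (.instr c) s Q ↔ Q (c.apply s) 1 := by
  constructor
  · rintro ⟨s', t, h, hQ⟩
    cases h
    exact hQ
  · exact fun h => ⟨_, _, .instr c s, h⟩

theorem runs_seq {P P' : Program} {s : State} {Q : State → ℕ → Prop} :
    Runs (.seq P P') s Q ↔ Runs P s fun s' t => Runs P' s' fun s'' t' => Q s'' (t + t') := by
  constructor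
  · rintro ⟨s', t, h, hQ⟩
    cases h with
    | seq h1 h2 => exact ⟨_, _, h1, _, _, h2, hQ⟩
  · rintro ⟨_, _, h1, _, _, h2, hQ⟩
    exact ⟨_, _, .seq h1 h2, hQ⟩

theorem runs_ite {b : Test} {P P' : Program} {s : State} {Q : State → ℕ → Prop} :
    Runs (.ite b P P') s Q ↔ (b.Holds s → Runs P s fun s' t => Q s' (t + 1)) ∧
      (¬ b.Holds s → Runs P' s fun s' t => Q s' (t + 1)) := by
  constructor
  · rintro ⟨s', t, h, hQ⟩
    cases h with
    | ite_true hb h => exact ⟨fun _ => ⟨_, _, h, hQ⟩, fun h => absurd hb h⟩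
    | ite_false hb h => exact ⟨fun h => absurd h hb, fun _ => ⟨_, _, h, hQ⟩⟩
  · rintro ⟨h1, h2⟩
    by_cases hb : b.Holds s
    · obtain ⟨_, _, h, hQ⟩ := h1 hb
      exact ⟨_, _, .ite_true hb h, hQ⟩
    · obtain ⟨_, _, h, hQ⟩ := h2 hb
      exact ⟨_, _, .ite_false hb h, hQ⟩

theorem runs_block_nil {s : State} {Q : State → ℕ → Prop} : Runs (.block []) s Q ↔ Q s 1 :=
  runs_skip

theorem runs_block_cons {P : Program} {L : List Program} {s : State} {Q : State → ℕ → Prop} :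
    Runs (.block (P :: L)) s Q ↔
      Runs P s fun s' t => Runs (.block L) s' fun s'' t' => Q s'' (t + t') :=
  runs_seq

/-- The rule for loops, with an invariant `I` and a potential `μ` that pays for the steps. -/
theorem runs_loop {b : Test} {P : Program} {s₀ : State} {Q : State → ℕ → Prop}
    (I : State → Prop) (μ : State → ℕ) (h0 : I s₀)
    (step : ∀ s, Same P s₀ s → I s → b.Holds s →
      Runs P s fun s' t => I s' ∧ t + 1 + μ s' ≤ μ s)
    (done : ∀ s t, Same P s₀ s → I s → ¬ b.Holds s → t + μ s ≤ μ s₀ + 1 → Q s t) :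
    Runs (.loop b P) s₀ Q := by
  -- The additional `1` pays for the final, failing test.
  have key : ∀ m s, μ s = m → Same P s₀ s → I s →
      ∃ s' t, Run (.loop b P) s s' t ∧ Same P s₀ s' ∧ I s' ∧ ¬ b.Holds s' ∧
        t + μ s' ≤ μ s + 1 := by
    intro m
    induction m using Nat.strong_induction_on with
    | _ m ih =>
      intro s hm hsame hI
      by_cases hb : b.Holds s
      · obtain ⟨s', t, h1, h2, h3⟩ := step s hsame hI hb
        obtain ⟨s'', t', h4, h5, h6, h7, h8⟩ :=
          ih (μ s') (by omega) s' rfl (hsame.trans h1.same) h2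
        exact ⟨s'', t + t' + 1, .loop_true hb h1 h4, h5, h6, h7, by omega⟩
      · exact ⟨s, 1, .loop_false hb, hsame, hI, hb, by omega⟩
  obtain ⟨s', t, h1, h2, h3, h4, h5⟩ := key _ s₀ rfl (.refl _ _) h0
  exact ⟨s', t, h1, done s' t h2 h3 h4 h5⟩

/-- The list `l` is stored in the array `m` from the address `p` on. -/
def Reads (m : ℕ → ℕ) : ℕ → List ℕ → Prop
  | _, [] => True
  | p, a :: l => m p = a ∧ Reads m (p + 1) l

theorem reads_append {m : ℕ → ℕ} {l l' : List ℕ} {p : ℕ} :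
    Reads m p (l ++ l') ↔ Reads m p l ∧ Reads m (p + l.length) l' := by
  induction l generalizing p with
  | nil => simp [Reads]
  | cons a l ih =>
    simp only [List.cons_append, Reads, ih, List.length_cons, and_assoc]
    rw [show p + 1 + l.length = p + (l.length + 1) by omega]

theorem reads_getD (l : List ℕ) : Reads (fun i => l.getD i 0) 0 l := by
  have : ∀ (l' : List ℕ) p, (∀ i, i < l'.length → l.getD (p + i) 0 = l'.getD i 0) →
      Reads (fun i => l.getD i 0) p l' := by
    intro l'
    induction l' with
    | nil => exact fun _ _ => True.intro
    | cons a l' ih =>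
      intro p h
      refine ⟨by simpa using h 0 (by simp), ih (p + 1) fun i hi => ?_⟩
      have := h (i + 1) (by simpa using hi)
      rw [show p + 1 + i = p + (i + 1) by omega, this]
      simp
  exact this l 0 fun i _ => by rw [zero_add]

/-- Linked lists: `h` is the head pointer, `nxt` the array of links; pointers are incremented by
one, and `0` is the null pointer. -/
def Linked (nxt : ℕ → ℕ) : ℕ → List ℕ → Prop
  | h, [] => h = 0
  | h, v :: l => h = v + 1 ∧ Linked nxt (nxt v) l

theorem Linked.congr {nxt nxt' : ℕ → ℕ} {h : ℕ} {l : List ℕ} (hl : Linked nxt h l)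
    (heq : ∀ v ∈ l, nxt' v = nxt v) : Linked nxt' h l := by
  induction l generalizing h with
  | nil => exact hl
  | cons v l ih =>
    refine ⟨hl.1, ?_⟩
    rw [heq v (by simp)]
    exact ih hl.2 fun w hw => heq w (List.mem_cons_of_mem _ hw)

theorem Linked.update {nxt : ℕ → ℕ} {h x y : ℕ} {l : List ℕ} (hl : Linked nxt h l)
    (hx : x ∉ l) : Linked (Function.update nxt x y) h l :=
  hl.congr fun v hv => Function.update_of_ne (fun e => hx (by rwa [← e])) _ _

theorem Linked.push {nxt : ℕ → ℕ} {h x : ℕ} {l : List ℕ} (hl : Linked nxt h l)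
    (hx : x ∉ l) : Linked (Function.update nxt x h) (x + 1) (x :: l) :=
  ⟨rfl, by rw [Function.update_self]; exact hl.update hx⟩

theorem Linked.eq_nil {nxt : ℕ → ℕ} {l : List ℕ} (hl : Linked nxt 0 l) : l = [] := by
  cases l with
  | nil => rfl
  | cons v l => exact absurd hl.1 (by omega)

theorem Linked.exists_cons {nxt : ℕ → ℕ} {h : ℕ} {l : List ℕ} (hl : Linked nxt h l)
    (h0 : 0 < h) : ∃ v l', l = v :: l' ∧ h = v + 1 ∧ Linked nxt (nxt v) l' := by
  cases l with
  | nil => exact absurd hl h0.ne'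
  | cons v l => exact ⟨v, l, rfl, hl⟩

end RAM

/-! ### Parses on an initial segment and the number of edges -/

namespace StatementKind

/-- Only the source branches. This bounds the out-degree of leaves by two and makes the last child
visible from the sink of an alternative. -/
theorem Edge.eq_or_eq {k : StatementKind} {i j : ℕ} (h : k.Edge i j) (hi : 0 < i) :
    j = 0 ∨ j = k.order - 1 := by
  cases k <;> simp [Edge, order] at * <;> omega

end StatementKind

namespace Parse

/-- `P` is a complete parse of a graph with vertices `0, …, n - 1` and adjacency lists `adj`. -/
structure OnRange (P : Parse ℕ) (n : ℕ) (adj : ℕ → List ℕ) : Prop where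
  valid : P.Valid
  root_lt : P.root < n
  ch_lt : ∀ v i, v < n → P.ch v i < n
  snk_lt : ∀ v, v < n → P.snk v < n
  lt_of_kd : ∀ v, P.kd v ≠ .trivial → v < n
  full : ∀ v, v < n → v = P.root ∨ ∃ w, P.Child w v
  nodup_adj : ∀ v, v < n → (adj v).Nodup
  mem_adj : ∀ v, v < n → ∀ w, w ∈ adj v ↔ P.Arc v w

namespace OnRange

variable {P : Parse ℕ} {n : ℕ} {adj : ℕ → List ℕ}

theorem arc_lt (h : P.OnRange n adj) {v w : ℕ} (ha : P.Arc v w) : v < n ∧ w < n := by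
  obtain ⟨x, i, j, he, rfl, rfl⟩ := ha
  have hx := h.lt_of_kd x he.ne_trivial
  refine ⟨?_, h.ch_lt x j hx⟩
  unfold out
  split_ifs
  · exact hx
  · exact h.snk_lt _ (h.ch_lt x i hx)

/-- An inner node points only to its own children. A leaf with an out-arc is the sink of a non-last
child of some `w`, and points only to `w` or to the last child of `w`. -/
theorem length_adj_le (h : P.OnRange n adj) {v : ℕ} (hv : v < n) :
    (adj v).length ≤ 2 + ((P.kd v).order - 1) := by
  rw [← List.toFinset_card_of_nodup (h.nodup_adj v hv)]
  by_cases hk : P.kd v = .trivial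
  · by_cases ha : ∃ y, P.Arc v y
    · obtain ⟨y, ha⟩ := ha
      obtain ⟨w, i, h0, hi, rfl⟩ := h.valid.exists_of_arc_of_kd_eq hk ha
      refine le_trans (Finset.card_le_card (t := {P.ch w 0, P.ch w ((P.kd w).order - 1)}) ?_)
        (Finset.card_le_two.trans (by omega))
      intro y hy
      rw [List.mem_toFinset, h.mem_adj _ hv, h.valid.arc_snk_iff h0 hi] at hy
      obtain ⟨j, he, rfl⟩ := hy
      rcases he.eq_or_eq h0 with rfl | rfl <;> simp
    · have : (adj v).toFinset = ∅ := by
        rw [Finset.eq_empty_iff_forall_notMem]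
        intro y hy
        rw [List.mem_toFinset, h.mem_adj _ hv] at hy
        exact ha ⟨y, hy⟩
      simp [this]
  · refine le_trans (Finset.card_le_card
      (t := (Finset.Ico 1 (P.kd v).order).image (P.ch v)) ?_)
      (Finset.card_image_le.trans (by simp))
    intro y hy
    rw [List.mem_toFinset, h.mem_adj _ hv, h.valid.arc_of_kd_ne hk] at hy
    obtain ⟨j, he, rfl⟩ := hy
    exact Finset.mem_image_of_mem _ (Finset.mem_Ico.2 ⟨by have := he.ne; omega, he.lt_right⟩)

/-- Pairs of an inner node and a child index inject into the vertices, since every vertex has at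
most one parent and one index there. -/
theorem sum_order_le (h : P.OnRange n adj) :
    ∑ v ∈ Finset.range n, ((P.kd v).order - 1) ≤ n := by
  have : ∑ v ∈ Finset.range n, ((P.kd v).order - 1) =
      ((Finset.range n).sigma fun v => Finset.Ico 1 (P.kd v).order).card := by
    rw [Finset.card_sigma]
    simp
  rw [this]
  conv_rhs => rw [← Finset.card_range n]
  refine Finset.card_le_card_of_injOn (fun x => P.ch x.1 x.2) ?_ ?_
  · rintro ⟨v, i⟩ hx
    simp only [Finset.coe_sigma, Set.mem_sigma_iff, Finset.coe_range, Set.mem_Iio] at hx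
    simpa using h.ch_lt v i hx.1
  · rintro ⟨v, i⟩ hx ⟨w, j⟩ hy heq
    simp only [Finset.coe_sigma, Set.mem_sigma_iff, Finset.coe_Ico, Set.mem_Ico] at hx hy
    obtain ⟨rfl, rfl⟩ := h.valid.ch_inj v i w j (by omega) hx.2.2 (by omega) hy.2.2 heq
    rfl

/-- The number of edges is linear in the number of vertices. -/
theorem sum_length_adj_le (h : P.OnRange n adj) :
    ∑ v ∈ Finset.range n, (adj v).length ≤ 3 * n := by
  calc _ ≤ ∑ v ∈ Finset.range n, (2 + ((P.kd v).order - 1)) :=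
        Finset.sum_le_sum fun v hv => h.length_adj_le (Finset.mem_range.1 hv)
    _ ≤ 3 * n := by
        rw [Finset.sum_add_distrib]
        have := h.sum_order_le
        simp
        omega

end OnRange

end Parse

/-! Names of registers and arrays. -/

notation "rZ" => (1 : ℕ)
notation "rOne" => (2 : ℕ)
notation "rN" => (3 : ℕ)
notation "rS" => (4 : ℕ)
notation "rV" => (5 : ℕ)
notation "rX" => (6 : ℕ)
notation "rY" => (7 : ℕ)
notation "rD" => (8 : ℕ)
notation "rP" => (9 : ℕ)

notation "aDeg" => (2 : ℕ)
notation "aRem" => (3 : ℕ)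
notation "aStart" => (4 : ℕ)
notation "aCur" => (5 : ℕ)
notation "aFst" => (6 : ℕ)
notation "aSnd" => (7 : ℕ)

/-! ### Reading the input -/

namespace RAM

open Program Instr Test

/-- Advance the register `rP` by the value of `rD`. -/
def advanceProg : Program := loop (lt rZ rD) (block [instr (inc rP), instr (dec rD)])

/-- Record the first two of the `rD` neighbors of `rV` that are listed from `rP` on. -/
def nbrProg : Program :=
  ite (lt rZ rD) (block [
    instr (load rX 0 rP),
    instr (inc rX),
    instr (store aFst rV rX),
    ite (lt rOne rD) (block [
      instr (copy rY rP),
      instr (inc rY),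
      instr (load rX 0 rY),
      instr (inc rX),
      instr (store aSnd rV rX)]) skip]) skip

/-- Reading the input: degrees, addresses of the adjacency lists, first and second neighbors. -/
def readProg : Program := block [
  instr (const rOne 1),
  instr (load rN 0 rZ),
  instr (load rS 0 rOne),
  instr (const rP 2),
  instr (const rV 0),
  loop (lt rV rN) (block [
    instr (load rD 0 rP),
    instr (store aDeg rV rD),
    instr (store aRem rV rD),
    instr (inc rP),
    instr (store aStart rV rP),
    instr (store aCur rV rP),
    nbrProg,
    advanceProg,
    instr (inc rV)])]

/-- The pointer to the head of a list. -/
def headPtr : List ℕ → ℕ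
  | [] => 0
  | a :: _ => a + 1

/-- The arrays describing the input. -/
structure HasGraph (n root : ℕ) (adj : ℕ → List ℕ) (s : State) : Prop where
  zero : s.reg rZ = 0
  one : s.reg rOne = 1
  num : s.reg rN = n
  src : s.reg rS = root
  deg : ∀ v, v < n → s.mem aDeg v = (adj v).length
  start : ∀ v, v < n → Reads (s.mem 0) (s.mem aStart v) (adj v)
  fst : ∀ v, v < n → s.mem aFst v = headPtr (adj v)
  snd : ∀ v, v < n → s.mem aSnd v = headPtr (adj v).tail

end RAM

namespace RAM

open Program Instr Test

/-- The part of the input word that describes the vertices from `i` on. -/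
def inputFrom (n : ℕ) (adj : ℕ → List ℕ) (i : ℕ) : List ℕ :=
  (List.range' i (n - i)).flatMap fun v => (adj v).length :: adj v

theorem inputFrom_of_lt {n : ℕ} (adj : ℕ → List ℕ) {i : ℕ} (h : i < n) :
    inputFrom n adj i = (adj i).length :: (adj i ++ inputFrom n adj (i + 1)) := by
  unfold inputFrom
  rw [show n - i = (n - (i + 1)) + 1 by omega, List.range'_succ]
  simp

/-- The number of edges leaving the vertices from `i` on. -/
def degSum (n : ℕ) (adj : ℕ → List ℕ) (i : ℕ) : ℕ := ∑ v ∈ Finset.Ico i n, (adj v).length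

theorem degSum_of_lt {n : ℕ} (adj : ℕ → List ℕ) {i : ℕ} (h : i < n) :
    degSum n adj i = (adj i).length + degSum n adj (i + 1) :=
  Finset.sum_eq_sum_Ico_succ_bot h _

/-- The clauses `fst'` and `snd'` on unread vertices are needed because `nbrProg` stores nothing for
a missing neighbor and relies on the initial `0`, the null pointer. -/
structure ReadInv (n root : ℕ) (adj : ℕ → List ℕ) (s : State) : Prop where
  zero : s.reg rZ = 0
  one : s.reg rOne = 1
  num : s.reg rN = n
  src : s.reg rS = root
  le : s.reg rV ≤ n
  rest : Reads (s.mem 0) (s.reg rP) (inputFrom n adj (s.reg rV))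
  deg : ∀ v, v < s.reg rV → s.mem aDeg v = (adj v).length
  start : ∀ v, v < s.reg rV → Reads (s.mem 0) (s.mem aStart v) (adj v)
  fst : ∀ v, v < s.reg rV → s.mem aFst v = headPtr (adj v)
  fst' : ∀ v, s.reg rV ≤ v → s.mem aFst v = 0
  snd : ∀ v, v < s.reg rV → s.mem aSnd v = headPtr (adj v).tail
  snd' : ∀ v, s.reg rV ≤ v → s.mem aSnd v = 0
  rem : ∀ v, v < s.reg rV → s.mem aRem v = (adj v).length
  cur : ∀ v, v < s.reg rV → s.mem aCur v = s.mem aStart v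

theorem forall_le_update {p : ℕ → ℕ → Prop} {f : ℕ → ℕ} {i x : ℕ}
    (h : ∀ v, v < i → p v (f v)) (hi : p i x) :
    ∀ v, v ≤ i → p v (Function.update f i x v) := by
  intro v hv
  by_cases hvi : v = i
  · subst hvi
    rwa [Function.update_self]
  · rw [Function.update_of_ne hvi]
    exact h v (by omega)

theorem runs_advanceProg {s : State} (hz : s.reg rZ = 0) :
    Runs advanceProg s fun s' t => s'.reg rP = s.reg rP + s.reg rD ∧ t ≤ 4 * s.reg rD + 1 := by
  refine runs_loop (fun s' => s'.reg rZ = 0 ∧ s'.reg rP + s'.reg rD = s.reg rP + s.reg rD)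
    (fun s' => 4 * s'.reg rD) ⟨hz, rfl⟩ ?_ ?_
  · rintro s1 - ⟨h1, h2⟩ hb
    simp only [Test.Holds] at hb
    simp [runs_block_cons, runs_block_nil, runs_instr, Instr.apply, h1]
    omega
  · rintro s1 t hs1 ⟨h1, h2⟩ hb h3
    simp only [Test.Holds] at hb
    omega

theorem runs_nbrProg {s : State} {l : List ℕ} (hz : s.reg rZ = 0) (h1 : s.reg rOne = 1)
    (hd : s.reg rD = l.length) (hl : Reads (s.mem 0) (s.reg rP) l)
    (hf : s.mem aFst (s.reg rV) = 0) (hs : s.mem aSnd (s.reg rV) = 0) :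
    Runs nbrProg s fun s' t =>
      s'.mem aFst = Function.update (s.mem aFst) (s.reg rV) (headPtr l) ∧
      s'.mem aSnd = Function.update (s.mem aSnd) (s.reg rV) (headPtr l.tail) ∧ t ≤ 12 := by
  have hf' : Function.update (s.mem aFst) (s.reg rV) 0 = s.mem aFst := by
    rw [← hf, Function.update_eq_self]
  have hs' : Function.update (s.mem aSnd) (s.reg rV) 0 = s.mem aSnd := by
    rw [← hs, Function.update_eq_self]
  rcases l with _ | ⟨a, _ | ⟨b, l⟩⟩
  · simp only [List.length_nil] at hd
    simp [nbrProg, runs_ite, runs_skip, Test.Holds, hz, hd, headPtr, hf', hs']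
  · simp only [List.length_cons, List.length_nil] at hd
    simp [nbrProg, runs_block_cons, runs_block_nil, runs_ite, runs_skip, runs_instr, Instr.apply,
      Test.Holds, hz, hd, h1, headPtr, hl.1, hs']
  · simp only [List.length_cons] at hd
    simp [nbrProg, runs_block_cons, runs_block_nil, runs_ite, runs_skip, runs_instr, Instr.apply,
      Test.Holds, hz, hd, h1, headPtr, hl.1, hl.2.1]

theorem runs_readProg {n root : ℕ} {adj : ℕ → List ℕ} {s : State}
    (hreg : ∀ r, s.reg r = 0)
    (hin : Reads (s.mem 0) 0 (n :: root :: inputFrom n adj 0))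
    (hmem : ∀ A, A ≠ 0 → s.mem A = fun _ => 0) :
    Runs readProg s fun s' t => HasGraph n root adj s' ∧
      (∀ v, v < n → s'.mem aRem v = (adj v).length ∧ s'.mem aCur v = s'.mem aStart v) ∧
      t ≤ 50 * n + 4 * degSum n adj 0 + 20 := by
  obtain ⟨h0, h1, h2⟩ := hin
  unfold readProg
  simp only [runs_block_cons, runs_block_nil, runs_instr, Instr.apply]
  refine runs_loop (ReadInv n root adj)
    -- A round costs a constant, covered by `50`, plus `4` steps per neighbor skipped by
    -- `advanceProg`.
    (fun s => 50 * (n - s.reg rV) + 4 * degSum n adj (s.reg rV)) ?_ ?_ ?_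
  · constructor <;> simp_all
  · intro s hs hI hb
    obtain ⟨zero, one, num, src, le, rest, deg, start, fst, fst', snd, snd', rem, cur⟩ := hI
    have hv : s.reg rV < n := by simpa [Test.Holds, num] using hb
    rw [inputFrom_of_lt adj hv] at rest
    obtain ⟨hd, hr⟩ := rest
    rw [reads_append] at hr
    have hw := degSum_of_lt adj hv
    simp only [runs_block_cons, runs_block_nil, runs_instr, Instr.apply]
    refine (runs_nbrProg (l := adj (s.reg rV)) (by simpa) (by simpa) (by simpa) (by simpa using hr.1)
      (by simpa using fst' _ le_rfl) (by simpa using snd' _ le_rfl)).mono ?_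
    rintro s1 t1 hs1 ⟨hf1, hf2, ht1⟩
    have e0 := hs1.reg rZ (by decide)
    have e1 := hs1.reg rOne (by decide)
    have e2 := hs1.reg rN (by decide)
    have e3 := hs1.reg rS (by decide)
    have e4 := hs1.reg rV (by decide)
    have e5 := hs1.reg rD (by decide)
    have e6 := hs1.reg rP (by decide)
    have m0 := hs1.mem 0 (by decide)
    have m1 := hs1.mem aDeg (by decide)
    have m2 := hs1.mem aRem (by decide)
    have m3 := hs1.mem aStart (by decide)
    have m4 := hs1.mem aCur (by decide)
    simp [zero, one, num, src, hd] at e0 e1 e2 e3 e4 e5 e6 m0 m1 m2 m3 m4 hf1 hf2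
    refine (runs_advanceProg e0).mono ?_
    rintro s2 t2 hs2 ⟨hp, ht2⟩
    have f0 := hs2.reg rZ (by decide)
    have f1 := hs2.reg rOne (by decide)
    have f2 := hs2.reg rN (by decide)
    have f3 := hs2.reg rS (by decide)
    have f4 := hs2.reg rV (by decide)
    have f5 : s2.mem = s1.mem := funext fun A => hs2.mem A (by simp [advanceProg, arrs, block])
    simp only [e0, e1, e2, e3, e4, e5, e6] at f0 f1 f2 f3 f4 hp ht2
    refine ⟨⟨?_, ?_, ?_, ?_, ?_, ?_, ?_, ?_, ?_, ?_, ?_, ?_, ?_, ?_⟩, ?_⟩ <;>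
      simp [f0, f1, f2, f3, f4, f5, hp, m0, m1, m2, m3, m4, hf1, hf2]
    · omega
    · exact hr.2
    · exact forall_le_update (p := fun v x => x = (adj v).length) deg rfl
    · exact forall_le_update (p := fun v x => Reads (s.mem 0) x (adj v)) start hr.1
    · exact forall_le_update (p := fun v x => x = headPtr (adj v)) fst rfl
    · intro v hv
      rw [Function.update_of_ne (by omega)]
      exact fst' v (by omega)
    · exact forall_le_update (p := fun v x => x = headPtr (adj v).tail) snd rfl
    · intro v hv
      rw [Function.update_of_ne (by omega)]
      exact snd' v (by omega)
    · exact forall_le_update (p := fun v x => x = (adj v).length) rem rfl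
    · intro v hv
      by_cases h : v = s.reg rV
      · subst h
        simp
      · simp [h, cur v (by omega)]
    · omega
  · intro s t hs hI hb ht
    obtain ⟨zero, one, num, src, le, rest, deg, start, fst, fst', snd, snd', rem, cur⟩ := hI
    have hv : s.reg rV = n := by
      simp only [Test.Holds, num] at hb
      omega
    subst hv
    refine ⟨⟨zero, one, num, src, deg, start, fst, snd⟩, fun v hv => ⟨rem v hv, cur v hv⟩, ?_⟩
    simp at ht
    omega

end RAM

-- Depth-first search

notation "rK" => (10 : ℕ)
notation "rT" => (11 : ℕ)
notation "rH" => (12 : ℕ)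
notation "rW" => (13 : ℕ)

notation "aStat" => (8 : ℕ)
notation "aDpar" => (9 : ℕ)
notation "aOrd" => (10 : ℕ)
notation "aFin" => (11 : ℕ)
notation "aBack" => (12 : ℕ)

namespace Parse

theorem OnRange.fwd_reach {P : Parse ℕ} {n : ℕ} {adj : ℕ → List ℕ} (h : P.OnRange n adj) {v : ℕ}
    (hv : v < n) : Relation.ReflTransGen P.Fwd P.root v := by
  rcases h.full v hv with rfl | ⟨w, i, h0, hi, rfl⟩
  · exact .refl
  · exact (h.valid.fwd_reach_of_live (StatementKind.ne_trivial_of_lt_order h0 hi)).trans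
      ((h.valid.fwd_reach_snk_and_child w).2 i hi)

open Classical in
/-- The number of vertices from which a non-cycle edge to `w` has been traversed. -/
noncomputable def fwdCount (P : Parse ℕ) (n : ℕ) (dn : ℕ → List ℕ) (w : ℕ) : ℕ :=
  ((Finset.range n).filter fun u => w ∈ dn u ∧ P.Fwd u w).card

theorem fwdCount_update_of_not {P : Parse ℕ} {n : ℕ} {dn : ℕ → List ℕ} {v w x : ℕ}
    (h : ¬ (x = w ∧ P.Fwd v w)) :
    P.fwdCount n (Function.update dn v (dn v ++ [w])) x = P.fwdCount n dn x := by
  classical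
  unfold fwdCount
  congr 1
  refine Finset.filter_congr fun u _ => ?_
  by_cases huv : u = v
  · subst huv
    rw [Function.update_self, List.mem_append, List.mem_singleton]
    constructor
    · rintro ⟨h1 | h1, h2⟩
      · exact ⟨h1, h2⟩
      · exact absurd ⟨h1, h1 ▸ h2⟩ h
    · exact fun h1 => ⟨.inl h1.1, h1.2⟩
  · rw [Function.update_of_ne huv]

theorem fwdCount_update_self {P : Parse ℕ} {n : ℕ} {dn : ℕ → List ℕ} {v w : ℕ} (hv : v < n)
    (hw : w ∉ dn v) (h : P.Fwd v w) :
    P.fwdCount n (Function.update dn v (dn v ++ [w])) w = P.fwdCount n dn w + 1 := by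
  classical
  unfold fwdCount
  rw [← Finset.card_insert_of_notMem (a := v)]
  · congr 1
    ext u
    simp only [Finset.mem_filter, Finset.mem_insert, Finset.mem_range]
    by_cases huv : u = v
    · subst huv
      simp [hv, h]
    · simp [huv]
  · simp [hw]

end Parse

namespace RAM

open Program Instr Test

/-- Depth-first search: the finishing order, the number of non-cycle edges entering every vertex,
and the vertices from which a cycle edge leaves. -/
def dfsProg : Program := block [
  instr (store aStat rS rOne),
  instr (const rK 0),
  instr (copy rX rS),
  instr (inc rX),
  loop (lt rZ rX) (block [
    instr (copy rV rX),
    instr (dec rV),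
    instr (load rD aRem rV),
    ite (lt rZ rD) (block [
      instr (dec rD),
      instr (store aRem rV rD),
      instr (load rP aCur rV),
      instr (load rW 0 rP),
      instr (inc rP),
      instr (store aCur rV rP),
      instr (load rT aStat rW),
      ite (eq rT rOne) (instr (store aBack rV rOne)) (block [
        instr (load rD aFin rW),
        instr (inc rD),
        instr (store aFin rW rD),
        ite (eq rT rZ) (block [
          instr (store aStat rW rOne),
          instr (store aDpar rW rX),
          instr (copy rX rW),
          instr (inc rX)]) skip])])
      (block [
        instr (const rT 2),
        instr (store aStat rV rT),
        instr (store aOrd rK rV),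
        instr (inc rK),
        instr (load rX aDpar rV)])])]

/-- The traversed and the remaining part of the adjacency lists. -/
structure EdgeInv (n : ℕ) (adj : ℕ → List ℕ) (dn rs : ℕ → List ℕ) (s : State) : Prop where
  split : ∀ v, v < n → adj v = dn v ++ rs v
  rem : ∀ v, v < n → s.mem aRem v = (rs v).length
  cur : ∀ v, v < n → Reads (s.mem 0) (s.mem aCur v) (rs v)

theorem EdgeInv.advance {n : ℕ} {adj dn rs : ℕ → List ℕ} {s s' : State}
    (h : EdgeInv n adj dn rs s) {v w : ℕ} {l : List ℕ} (hl : rs v = w :: l)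
    (h0 : s'.mem 0 = s.mem 0)
    (hr : s'.mem aRem = Function.update (s.mem aRem) v (s.mem aRem v - 1))
    (hc : s'.mem aCur = Function.update (s.mem aCur) v (s.mem aCur v + 1)) :
    EdgeInv n adj (Function.update dn v (dn v ++ [w])) (Function.update rs v l) s' := by
  constructor <;> intro x hx <;> by_cases hxv : x = v
  · subst hxv
    simp [h.split x hx, hl]
  · simp [hxv, h.split x hx]
  · subst hxv
    simp [hr, h.rem x hx, hl]
  · simp [hr, hxv, h.rem x hx]
  · subst hxv
    have := h.cur x hx
    rw [hl] at this
    simpa [hc, h0] using this.2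
  · simpa [hc, h0, hxv] using h.cur x hx

open Classical in
-- Here `st` is the stack, `O` the finished vertices in finishing order, and `dn v`, `rs v` are the
-- traversed and remaining neighbors of `v`. The status is `0` for unvisited, `1` for stacked and
-- `2` for finished vertices. By `sorted` and `closed`, forward arcs from finished vertices lead to
-- vertices finished earlier.
structure DfsInv (P : Parse ℕ) (n : ℕ) (adj : ℕ → List ℕ) (st O : List ℕ) (dn rs : ℕ → List ℕ)
    (s : State) : Prop where
  zero : s.reg rZ = 0
  one : s.reg rOne = 1
  edge : EdgeInv n adj dn rs s
  linked : Linked (s.mem aDpar) (s.reg rX) st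
  path : P.StackPath st
  stat : ∀ v, s.mem aStat v = if v ∈ st then 1 else if v ∈ O then 2 else 0
  disj : ∀ v ∈ st, v ∉ O
  st_lt : ∀ v ∈ st, v < n
  ord_lt : ∀ v ∈ O, v < n
  nodup : O.Nodup
  count : s.reg rK = O.length
  ord : Reads (s.mem aOrd) 0 O
  unvisited : ∀ v, v ∉ st → v ∉ O → dn v = []
  finished : ∀ v ∈ O, rs v = []
  visited : ∀ v, ∀ w ∈ dn v, w ∈ st ∨ w ∈ O
  sorted : O.Pairwise fun a b => ¬ P.Fwd a b
  closed : ∀ u ∈ O, ∀ w, P.Fwd u w → w ∈ O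
  back : ∀ v, s.mem aBack v = if ∃ w ∈ dn v, P.Back v w then 1 else 0
  fin : ∀ w, s.mem aFin w = P.fwdCount n dn w
  root : P.root ∈ st ∨ P.root ∈ O

/-- The result of the depth-first search. -/
structure HasOrder (P : Parse ℕ) (n : ℕ) (O : List ℕ) (s : State) : Prop where
  nodup : O.Nodup
  mem : ∀ v, v ∈ O ↔ v < n
  ord : Reads (s.mem aOrd) 0 O
  sorted : O.Pairwise fun a b => ¬ P.Fwd a b
  back : ∀ v, v < n → (s.mem aBack v = 0 ↔ ∀ w, ¬ P.Back v w)
  fin : ∀ v w, P.Fwd v w → (s.mem aFin w = 1 ↔ ∀ u, P.Fwd u w → u = v)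

/-- With an empty stack the finished vertices contain the root and are closed under forward arcs,
and all vertices are forward reachable. Thus everything is finished, all adjacency lists are
exhausted, and the partial counts and flags are final. -/
theorem DfsInv.hasOrder {P : Parse ℕ} {n : ℕ} {adj : ℕ → List ℕ} {O : List ℕ}
    {dn rs : ℕ → List ℕ} {s : State} (hP : P.OnRange n adj) (h : DfsInv P n adj [] O dn rs s) :
    HasOrder P n O s := by
  have hmem : ∀ v, v ∈ O ↔ v < n := by
    refine fun v => ⟨h.ord_lt v, fun hv => ?_⟩
    have := hP.fwd_reach hv
    induction this with
    | refl => simpa using h.root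
    | tail _ hab ih => exact h.closed _ (ih (hP.arc_lt hab.arc).1) _ hab
  have hdn : ∀ v, v < n → dn v = adj v := by
    intro v hv
    rw [h.edge.split v hv, h.finished v ((hmem v).2 hv), List.append_nil]
  refine ⟨h.nodup, hmem, h.ord, h.sorted, ?_, ?_⟩
  · intro v hv
    rw [h.back v]
    simp only [ite_eq_right_iff, one_ne_zero, imp_false, not_exists, not_and]
    refine ⟨fun h1 w hw => h1 w ?_ hw, fun h1 w _ => h1 w⟩
    rw [hdn v hv, hP.mem_adj v hv]
    exact hP.valid.arc_iff.2 (.inr hw)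
  · intro v w hvw
    classical
    have hm : ∀ u, P.Fwd u w → u ∈ Finset.range n ∧ w ∈ dn u := by
      intro u hu
      have hun := (hP.arc_lt hu.arc).1
      exact ⟨Finset.mem_range.2 hun, by rw [hdn u hun, hP.mem_adj u hun]; exact hu.arc⟩
    rw [h.fin w, Parse.fwdCount, Finset.card_eq_one]
    constructor
    · rintro ⟨a, ha⟩ u hu
      have h1 : u ∈ ({a} : Finset ℕ) := by
        rw [← ha]
        exact Finset.mem_filter.2 ⟨(hm u hu).1, (hm u hu).2, hu⟩
      have h2 : v ∈ ({a} : Finset ℕ) := by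
        rw [← ha]
        exact Finset.mem_filter.2 ⟨(hm v hvw).1, (hm v hvw).2, hvw⟩
      rw [Finset.mem_singleton] at h1 h2
      rw [h1, h2]
    · intro hu
      refine ⟨v, Finset.eq_singleton_iff_unique_mem.2 ⟨?_, ?_⟩⟩
      · exact Finset.mem_filter.2 ⟨(hm v hvw).1, (hm v hvw).2, hvw⟩
      · intro x hx
        exact hu x (Finset.mem_filter.1 hx).2.2

/-- What a step along the edge from `v` to `w` does to the lists. -/
structure EdgeStep (v : ℕ) (s s' : State) : Prop where
  zero : s'.reg rZ = s.reg rZ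
  one : s'.reg rOne = s.reg rOne
  count : s'.reg rK = s.reg rK
  input : s'.mem 0 = s.mem 0
  rem : s'.mem aRem = Function.update (s.mem aRem) v (s.mem aRem v - 1)
  cur : s'.mem aCur = Function.update (s.mem aCur) v (s.mem aCur v + 1)
  ord : s'.mem aOrd = s.mem aOrd

namespace DfsInv

variable {P : Parse ℕ} {n : ℕ} {adj : ℕ → List ℕ} {st O : List ℕ} {dn rs : ℕ → List ℕ}
  {s s' : State} {v w : ℕ} {l : List ℕ}

theorem arc (hP : P.OnRange n adj) (h : DfsInv P n adj (v :: st) O dn rs s)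
    (hl : rs v = w :: l) : P.Arc v w ∧ w ∉ dn v := by
  have hv := h.st_lt v (by simp)
  have hs := h.edge.split v hv
  rw [hl] at hs
  refine ⟨(hP.mem_adj v hv w).1 (by rw [hs]; simp), fun hw => ?_⟩
  have := hP.nodup_adj v hv
  rw [hs, List.nodup_append] at this
  exact this.2.2 w hw w (by simp) rfl

/-- The invariants that do not depend on the kind of the edge. -/
theorem common (h : DfsInv P n adj (v :: st) O dn rs s) (hl : rs v = w :: l)
    (hs : EdgeStep v s s') :
    EdgeInv n adj (Function.update dn v (dn v ++ [w])) (Function.update rs v l) s' ∧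
    (∀ x ∈ O, Function.update rs v l x = []) ∧
    (∀ x, x ∉ v :: st → x ∉ O → Function.update dn v (dn v ++ [w]) x = []) ∧
    ∀ x, ∀ y ∈ Function.update dn v (dn v ++ [w]) x, (y ∈ v :: st ∨ y ∈ O) ∨ (x = v ∧ y = w) := by
  refine ⟨h.edge.advance hl hs.input hs.rem hs.cur, ?_, ?_, ?_⟩
  · intro x hx
    rw [Function.update_of_ne]
    · exact h.finished x hx
    · rintro rfl
      exact h.disj x (by simp) hx
  · intro x hx hxO
    rw [Function.update_of_ne]
    · exact h.unvisited x hx hxO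
    · rintro rfl
      exact hx (by simp)
  · intro x y hy
    by_cases hxv : x = v
    · subst hxv
      rw [Function.update_self, List.mem_append, List.mem_singleton] at hy
      rcases hy with hy | rfl
      · exact .inl (h.visited x y hy)
      · exact .inr ⟨rfl, rfl⟩
    · rw [Function.update_of_ne hxv] at hy
      exact .inl (h.visited x y hy)

theorem back_update_of_fwd (hP : P.Valid) (h : DfsInv P n adj (v :: st) O dn rs s)
    (hvw : P.Fwd v w) (x : ℕ) : (∃ y ∈ Function.update dn v (dn v ++ [w]) x, P.Back x y) ↔
      ∃ y ∈ dn x, P.Back x y := by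
  by_cases hxv : x = v
  · subst hxv
    rw [Function.update_self]
    constructor
    · rintro ⟨y, hy, hb⟩
      rw [List.mem_append, List.mem_singleton] at hy
      rcases hy with hy | rfl
      · exact ⟨y, hy, hb⟩
      · exact absurd hvw (hP.not_fwd_of_back hb)
    · rintro ⟨y, hy, hb⟩
      exact ⟨y, List.mem_append_left _ hy, hb⟩
  · rw [Function.update_of_ne hxv]

/-- The status of `w` alone separates the two sorts of arcs: a forward arc from the top never ends
on the stack, a back arc always does. -/
theorem step_back (hP : P.OnRange n adj) (h : DfsInv P n adj (v :: st) O dn rs s)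
    (hl : rs v = w :: l) (hw : w ∈ v :: st) (hs : EdgeStep v s s')
    (hx : s'.reg rX = s.reg rX) (hst : s'.mem aStat = s.mem aStat)
    (hd : s'.mem aDpar = s.mem aDpar) (hf : s'.mem aFin = s.mem aFin)
    (hb : s'.mem aBack = Function.update (s.mem aBack) v 1) :
    DfsInv P n adj (v :: st) O (Function.update dn v (dn v ++ [w])) (Function.update rs v l) s' := by
  obtain ⟨c1, c2, c3, c4⟩ := h.common hl hs
  have harc := (h.arc hP hl).1
  have hback : P.Back v w := by
    rcases hP.valid.arc_iff.1 harc with h1 | h1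
    · exact absurd hw (hP.valid.not_mem_of_fwd h.path h1)
    · exact h1
  exact {
    zero := by rw [hs.zero, h.zero]
    one := by rw [hs.one, h.one]
    edge := c1
    linked := by rw [hd, hx]; exact h.linked
    path := h.path
    stat := by rw [hst]; exact h.stat
    disj := h.disj
    st_lt := h.st_lt
    ord_lt := h.ord_lt
    nodup := h.nodup
    count := by rw [hs.count, h.count]
    ord := by rw [hs.ord]; exact h.ord
    unvisited := c3
    finished := c2
    visited := fun x y hy => by
      rcases c4 x y hy with h1 | ⟨-, rfl⟩
      · exact h1
      · exact .inl hw
    sorted := h.sorted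
    closed := h.closed
    back := fun x => by
      rw [hb]
      by_cases hxv : x = v
      · subst hxv
        rw [Function.update_self, Function.update_self, if_pos ⟨w, by simp, hback⟩]
      · rw [Function.update_of_ne hxv, Function.update_of_ne hxv, h.back x]
    fin := fun x => by
      rw [hf, h.fin x, Parse.fwdCount_update_of_not]
      exact fun h1 => hP.valid.not_fwd_of_back hback h1.2
    root := h.root }

theorem step_fwd (hP : P.OnRange n adj) (h : DfsInv P n adj (v :: st) O dn rs s)
    (hl : rs v = w :: l) (hw : w ∉ v :: st)
    (hf : s'.mem aFin = Function.update (s.mem aFin) w (s.mem aFin w + 1))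
    (hb : s'.mem aBack = s.mem aBack) :
    P.Fwd v w ∧ (∀ x, s'.mem aFin x =
      P.fwdCount n (Function.update dn v (dn v ++ [w])) x) ∧
    ∀ x, s'.mem aBack x = open Classical in
      if ∃ y ∈ Function.update dn v (dn v ++ [w]) x, P.Back x y then 1 else 0 := by
  obtain ⟨harc, hdn⟩ := h.arc hP hl
  have hfwd : P.Fwd v w := by
    rcases hP.valid.arc_iff.1 harc with h1 | h1
    · exact h1
    · exact absurd (List.mem_cons_of_mem _ (hP.valid.mem_of_back h.path h1)) hw
  refine ⟨hfwd, fun x => ?_, fun x => ?_⟩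
  · rw [hf]
    by_cases hxw : x = w
    · subst hxw
      rw [Function.update_self, h.fin x,
        Parse.fwdCount_update_self (h.st_lt v (by simp)) hdn hfwd]
    · rw [Function.update_of_ne hxw, h.fin x, Parse.fwdCount_update_of_not fun h1 => hxw h1.1]
  · rw [hb, h.back x]
    have := h.back_update_of_fwd hP.valid hfwd x
    by_cases hc : ∃ y ∈ dn x, P.Back x y
    · rw [if_pos hc, if_pos (this.2 hc)]
    · rw [if_neg hc, if_neg fun h => hc (this.1 h)]

theorem step_cross (hP : P.OnRange n adj) (h : DfsInv P n adj (v :: st) O dn rs s)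
    (hl : rs v = w :: l) (hw : w ∉ v :: st) (hwO : w ∈ O) (hs : EdgeStep v s s')
    (hx : s'.reg rX = s.reg rX) (hst : s'.mem aStat = s.mem aStat)
    (hd : s'.mem aDpar = s.mem aDpar)
    (hf : s'.mem aFin = Function.update (s.mem aFin) w (s.mem aFin w + 1))
    (hb : s'.mem aBack = s.mem aBack) :
    DfsInv P n adj (v :: st) O (Function.update dn v (dn v ++ [w])) (Function.update rs v l) s' := by
  obtain ⟨c1, c2, c3, c4⟩ := h.common hl hs
  obtain ⟨-, d1, d2⟩ := h.step_fwd hP hl hw hf hb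
  exact {
    zero := by rw [hs.zero, h.zero]
    one := by rw [hs.one, h.one]
    edge := c1
    linked := by rw [hd, hx]; exact h.linked
    path := h.path
    stat := by rw [hst]; exact h.stat
    disj := h.disj
    st_lt := h.st_lt
    ord_lt := h.ord_lt
    nodup := h.nodup
    count := by rw [hs.count, h.count]
    ord := by rw [hs.ord]; exact h.ord
    unvisited := c3
    finished := c2
    visited := fun x y hy => by
      rcases c4 x y hy with h1 | ⟨-, rfl⟩
      · exact h1
      · exact .inr hwO
    sorted := h.sorted
    closed := h.closed
    back := d2
    fin := d1
    root := h.root }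

theorem step_visit (hP : P.OnRange n adj) (h : DfsInv P n adj (v :: st) O dn rs s)
    (hl : rs v = w :: l) (hw : w ∉ v :: st) (hwO : w ∉ O) (hs : EdgeStep v s s')
    (hx : s'.reg rX = w + 1) (hst : s'.mem aStat = Function.update (s.mem aStat) w 1)
    (hd : s'.mem aDpar = Function.update (s.mem aDpar) w (s.reg rX))
    (hf : s'.mem aFin = Function.update (s.mem aFin) w (s.mem aFin w + 1))
    (hb : s'.mem aBack = s.mem aBack) :
    DfsInv P n adj (w :: v :: st) O (Function.update dn v (dn v ++ [w]))
      (Function.update rs v l) s' := by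
  obtain ⟨c1, c2, c3, c4⟩ := h.common hl hs
  obtain ⟨d0, d1, d2⟩ := h.step_fwd hP hl hw hf hb
  exact {
    zero := by rw [hs.zero, h.zero]
    one := by rw [hs.one, h.one]
    edge := c1
    linked := by
      rw [hd, hx]
      exact h.linked.push hw
    path := h.path.cons d0.arc hw
    stat := fun x => by
      rw [hst]
      by_cases hxw : x = w
      · subst hxw
        simp
      · rw [Function.update_of_ne hxw, h.stat x]
        simp [hxw]
    disj := fun x hx => by
      rcases List.mem_cons.1 hx with rfl | hx
      · exact hwO
      · exact h.disj x hx
    st_lt := fun x hx => by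
      rcases List.mem_cons.1 hx with rfl | hx
      · exact (hP.arc_lt d0.arc).2
      · exact h.st_lt x hx
    ord_lt := h.ord_lt
    nodup := h.nodup
    count := by rw [hs.count, h.count]
    ord := by rw [hs.ord]; exact h.ord
    unvisited := fun x hx => c3 x fun h1 => hx (List.mem_cons_of_mem _ h1)
    finished := c2
    visited := fun x y hy => by
      rcases c4 x y hy with (h1 | h1) | ⟨-, rfl⟩
      · exact .inl (List.mem_cons_of_mem _ h1)
      · exact .inr h1
      · exact .inl (by simp)
    sorted := h.sorted
    closed := h.closed
    back := d2
    fin := d1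
    root := h.root.imp_left (List.mem_cons_of_mem _) }

/-- All neighbors of `v` have been visited, and its forward neighbors cannot be on the stack, where
numbers are at least that of `v`. So they precede `v` in the finishing order, which keeps it closed
and sorted. -/
theorem step_finish (hP : P.OnRange n adj) (h : DfsInv P n adj (v :: st) O dn rs s)
    (hl : rs v = []) (h0 : s'.reg rZ = s.reg rZ) (h1 : s'.reg rOne = s.reg rOne)
    (hk : s'.reg rK = s.reg rK + 1) (hx : s'.reg rX = s.mem aDpar v)
    (hst : s'.mem aStat = Function.update (s.mem aStat) v 2)
    (ho : s'.mem aOrd = Function.update (s.mem aOrd) (s.reg rK) v)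
    (hm : ∀ A, A ≠ aStat → A ≠ aOrd → s'.mem A = s.mem A) :
    DfsInv P n adj st (O ++ [v]) dn rs s' := by
  have hv := h.st_lt v (by simp)
  have hvO := h.disj v (by simp)
  have hvst : v ∉ st := (List.nodup_cons.1 h.path.nodup).1
  have hclosed : ∀ w, P.Fwd v w → w ∈ O := by
    intro w hw
    have h2 : w ∈ dn v := by
      have := (hP.mem_adj v hv w).2 hw.arc
      rwa [h.edge.split v hv, hl, List.append_nil] at this
    rcases h.visited v w h2 with h3 | h3
    · exact absurd h3 (hP.valid.not_mem_of_fwd h.path hw)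
    · exact h3
  have hmv : ∀ x, (x ∈ st ∨ x ∈ O ++ [v]) ↔ (x ∈ v :: st ∨ x ∈ O) := by
    intro x
    simp only [List.mem_append, List.mem_cons, List.not_mem_nil, or_false]
    tauto
  exact {
    zero := by rw [h0, h.zero]
    one := by rw [h1, h.one]
    edge := by
      constructor
      · exact h.edge.split
      · rw [hm _ (by simp) (by simp)]
        exact h.edge.rem
      · rw [hm _ (by simp) (by simp), hm _ (by simp) (by simp)]
        exact h.edge.cur
    linked := by
      rw [hm _ (by simp) (by simp), hx]
      exact h.linked.2
    path := h.path.tail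
    stat := fun x => by
      rw [hst]
      by_cases hxv : x = v
      · subst hxv
        simp [hvst]
      · rw [Function.update_of_ne hxv, h.stat x]
        simp [hxv]
    disj := fun x hx => by
      have := h.disj x (List.mem_cons_of_mem _ hx)
      have hxv : x ≠ v := fun e => hvst (e ▸ hx)
      simp [this, hxv]
    st_lt := fun x hx => h.st_lt x (List.mem_cons_of_mem _ hx)
    ord_lt := fun x hx => by
      rcases List.mem_append.1 hx with hx | hx
      · exact h.ord_lt x hx
      · rwa [List.mem_singleton.1 hx]
    nodup := by
      rw [List.nodup_append]
      refine ⟨h.nodup, by simp, fun a ha b hb => ?_⟩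
      rw [List.mem_singleton.1 hb]
      rintro rfl
      exact hvO ha
    count := by rw [hk, h.count]; simp
    ord := by
      rw [ho, reads_append, h.count]
      refine ⟨?_, by simp [Reads]⟩
      have := h.ord
      have aux : ∀ (l : List ℕ) p, p + l.length ≤ O.length → Reads (s.mem aOrd) p l →
          Reads (Function.update (s.mem aOrd) O.length v) p l := by
        intro l
        induction l with
        | nil => exact fun _ _ _ => True.intro
        | cons a l ih =>
          intro p hp hr
          simp only [List.length_cons] at hp
          refine ⟨?_, ih _ (by omega) hr.2⟩
          rw [Function.update_of_ne (by omega)]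
          exact hr.1
      exact aux O 0 (by omega) h.ord
    unvisited := fun x hx hxO => by
      have := (not_congr (hmv x)).1 (by tauto)
      exact h.unvisited x (by tauto) (by tauto)
    finished := fun x hx => by
      rcases List.mem_append.1 hx with hx | hx
      · exact h.finished x hx
      · rwa [List.mem_singleton.1 hx]
    visited := fun x y hy => (hmv y).2 (h.visited x y hy)
    sorted := by
      rw [List.pairwise_append]
      refine ⟨h.sorted, by simp, fun a ha b hb hab => ?_⟩
      rw [List.mem_singleton.1 hb] at hab
      exact hvO (h.closed a ha v hab)
    closed := fun u hu w hw => by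
      rw [List.mem_append] at hu ⊢
      rcases hu with hu | hu
      · exact .inl (h.closed u hu w hw)
      · rw [List.mem_singleton.1 hu] at hw
        exact .inl (hclosed w hw)
    back := by rw [hm _ (by simp) (by simp)]; exact h.back
    fin := by rw [hm _ (by simp) (by simp)]; exact h.fin
    root := (hmv _).2 h.root }

end DfsInv

theorem sum_update_pred {n v : ℕ} {f : ℕ → ℕ} (hv : v < n) (hf : 0 < f v) :
    ∑ x ∈ Finset.range n, Function.update f v (f v - 1) x + 1 = ∑ x ∈ Finset.range n, f x := by
  rw [Finset.sum_update_of_mem (Finset.mem_range.2 hv),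
    Finset.sum_eq_add_sum_sdiff_singleton_of_mem (Finset.mem_range.2 hv) f]
  omega

theorem runs_dfsProg {P : Parse ℕ} {n : ℕ} {adj : ℕ → List ℕ} (hP : P.OnRange n adj) {s : State}
    (hG : HasGraph n P.root adj s)
    (hrem : ∀ v, v < n → s.mem aRem v = (adj v).length ∧ s.mem aCur v = s.mem aStart v)
    (hmem : ∀ A, A ∈ [aStat, aDpar, aOrd, aFin, aBack] → s.mem A = fun _ => 0) :
    Runs dfsProg s fun s' t => (∃ O, HasOrder P n O s') ∧
      t ≤ 30 * (degSum n adj 0 + n) + 10 := by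
  have hm1 := hmem aStat (by simp)
  have hm2 := hmem aDpar (by simp)
  have hm4 := hmem aFin (by simp)
  have hm5 := hmem aBack (by simp)
  unfold dfsProg
  simp only [runs_block_cons, runs_block_nil, runs_instr, Instr.apply]
  refine runs_loop (fun s => ∃ st O dn rs, DfsInv P n adj st O dn rs s)
    -- Each round either traverses one remaining edge or finishes one vertex.
    (fun s => 30 * (∑ v ∈ Finset.range n, s.mem aRem v + (n - s.reg rK))) ?_ ?_ ?_
  · refine ⟨[P.root], [], fun _ => [], adj, ?_⟩
    constructor <;> try simp [hG.zero, hG.one, hG.src, hm1, hm2, hm4, hm5, Reads, Linked]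
    · constructor <;> simp
      · exact fun v hv => (hrem v hv).1
      · intro v hv
        rw [(hrem v hv).2]
        exact hG.start v hv
    · constructor <;> simp
    · intro v
      simp [Function.update_apply]
    · exact hP.root_lt
    · simp [Parse.fwdCount]
  · rintro s1 hs1 ⟨st, O, dn, rs, hI⟩ hb
    have zero := hI.zero
    have one := hI.one
    simp only [Test.Holds, zero] at hb
    obtain ⟨v, st, rfl, hx, linked'⟩ := hI.linked.exists_cons hb
    have hv : v < n := hI.st_lt v (by simp)
    have hvO : v ∉ O := hI.disj v (by simp)
    have hstat := hI.stat
    have hrm := hI.edge.rem v hv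
    have hcur := hI.edge.cur v hv
    simp only [runs_block_cons, runs_block_nil, runs_instr, runs_ite, runs_skip, Instr.apply]
    simp only [State.setReg_reg, State.setReg_mem, State.setMem_reg, State.setMem_mem, hx, zero,
      one, Test.Holds, ↓reduceIte, Nat.reduceEqDiff, Nat.add_sub_cancel]
    rcases hl : rs v with _ | ⟨w, l⟩
    · rw [hl] at hrm
      refine ⟨fun h => absurd h (by simp [hrm]), fun _ => ⟨⟨st, O ++ [v], dn, rs, ?_⟩, ?_⟩⟩
      · refine hI.step_finish hP hl ?_ ?_ ?_ ?_ ?_ ?_ ?_ <;> simp +contextual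
      · have h2 : (O ++ [v]).length ≤ n := by
          have h3 : (O ++ [v]).toFinset.card ≤ (Finset.range n).card := by
            refine Finset.card_le_card fun x hx => ?_
            rw [List.mem_toFinset, List.mem_append, List.mem_singleton] at hx
            rcases hx with hx | rfl
            · exact Finset.mem_range.2 (hI.ord_lt x hx)
            · exact Finset.mem_range.2 hv
          rw [List.toFinset_card_of_nodup, Finset.card_range] at h3
          · exact h3
          · rw [List.nodup_append]
            refine ⟨hI.nodup, by simp, fun a ha b hb => ?_⟩
            rw [List.mem_singleton.1 hb]
            rintro rfl
            exact hvO ha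
        have h3 := hI.count
        simp at h2 ⊢
        omega
    · rw [hl] at hrm hcur
      have hw := hcur.1
      have hpos : 0 < s1.mem aRem v := by simp [hrm]
      have hsum := sum_update_pred hv hpos
      have hsw := hstat w
      have hn1 : ¬ s1.mem aStat w = 1 → w ∉ v :: st := fun h hm => h (by rw [hsw, if_pos hm])
      have hn2 : s1.mem aStat w = 0 → w ∉ O := by
        intro h hm
        rw [hsw, if_pos hm] at h
        split_ifs at h
      have hn3 : ¬ s1.mem aStat w = 1 → ¬ s1.mem aStat w = 0 → w ∈ O := by
        intro h h'
        by_contra hm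
        rw [hsw, if_neg (hn1 h), if_neg hm] at h'
        exact h' rfl
      rw [hw]
      refine ⟨fun _ => ⟨fun h => ⟨⟨v :: st, O, _, _, hI.step_back hP hl (w := w) ?_ ?_ ?_ ?_ ?_ ?_ ?_⟩,
        ?_⟩, fun h => ⟨fun h' => ⟨⟨w :: v :: st, O, _, _,
          hI.step_visit hP hl (w := w) ?_ ?_ ?_ ?_ ?_ ?_ ?_ ?_⟩, ?_⟩,
          fun h' => ⟨⟨v :: st, O, _, _, hI.step_cross hP hl (w := w) ?_ ?_ ?_ ?_ ?_ ?_ ?_ ?_⟩,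
          ?_⟩⟩⟩, fun h => absurd hpos h⟩
      · by_contra hn
        rw [hsw, if_neg hn] at h
        split_ifs at h <;> omega
      all_goals first
        | exact hn1 h
        | exact hn2 h'
        | exact hn3 h h'
        | exact ⟨by simp, by simp, by simp, by simp, by simp, by simp, by simp⟩
        | simp; done
        | simp [hx]; done
        | simp; omega
  · rintro s1 t hs1 ⟨st, O, dn, rs, hI⟩ hb ht
    have h0 : s1.reg rX = 0 := by
      simp only [Test.Holds, hI.zero] at hb
      omega
    have hl := hI.linked
    rw [h0] at hl
    obtain rfl := hl.eq_nil
    refine ⟨⟨O, hI.hasOrder hP⟩, ?_⟩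
    have : ∑ v ∈ Finset.range n, s.mem aRem v = degSum n adj 0 := by
      rw [degSum, ← Finset.range_eq_Ico]
      exact Finset.sum_congr rfl fun v hv => (hrem v (Finset.mem_range.1 hv)).1
    simp [this] at ht
    omega

end RAM

-- Recognition of the statement graphs by local rules

notation "rI" => (14 : ℕ)
notation "rA" => (15 : ℕ)
notation "rB" => (16 : ℕ)
notation "rL" => (17 : ℕ)
notation "rU" => (18 : ℕ)

notation "aKind" => (13 : ℕ)
notation "aTl" => (14 : ℕ)
notation "aSnk" => (15 : ℕ)

namespace StatementKind

/-- The first letter of the code of a statement graph; `1` for the trivial one. -/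
def number : StatementKind → ℕ
  | trivial => 1
  | sequence => 2
  | ifThen => 3
  | whileLoop => 4
  | repeatLoop => 5
  | ifThenElse => 6
  | pCase p _ => p + 4

theorem number_pos (k : StatementKind) : 0 < k.number := by
  cases k <;> simp [number]

theorem number_eq_one {k : StatementKind} : k.number = 1 ↔ k = trivial := by
  cases k <;> simp [number]

end StatementKind

namespace RAM

open Program Instr Test

/-- Decide by local rules into which kind of statement graph the vertex `v` is expanded, and what
is its last child. -/
def classify (v : ℕ) (deg back fst snd snk fin : ℕ → ℕ) : ℕ × ℕ :=
  if 0 < deg v then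
    if back v = 0 then
      if deg v = 1 then
        if fin (fst v - 1) = 1 then
          if fst (snk (fst v - 1)) = v + 1 then (5, snd (snk (fst v - 1)) - 1)
          else if snd (snk (fst v - 1)) = v + 1 then (5, fst (snk (fst v - 1)) - 1)
          else (2, fst v - 1)
        else (1, v)
      else if deg v = 2 then
        if fst (snk (fst v - 1)) = v + 1 then (4, snd v - 1)
        else if fst (snk (snd v - 1)) = v + 1 then (4, fst v - 1)
        else if fst (snk (fst v - 1)) = snd v then (3, snd v - 1)
        else if fst (snk (snd v - 1)) = fst v then (3, fst v - 1)
        else (6, fst (snk (fst v - 1)) - 1)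
      else (deg v + 4, fst (snk (fst v - 1)) - 1)
    else (1, v)
  else (1, v)

/-- Set `rK` and `rT` to the two components of `classify` for the vertex in `rV`. -/
def classifyProg : Program := block [
  instr (const rK 1),
  instr (copy rT rV),
  instr (load rD aDeg rV),
  instr (load rX aBack rV),
  ite (lt rZ rD) (ite (eq rX rZ) (block [
    instr (load rL aFst rV),
    instr (copy rY rL),
    instr (dec rY),
    instr (load rU aSnk rY),
    instr (load rA aFst rU),
    instr (load rB aSnd rU),
    instr (copy rP rV),
    instr (inc rP),
    instr (const rX 2),
    ite (eq rD rOne) (block [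
      instr (load rX aFin rY),
      ite (eq rX rOne)
        (ite (eq rA rP) (block [instr (const rK 5), instr (copy rT rB), instr (dec rT)])
          (ite (eq rB rP) (block [instr (const rK 5), instr (copy rT rA), instr (dec rT)])
            (block [instr (const rK 2), instr (copy rT rY)]))) skip])
      (ite (eq rD rX) (block [
        instr (load rH aSnd rV),
        instr (copy rW rH),
        instr (dec rW),
        instr (load rX aSnk rW),
        instr (load rX aFst rX),
        ite (eq rA rP) (block [instr (const rK 4), instr (copy rT rW)])
          (ite (eq rX rP) (block [instr (const rK 4), instr (copy rT rY)])
            (ite (eq rA rH) (block [instr (const rK 3), instr (copy rT rW)])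
              (ite (eq rX rL) (block [instr (const rK 3), instr (copy rT rY)])
                (block [instr (const rK 6), instr (copy rT rA), instr (dec rT)]))))])
        (block [instr (copy rK rD), instr (inc rK), instr (inc rK), instr (inc rK), instr (inc rK),
          instr (copy rT rA), instr (dec rT)]))]) skip) skip]

theorem runs_classifyProg {s : State} (h0 : s.reg rZ = 0) (h1 : s.reg rOne = 1) :
    Runs classifyProg s fun s' t =>
      (s'.reg rK, s'.reg rT) = classify (s.reg rV) (s.mem aDeg) (s.mem aBack) (s.mem aFst)
        (s.mem aSnd) (s.mem aSnk) (s.mem aFin) ∧ t ≤ 50 := by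
  unfold classifyProg classify
  simp only [runs_block_cons, runs_block_nil, runs_instr, runs_ite, runs_skip, Instr.apply,
    State.setReg_reg, State.setReg_mem, Test.Holds, h0, h1, ↓reduceIte, Nat.reduceEqDiff]
  split_ifs <;> simp_all

/-- The parse of the graph of the input: the vertices are classified in finishing order. -/
def parseProg : Program := block [
  instr (const rI 0),
  loop (lt rI rN) (block [
    instr (load rV aOrd rI),
    classifyProg,
    instr (store aKind rV rK),
    instr (store aTl rV rT),
    ite (eq rK rOne) (instr (store aSnk rV rV))
      (block [instr (load rX aSnk rT), instr (store aSnk rV rX)]),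
    instr (inc rI)])]

end RAM

namespace List

theorem eq_singleton_of_forall_mem {α : Type*} {l : List α} {a : α} (hl : l.Nodup)
    (h : ∀ w, w ∈ l ↔ w = a) : l = [a] := by
  refine List.perm_singleton.1 ((List.perm_ext_iff_of_nodup hl (by simp)).2 fun w => ?_)
  rw [h, mem_singleton]

theorem eq_pair_of_forall_mem {α : Type*} {l : List α} {a b : α} (hl : l.Nodup) (hab : a ≠ b)
    (h : ∀ w, w ∈ l ↔ w = a ∨ w = b) : l = [a, b] ∨ l = [b, a] := by
  have hp : l.Perm [a, b] := (List.perm_ext_iff_of_nodup hl (by simp [hab])).2 fun w => by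
    simp [h]
  have : l.length = 2 := hp.length_eq
  obtain ⟨x, y, rfl⟩ := List.length_eq_two.1 this
  have hx := (h x).1 (by simp)
  have hy := (h y).1 (by simp)
  have hxy : x ≠ y := by simpa using hl
  rcases hx with rfl | rfl <;> rcases hy with rfl | rfl <;> simp_all

end List

namespace RAM

theorem mem_of_headPtr_eq {l : List ℕ} {y : ℕ} (h : headPtr l = y + 1) : y ∈ l := by
  cases l with
  | nil => simp [headPtr] at h
  | cons a l =>
    simp only [headPtr, Nat.add_right_cancel_iff] at h
    simp [h]

end RAM

open RAM in
-- An inner node emits no back arc, as a back arc leaves from a sink. A leaf without back arcs has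
-- at most one out-neighbor, the last child of some `w`, which then has a second forward
-- in-neighbor; for sequence and repeat the only out-neighbor has just one. Once `v` is known to be
-- inner, the out-degree leaves few kinds, and these are told apart by where the sinks of the
-- children lead: back to `v`, to another child listed at `v`, or to a common last child. Adjacency
-- lists come in any order, hence the symmetric tests.
theorem Parse.OnRange.classify_eq {P : Parse ℕ} {n : ℕ} {adj : ℕ → List ℕ} (h : P.OnRange n adj)
    {v : ℕ} (hv : v < n) {deg back fst snd snk fin : ℕ → ℕ}
    (hdeg : ∀ u, u < n → deg u = (adj u).length)
    (hfst : ∀ u, u < n → fst u = headPtr (adj u))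
    (hsnd : ∀ u, u < n → snd u = headPtr (adj u).tail)
    (hback : back v = 0 ↔ ∀ w, ¬ P.Back v w)
    (hfin : ∀ w, P.Fwd v w → (fin w = 1 ↔ ∀ u, P.Fwd u w → u = v))
    (hsnk : ∀ w, P.Child v w → snk w = P.snk w) :
    (classify v deg back fst snd snk fin).1 = (P.kd v).number ∧
      (classify v deg back fst snd snk fin).2 =
        P.ch v ((P.kd v).order - 1) := by
  have hV := h.valid
  by_cases hk : P.kd v = .trivial
  · suffices hc : classify v deg back fst snd snk fin = (1, v) by
      simp [hc, hk, StatementKind.number, StatementKind.order, hV.ch_zero]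
    unfold classify
    by_cases hd : 0 < deg v
    · by_cases hb : back v = 0
      · rw [if_pos hd, if_pos hb]
        rw [hdeg v hv] at hd
        obtain ⟨y, hy⟩ := List.exists_mem_of_length_pos hd
        rw [h.mem_adj v hv] at hy
        obtain ⟨w, i, h0, hi, rfl⟩ := hV.exists_of_arc_of_kd_eq hk hy
        have hnb : ¬ (P.kd w).Edge i 0 := fun he =>
          hback.1 hb w ⟨i, he, (P.out_pos w h0.ne').symm⟩
        have hmem : ∀ y, P.Arc (P.snk (P.ch w i)) y →
            y = P.ch w ((P.kd w).order - 1) ∧ (P.kd w).Edge i ((P.kd w).order - 1) := by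
          intro y hy
          obtain ⟨j, he, rfl⟩ := (hV.arc_snk_iff h0 hi).1 hy
          rcases he.eq_or_eq h0 with rfl | rfl
          · exact absurd he hnb
          · exact ⟨rfl, he⟩
        obtain ⟨rfl, he⟩ := hmem _ hy
        have hl : adj (P.snk (P.ch w i)) = [P.ch w ((P.kd w).order - 1)] := by
          refine List.eq_singleton_of_forall_mem (h.nodup_adj _ hv) fun x => ?_
          rw [h.mem_adj _ hv]
          exact ⟨fun hx => (hmem _ hx).1, fun hx => hx ▸ hy⟩
        have hF : P.Fwd (P.snk (P.ch w i)) (P.ch w ((P.kd w).order - 1)) :=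
          ⟨w, i, _, he, by omega, (P.out_pos w h0.ne').symm, rfl⟩
        rw [hdeg _ hv, hfst _ hv, hl]
        simp only [List.length_singleton, headPtr, ↓reduceIte, Nat.add_sub_cancel]
        -- The in-count of the last child is not `1`: by `exists_other` a different exit of `w` also
        -- leads there.
        rw [if_neg]
        rw [hfin _ hF]
        intro hu
        rcases he.exists_other h0 with he' | ⟨i', hne, he'⟩
        · exact hnb he'
        · have := hu (P.out w i') ⟨w, i', _, he', by omega, rfl, rfl⟩
          rw [← P.out_pos w h0.ne'] at this
          exact hne (hV.out_injective (by have := he'.lt_left; omega) (by omega) this)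
      · rw [if_pos hd, if_neg hb]
    · rw [if_neg hd]
  · have hb : back v = 0 := by
      rw [hback]
      rintro w ⟨i, he, rfl⟩
      refine hk ?_
      rw [P.out_pos w he.ne]
      exact hV.kd_snk _
    have hch : ∀ i, P.ch v i < n := fun i => h.ch_lt v i hv
    have hs : ∀ i, P.snk (P.ch v i) < n := fun i => h.snk_lt _ (hch i)
    have hinj : ∀ i j, i < (P.kd v).order → j < (P.kd v).order → i ≠ j → P.ch v i ≠ P.ch v j :=
      fun i j hi hj hij he => hij (hV.ch_injective hi hj he)
    have hadj : ∀ w, w ∈ adj v ↔ ∃ j, (P.kd v).Edge 0 j ∧ w = P.ch v j := fun w => by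
      rw [h.mem_adj v hv, hV.arc_of_kd_ne hk]
    have hz : ∀ i, 0 < i → i + 1 < (P.kd v).order → ∀ w, w ∈ adj (P.snk (P.ch v i)) ↔
        ∃ j, (P.kd v).Edge i j ∧ w = P.ch v j := fun i h0 hi w => by
      rw [h.mem_adj _ (hs i), hV.arc_snk_iff h0 hi]
    -- Arcs from the sink of the whole expansion leave the subtree of `v`, so tests applied to the
    -- last child by mistake of order cannot succeed.
    have hlast : ∀ i, i < (P.kd v).order → ∀ w ∈ adj (P.snk (P.ch v ((P.kd v).order - 1))),
        w ≠ P.ch v i := by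
      rintro i hi w hw rfl
      rw [h.mem_adj _ (hs _), ← hV.snk_ch v hk] at hw
      refine hV.not_desc_of_arc_snk hw ?_
      rcases Nat.eq_zero_or_pos i with rfl | h0
      · rw [hV.ch_zero]
        exact .refl
      · exact .single ⟨i, h0, hi, rfl⟩
    have hsk : ∀ i, 0 < i → i < (P.kd v).order → snk (P.ch v i) = P.snk (P.ch v i) :=
      fun i h0 hi => hsnk _ ⟨i, h0, hi, rfl⟩
    have hnl : ∀ i j, i < (P.kd v).order → j + 1 = (P.kd v).order →
        fst (P.snk (P.ch v j)) ≠ P.ch v i + 1 := by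
      intro i j hi hj he
      obtain rfl : j = (P.kd v).order - 1 := by omega
      rw [hfst _ (hs _)] at he
      exact hlast i hi _ (mem_of_headPtr_eq he) rfl
    have hnl' : ∀ i j, i < (P.kd v).order → j + 1 = (P.kd v).order →
        snd (P.snk (P.ch v j)) ≠ P.ch v i + 1 := by
      intro i j hi hj he
      obtain rfl : j = (P.kd v).order - 1 := by omega
      rw [hsnd _ (hs _)] at he
      exact hlast i hi _ (List.mem_of_mem_tail (mem_of_headPtr_eq he)) rfl
    have hfin' : (P.kd v).Edge 0 1 → fin (P.ch v 1) = 1 := by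
      intro he
      rw [hfin _ ⟨v, 0, 1, he, one_ne_zero, (P.out_zero v).symm, rfl⟩]
      intro u hu
      obtain ⟨i, he', rfl⟩ := (hV.fwd_ch_iff one_pos he.lt_right).1 hu
      rw [StatementKind.edge_one_unique he', P.out_zero]
    have h0 := hV.ch_zero v
    unfold classify
    cases hkd : P.kd v with
    | trivial => exact absurd hkd hk
    | sequence =>
      simp only [hkd, StatementKind.order, StatementKind.Edge, StatementKind.number] at *
      have hl : adj v = [P.ch v 1] := List.eq_singleton_of_forall_mem (h.nodup_adj v hv) (by
        intro w; rw [hadj]; simp)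
      have e1 := hnl 0 1 (by omega) rfl
      have e2 := hnl' 0 1 (by omega) rfl
      rw [h0] at e1 e2
      simp [hdeg v hv, hfst v hv, hl, hb, headPtr, hfin', hsk, e1, e2]
    | ifThen =>
      simp only [hkd, StatementKind.order, StatementKind.Edge, StatementKind.number] at *
      have hz1 : adj (P.snk (P.ch v 1)) = [P.ch v 2] :=
        List.eq_singleton_of_forall_mem (h.nodup_adj _ (hs 1)) (by
          intro w; rw [hz 1 (by omega) (by omega)]; simp)
      have e1 := hnl 0 2 (by omega) rfl
      have e2 := hnl 1 2 (by omega) rfl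
      have i1 := hinj 0 2 (by omega) (by omega) (by omega)
      rw [h0] at e1 i1
      have f1 : fst (P.snk (P.ch v 1)) = P.ch v 2 + 1 := by simp [hfst _ (hs 1), hz1, headPtr]
      rcases List.eq_pair_of_forall_mem (h.nodup_adj v hv)
        (hinj 1 2 (by omega) (by omega) (by omega)) (by
          intro w; rw [hadj]
          constructor
          · rintro ⟨j, hj, rfl⟩
            obtain rfl | rfl : j = 1 ∨ j = 2 := by omega
            · exact .inl rfl
            · exact .inr rfl
          · rintro (rfl | rfl)
            · exact ⟨1, by simp, rfl⟩
            · exact ⟨2, by simp, rfl⟩) with hl | hl <;>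
      simp [hdeg v hv, hfst v hv, hsnd v hv, hl, hb, headPtr, hsk, e1, e2, f1, i1.symm]
    | whileLoop =>
      simp only [hkd, StatementKind.order, StatementKind.Edge, StatementKind.number] at *
      have hz1 : adj (P.snk (P.ch v 1)) = [v] :=
        List.eq_singleton_of_forall_mem (h.nodup_adj _ (hs 1)) (by
          intro w; rw [hz 1 (by omega) (by omega)]; simp [h0])
      have e1 := hnl 0 2 (by omega) rfl
      rw [h0] at e1
      have f1 : fst (P.snk (P.ch v 1)) = v + 1 := by simp [hfst _ (hs 1), hz1, headPtr]
      rcases List.eq_pair_of_forall_mem (h.nodup_adj v hv)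
        (hinj 1 2 (by omega) (by omega) (by omega)) (by
          intro w; rw [hadj]
          constructor
          · rintro ⟨j, hj, rfl⟩
            obtain rfl | rfl : j = 1 ∨ j = 2 := by omega
            · exact .inl rfl
            · exact .inr rfl
          · rintro (rfl | rfl)
            · exact ⟨1, by simp, rfl⟩
            · exact ⟨2, by simp, rfl⟩) with hl | hl <;>
      simp [hdeg v hv, hfst v hv, hsnd v hv, hl, hb, headPtr, hsk, e1, f1]
    | repeatLoop =>
      simp only [hkd, StatementKind.order, StatementKind.Edge, StatementKind.number] at *
      have hl : adj v = [P.ch v 1] := List.eq_singleton_of_forall_mem (h.nodup_adj v hv) (by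
        intro w; rw [hadj]; simp)
      have i1 := hinj 0 2 (by omega) (by omega) (by omega)
      rw [h0] at i1
      rcases List.eq_pair_of_forall_mem (h.nodup_adj _ (hs 1)) i1 (by
          intro w; rw [hz 1 (by omega) (by omega)]
          constructor
          · rintro ⟨j, hj, rfl⟩
            obtain rfl | rfl : j = 0 ∨ j = 2 := by omega
            · exact .inl h0
            · exact .inr rfl
          · rintro (rfl | rfl)
            · exact ⟨0, by omega, h0.symm⟩
            · exact ⟨2, by simp, rfl⟩) with hz1 | hz1 <;>
      simp [hdeg v hv, hfst v hv, hfst _ (hs 1), hsnd _ (hs 1), hl, hz1, hb, headPtr, hfin', hsk,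
        i1.symm]
    | ifThenElse =>
      simp only [hkd, StatementKind.order, StatementKind.Edge, StatementKind.number] at *
      have hz1 : adj (P.snk (P.ch v 1)) = [P.ch v 3] :=
        List.eq_singleton_of_forall_mem (h.nodup_adj _ (hs 1)) (by
          intro w; rw [hz 1 (by omega) (by omega)]; simp)
      have hz2 : adj (P.snk (P.ch v 2)) = [P.ch v 3] :=
        List.eq_singleton_of_forall_mem (h.nodup_adj _ (hs 2)) (by
          intro w; rw [hz 2 (by omega) (by omega)]; simp)
      have i0 := hinj 0 3 (by omega) (by omega) (by omega)
      have i1 := hinj 1 3 (by omega) (by omega) (by omega)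
      have i2 := hinj 2 3 (by omega) (by omega) (by omega)
      rw [h0] at i0
      have f1 : fst (P.snk (P.ch v 1)) = P.ch v 3 + 1 := by simp [hfst _ (hs 1), hz1, headPtr]
      have f2 : fst (P.snk (P.ch v 2)) = P.ch v 3 + 1 := by simp [hfst _ (hs 2), hz2, headPtr]
      rcases List.eq_pair_of_forall_mem (h.nodup_adj v hv)
        (hinj 1 2 (by omega) (by omega) (by omega)) (by
          intro w; rw [hadj]
          constructor
          · rintro ⟨j, hj, rfl⟩
            obtain rfl | rfl : j = 1 ∨ j = 2 := by omega
            · exact .inl rfl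
            · exact .inr rfl
          · rintro (rfl | rfl)
            · exact ⟨1, by simp, rfl⟩
            · exact ⟨2, by simp, rfl⟩) with hl | hl <;>
      simp [hdeg v hv, hfst v hv, hsnd v hv, hl, hb, headPtr, hsk, f1, f2, i0.symm, i1.symm,
        i2.symm]
    | pCase p hp =>
      simp only [hkd, StatementKind.order, StatementKind.Edge, StatementKind.number] at *
      have hlen : (adj v).length = p := by
        rw [← List.toFinset_card_of_nodup (h.nodup_adj v hv)]
        have : (adj v).toFinset = (Finset.Icc 1 p).image (P.ch v) := by
          ext w
          rw [List.mem_toFinset, hadj, Finset.mem_image]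
          constructor
          · rintro ⟨j, hj, rfl⟩
            exact ⟨j, Finset.mem_Icc.2 (by omega), rfl⟩
          · rintro ⟨j, hj, rfl⟩
            exact ⟨j, by simpa using Finset.mem_Icc.1 hj, rfl⟩
        rw [this, Finset.card_image_of_injOn, Nat.card_Icc, Nat.add_sub_cancel]
        intro i hi j hj he
        by_contra hne
        have hi := Finset.mem_Icc.1 hi
        have hj := Finset.mem_Icc.1 hj
        exact hinj i j (by omega) (by omega) hne he
      obtain ⟨y, l, hl⟩ := List.exists_cons_of_length_pos (l := adj v) (by omega)
      obtain ⟨i, hi, rfl⟩ := (hadj y).1 (by simp [hl])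
      have hi1 : 0 < i ∧ i ≤ p := by omega
      have hz1 : adj (P.snk (P.ch v i)) = [P.ch v (p + 1)] :=
        List.eq_singleton_of_forall_mem (h.nodup_adj _ (hs i)) (by
          intro w; rw [hz i (by omega) (by omega)]
          constructor
          · rintro ⟨j, hj, rfl⟩
            rw [show j = p + 1 by omega]
          · rintro rfl
            exact ⟨p + 1, by omega, rfl⟩)
      have f1 : fst (P.snk (P.ch v i)) = P.ch v (p + 1) + 1 := by
        simp [hfst _ (hs i), hz1, headPtr]
      have g1 : 0 < p := by omega
      have g2 : p ≠ 1 := by omega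
      have g3 : p ≠ 2 := by omega
      have g4 : fst v = P.ch v i + 1 := by simp [hfst v hv, hl, headPtr]
      have g5 := hsk i (by omega) (by omega)
      simp [hdeg v hv, hlen, hb, g1, g2, g3, g4, g5, f1]

/-! ### Construction of the parse in finishing order -/

namespace RAM

open Program Instr Test

theorem reads_getElem {m : ℕ → ℕ} {l : List ℕ} {p i : ℕ} (h : Reads m p l) (hi : i < l.length) :
    m (p + i) = l[i] := by
  induction l generalizing p i with
  | nil => simp at hi
  | cons a l ih =>
    cases i with
    | zero => exact h.1
    | succ i =>
      rw [show p + (i + 1) = p + 1 + i by omega]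
      exact ih h.2 (by simpa using hi)

/-- The length of a list enumerating `0, …, n - 1`. -/
theorem length_eq_of_mem_iff_lt {O : List ℕ} {n : ℕ} (hO : O.Nodup) (h : ∀ v, v ∈ O ↔ v < n) :
    O.length = n := by
  rw [← List.toFinset_card_of_nodup hO, ← Finset.card_range n]
  congr 1
  ext v
  simp [h]

/-- The arrays describing the parse tree. -/
structure HasParse (P : Parse ℕ) (n : ℕ) (s : State) : Prop where
  kind : ∀ v, v < n → s.mem aKind v = (P.kd v).number
  last : ∀ v, v < n → s.mem aTl v = P.ch v ((P.kd v).order - 1)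

/-- A child is reached from its parent by a non-empty forward path, and no forward arc leads to a
later position of the finishing order. -/
theorem HasOrder.child_mem_take {P : Parse ℕ} {n : ℕ} {O : List ℕ} {adj : ℕ → List ℕ} {s : State}
    (hO : HasOrder P n O s) (hP : P.OnRange n adj) {i : ℕ} (hi : i < O.length) {w : ℕ}
    (hw : P.Child O[i] w) : w ∈ O.take i := by
  have hreach : Relation.TransGen P.Fwd O[i] w := by
    obtain ⟨j, h0, hj, rfl⟩ := hw
    refine ((Relation.reflTransGen_iff_eq_or_transGen).1
      ((hP.valid.fwd_reach_snk_and_child _).2 j hj)).resolve_left fun he => ?_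
    exact absurd (hP.valid.num_ch _ j h0 hj) (by rw [he]; exact lt_irrefl _)
  have hlt : w < n := by
    obtain ⟨j, h0, hj, rfl⟩ := hw
    exact hP.ch_lt _ _ ((hO.mem _).1 (List.getElem_mem hi))
  clear hw
  induction hreach with
  | single h =>
    obtain ⟨j, hj, rfl⟩ := List.getElem_of_mem ((hO.mem _).2 hlt)
    have hpw := List.pairwise_iff_getElem.1 hO.sorted
    rw [List.mem_take_iff_getElem]
    refine ⟨j, ?_, rfl⟩
    rcases lt_trichotomy i j with h' | rfl | h'
    · exact absurd h (hpw i j hi hj h')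
    · exact absurd h.arc (hP.valid.not_arc_self _)
    · omega
  | tail _ h ih =>
    obtain ⟨j, hj, rfl⟩ := List.getElem_of_mem ((hO.mem _).2 hlt)
    have hpw := List.pairwise_iff_getElem.1 hO.sorted
    obtain ⟨k, hk, rfl⟩ := List.mem_take_iff_getElem.1 (ih (hP.arc_lt h.arc).1)
    rw [List.mem_take_iff_getElem]
    refine ⟨j, ?_, rfl⟩
    rcases lt_trichotomy k j with h' | rfl | h'
    · exact absurd h (hpw k j _ hj h')
    · exact absurd h.arc (hP.valid.not_arc_self _)
    · omega

theorem runs_parseProg {P : Parse ℕ} {n : ℕ} {O : List ℕ} {adj : ℕ → List ℕ} {s : State}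
    (hP : P.OnRange n adj) (hG : HasGraph n P.root adj s) (hO : HasOrder P n O s) :
    Runs parseProg s fun s' t => HasParse P n s' ∧ t ≤ 70 * n + 10 := by
  have hlen : O.length = n := length_eq_of_mem_iff_lt hO.nodup hO.mem
  unfold parseProg
  simp only [runs_block_cons, runs_block_nil, runs_instr, Instr.apply]
  refine runs_loop
    (fun s' => s'.reg rI ≤ n ∧ ∀ v ∈ O.take (s'.reg rI), s'.mem aKind v = (P.kd v).number ∧
      s'.mem aTl v = P.ch v ((P.kd v).order - 1) ∧ s'.mem aSnk v = P.snk v)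
    (fun s' => 70 * (n - s'.reg rI)) (by simp) ?_ ?_
  · rintro s1 hs1 ⟨hle, hI⟩ hb
    have e0 := hs1.reg rZ (by decide)
    have e1 := hs1.reg rOne (by decide)
    have e3 := hs1.reg rN (by decide)
    have m10 := hs1.mem aOrd (by decide)
    have m2 := hs1.mem aDeg (by decide)
    have m12 := hs1.mem aBack (by decide)
    have m6 := hs1.mem aFst (by decide)
    have m7 := hs1.mem aSnd (by decide)
    have m11 := hs1.mem aFin (by decide)
    simp only [State.setReg_reg, State.setReg_mem, Nat.reduceEqDiff, ↓reduceIte, hG.zero, hG.one,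
      hG.num] at e0 e1 e3 m10 m2 m12 m6 m7 m11
    simp only [Test.Holds, e3] at hb
    generalize hi : s1.reg rI = i at *
    have hil : i < O.length := by omega
    have hv := (hO.mem _).1 (List.getElem_mem hil)
    have hload : s1.mem aOrd i = O[i] := by
      have := reads_getElem hO.ord hil
      rwa [zero_add, ← m10] at this
    simp only [runs_block_cons, runs_block_nil, runs_instr, runs_ite, Instr.apply]
    refine (runs_classifyProg (by simp [e0]) (by simp [e1])).mono ?_
    rintro s2 t2 hs2 ⟨hc, ht2⟩
    have f1 := hs2.reg rOne (by decide)
    have f14 := hs2.reg rI (by decide)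
    have f5 := hs2.reg rV (by decide)
    have k13 := hs2.mem aKind (by decide)
    have k14 := hs2.mem aTl (by decide)
    have k15 := hs2.mem aSnk (by decide)
    simp only [State.setReg_reg, State.setReg_mem, ↓reduceIte, Nat.reduceEqDiff, hi, hload, m2, m12, m6,
      m7, m11, e1] at hc f1 f14 f5 k13 k14 k15
    -- The rules consult sinks of children only, and these are already correct on the prefix `O.take
    -- i`.
    have hcl := hP.classify_eq (v := O[i]) hv hG.deg hG.fst hG.snd (hO.back _ hv)
      (fun w hw => hO.fin _ _ hw) (snk := s1.mem aSnk)
      (fun w hw => (hI w (hO.child_mem_take hP hil hw)).2.2)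
    rw [← hc] at hcl
    obtain ⟨hk, ht⟩ := hcl
    dsimp only at hk ht
    simp only [State.setReg_reg, State.setReg_mem, State.setMem_reg, State.setMem_mem, Test.Holds,
      ↓reduceIte, Nat.reduceEqDiff, f1, f14, f5, hk, ht, k13, k14, k15]
    have hI' : ∀ (A : ℕ → ℕ) x (F : ℕ → ℕ), (∀ u ∈ O.take i, A u = F u) → x = F O[i] →
        ∀ u ∈ O.take (i + 1), Function.update A O[i] x u = F u := by
      intro A x F hA hx u hu
      by_cases hui : u = O[i]
      · subst hui
        rw [Function.update_self, hx]
      · rw [Function.update_of_ne hui]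
        rw [List.take_add_one, List.mem_append, List.getElem?_eq_getElem hil] at hu
        exact hA u (hu.resolve_right (by simpa using hui))
    have a1 := hI' _ _ (fun u => (P.kd u).number) (fun u hu => (hI u hu).1) rfl
    have a2 := hI' _ _ (fun u => P.ch u ((P.kd u).order - 1)) (fun u hu => (hI u hu).2.1) rfl
    constructor
    · intro h1
      rw [StatementKind.number_eq_one] at h1
      refine ⟨⟨hb, fun u hu => ⟨a1 u hu, a2 u hu, hI' _ _ P.snk (fun u hu => (hI u hu).2.2)
        (hP.valid.snk_trivial _ h1).symm u hu⟩⟩, by omega⟩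
    · intro h1
      rw [StatementKind.number_eq_one] at h1
      refine ⟨⟨hb, fun u hu => ⟨a1 u hu, a2 u hu, hI' _ _ P.snk (fun u hu => (hI u hu).2.2)
        ?_ u hu⟩⟩, by omega⟩
      rw [hP.valid.snk_ch _ h1]
      exact (hI _ (hO.child_mem_take hP hil (Parse.Valid.child_last h1))).2.2
  · rintro s1 t hs1 ⟨hle, hI⟩ hb ht
    have e3 := hs1.reg rN (by decide)
    simp only [State.setReg_reg, Nat.reduceEqDiff, ↓reduceIte, hG.num] at e3
    simp only [Test.Holds, e3] at hb
    rw [show s1.reg rI = n by omega, ← hlen, List.take_length] at hI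
    refine ⟨⟨fun v hv => (hI v ((hO.mem v).2 hv)).1,
      fun v hv => (hI v ((hO.mem v).2 hv)).2.1⟩, ?_⟩
    simp at ht
    omega

end RAM

/-! ### Codes, ranks and the lexicographic order -/

/-- All kinds get one shape: `order - 2` sorted alternatives, then the last child. With at most one
alternative the sorting is vacuous, so the order fixed for if-then, while and repeat is respected.
-/
theorem StatementKind.code_eq {k : StatementKind} (hk : k ≠ .trivial) (c : ℕ → List ℕ) :
    (k.code fun i => c i) = k.number ::
      (lexConcat ((List.range' 1 (k.order - 2)).map c) ++ c (k.order - 1)) := by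
  cases k with
  | trivial => exact absurd rfl hk
  | pCase p hp =>
    simp only [code, number, order, Nat.add_sub_cancel, List.cons.injEq, true_and]
    congr 2
    refine List.ext_getElem (by simp) fun i h1 h2 => ?_
    simp [add_comm]
  | _ => simp [code, number, order, lexConcat, List.range']

/-- Sorted rearrangements of one list of strings coincide, so any sorting method yields the same
concatenation, even when distinct children have equal codes. -/
theorem lexConcat_eq {α : Type*} {l l' : List α} {code : α → List ℕ} (h : l.Perm l')
    (hs : l'.Pairwise fun a b => code a ≤ code b) :
    lexConcat (l.map code) = l'.flatMap code := by
  unfold lexConcat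
  rw [List.flatMap_def]
  congr 1
  refine List.Perm.eq_of_pairwise' (r := (· ≤ ·)) (List.pairwise_insertionSort _ _) ?_
    ((List.perm_insertionSort _ _).trans (h.map code))
  rwa [List.pairwise_map]

theorem Parse.Valid.perm_alternatives {P : Parse ℕ} (hP : P.Valid) {v : ℕ}
    (hk : P.kd v ≠ .trivial) {l : List ℕ} (hl : l.Nodup)
    (hmem : ∀ c, c ∈ l ↔ P.Child v c ∧ c ≠ P.ch v ((P.kd v).order - 1)) :
    ((List.range' 1 ((P.kd v).order - 2)).map (P.ch v)).Perm l := by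
  have h2 := StatementKind.two_le_order hk
  refine (List.perm_ext_iff_of_nodup ?_ hl).2 fun c => ?_
  · refine List.Nodup.map_on (fun i hi j hj he => ?_) (List.nodup_range' ..)
    rw [List.mem_range'_1] at hi hj
    exact hP.ch_injective (by omega) (by omega) he
  · rw [hmem, List.mem_map]
    constructor
    · rintro ⟨i, hi, rfl⟩
      rw [List.mem_range'_1] at hi
      refine ⟨⟨i, by omega, by omega, rfl⟩, fun he => ?_⟩
      have := hP.ch_injective (by omega) (by omega) he
      omega
    · rintro ⟨⟨i, h0, hi, rfl⟩, hne⟩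
      refine ⟨i, ?_, rfl⟩
      rw [List.mem_range'_1]
      have : i ≠ (P.kd v).order - 1 := by
        rintro rfl
        exact hne rfl
      omega

/-- The code of a vertex, from a list of its children in which the last one is followed by the
others in non-increasing order of codes. -/
theorem Parse.IsCode.eq_of_sorted {P : Parse ℕ} (hP : P.Valid) {code : ℕ → List ℕ}
    (hc : P.IsCode code) {v : ℕ} (hk : P.kd v ≠ .trivial) {l : List ℕ} (hl : l.Nodup)
    (hmem : ∀ c, c ∈ l ↔ P.Child v c ∧ c ≠ P.ch v ((P.kd v).order - 1))
    (hs : l.Pairwise fun a b => code b ≤ code a) :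
    code v = 1 :: (P.kd v).number ::
      (P.ch v ((P.kd v).order - 1) :: l).reverse.flatMap code := by
  rw [hc v, StatementKind.code_eq hk fun i => code (P.ch v i)]
  rw [show (fun i => code (P.ch v i)) = code ∘ P.ch v from rfl, ← List.map_map,
    lexConcat_eq ((hP.perm_alternatives hk hl hmem).trans (List.reverse_perm l).symm)
      (by rwa [List.pairwise_reverse])]
  simp

/-- A strong form of the lexicographic order: `c` is below `c'`, however they are continued, if
the continuation of `c` starts with `1`. -/
def Below (c c' : List ℕ) : Prop :=
  ∃ A r y r', c = A ++ r ∧ c' = A ++ y :: r' ∧ r.headD 1 < y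

/-- The plain order would not survive continuation, because `[1]` is a proper prefix of other codes.
Here an exhausted left string is continued by a letter `1` or by nothing, and the right string still
wins with `y > 1`. -/
theorem Below.append {c c' : List ℕ} (h : Below c c') {t t' : List ℕ} (ht : t.headD 1 = 1) :
    Below (c ++ t) (c' ++ t') := by
  obtain ⟨A, r, y, r', rfl, rfl, hr⟩ := h
  refine ⟨A, r ++ t, y, r' ++ t', by simp, by simp, ?_⟩
  cases r with
  | nil =>
    rw [List.nil_append, ht]
    exact hr
  | cons => simpa using hr

theorem Below.append_left {c c' : List ℕ} (h : Below c c') (B : List ℕ) :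
    Below (B ++ c) (B ++ c') := by
  obtain ⟨A, r, y, r', rfl, rfl, hr⟩ := h
  exact ⟨B ++ A, r, y, r', by simp, by simp, hr⟩

theorem Below.lt {c c' : List ℕ} (h : Below c c') : c < c' := by
  obtain ⟨A, r, y, r', rfl, rfl, hr⟩ := h
  refine List.append_left_lt ?_
  cases r with
  | nil => exact List.nil_lt_cons _ _
  | cons x r => exact List.cons_lt_cons_iff.2 (.inl (by simpa using hr))

theorem headD_flatMap {α : Type*} {code : α → List ℕ} (h1 : ∀ a, (code a).headD 0 = 1)
    (l : List α) : (l.flatMap code).headD 1 = 1 := by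
  cases l with
  | nil => rfl
  | cons a l =>
    have := h1 a
    rw [List.flatMap_cons]
    rcases h : code a with _ | ⟨x, c⟩
    · rw [h] at this
      simp at this
    · rw [h] at this
      simpa using this

/-- Ranks `f` represent the order of codes: on vertices satisfying `p`. -/
def Ranks (p : ℕ → Prop) (f : ℕ → ℕ) (code : ℕ → List ℕ) : Prop :=
  ∀ a b, p a → p b → (f a < f b → Below (code a) (code b)) ∧ (f a = f b → code a = code b)

/-- At the first difference of the rank sequences the codes are related by `Below`, and what follows
on the left is a concatenation of codes, hence empty or starting with `1`. Before it the codes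
agree. -/
theorem Ranks.flatMap {p : ℕ → Prop} {f : ℕ → ℕ} {code : ℕ → List ℕ} (h : Ranks p f code)
    (h1 : ∀ a, (code a).headD 0 = 1) {l l' : List ℕ} (hl : ∀ a ∈ l, p a) (hl' : ∀ a ∈ l', p a)
    (hlen : l.length = l'.length) :
    (l.map f < l'.map f → Below (l.flatMap code) (l'.flatMap code)) ∧
      (l.map f = l'.map f → l.flatMap code = l'.flatMap code) := by
  induction l generalizing l' with
  | nil =>
    cases l' with
    | nil => simp
    | cons => simp at hlen
  | cons a l ih =>
    cases l' with
    | nil => simp at hlen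
    | cons b l' =>
      obtain ⟨i1, i2⟩ := ih (fun x hx => hl x (List.mem_cons_of_mem _ hx))
        (fun x hx => hl' x (List.mem_cons_of_mem _ hx)) (by simpa using hlen)
      obtain ⟨h3, h4⟩ := h a b (hl a (by simp)) (hl' b (by simp))
      simp only [List.map_cons, List.flatMap_cons, List.cons_lt_cons_iff, List.cons.injEq]
      constructor
      · rintro (hab | ⟨hab, hlt⟩)
        · exact (h3 hab).append (headD_flatMap h1 l)
        · rw [h4 hab]
          exact (i1 hlt).append_left _
      · rintro ⟨hab, he⟩
        rw [h4 hab, i2 he]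

theorem Parse.IsCode.headD {P : Parse ℕ} {code : ℕ → List ℕ} (hc : P.IsCode code) (v : ℕ) :
    (code v).headD 0 = 1 := by
  rw [hc v]
  simp

/-- The code of a leaf or of an inner vertex with children listed in reverse order by `l`. -/
def CodeFrom (P : Parse ℕ) (code : ℕ → List ℕ) (v : ℕ) (l : List ℕ) : Prop :=
  code v = 1 :: ((if (P.kd v).number = 1 then [] else [(P.kd v).number]) ++
    l.reverse.flatMap code)

theorem StatementKind.number_injective : Function.Injective StatementKind.number := by
  intro k k' h
  cases k <;> cases k' <;> simp [number] at h ⊢ <;> omega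

/-- Different kinds are decided by the letter after the initial `1`, a leaf behaving like a kind
`1`. Equal kinds have equally many children, so the sequences of child ranks, read in order of
emission, decide by `Ranks.flatMap`. The lists `C a` run against that order, hence the reversals. -/
theorem Ranks.of_children {P : Parse ℕ} {code : ℕ → List ℕ} {p q : ℕ → Prop} {f g : ℕ → ℕ}
    {C : ℕ → List ℕ} (h1 : ∀ a, (code a).headD 0 = 1) (hf : Ranks p f code)
    (hC : ∀ a, q a → CodeFrom P code a (C a)) (hp : ∀ a, q a → ∀ c ∈ C a, p c)
    (hlen : ∀ a b, q a → q b → P.kd a = P.kd b → (C a).length = (C b).length)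
    (hnil : ∀ a, q a → (P.kd a).number = 1 → C a = [])
    (hg : ∀ a b, q a → q b →
      (g a < g b → (P.kd a).number :: ((C a).map f).reverse < (P.kd b).number ::
        ((C b).map f).reverse) ∧
      (g a = g b → (P.kd a).number :: ((C a).map f).reverse = (P.kd b).number ::
        ((C b).map f).reverse)) :
    Ranks q g code := by
  intro a b ha hb
  obtain ⟨g1, g2⟩ := hg a b ha hb
  have key : (P.kd a).number = (P.kd b).number →
      ((C a).reverse.map f < (C b).reverse.map f →
        Below ((C a).reverse.flatMap code) ((C b).reverse.flatMap code)) ∧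
      ((C a).reverse.map f = (C b).reverse.map f →
        (C a).reverse.flatMap code = (C b).reverse.flatMap code) := fun he =>
    hf.flatMap h1 (fun x hx => hp a ha x (by simpa using hx))
      (fun x hx => hp b hb x (by simpa using hx)) (by
        rw [List.length_reverse, List.length_reverse,
          hlen a b ha hb (StatementKind.number_injective he)])
  rw [hC a ha, hC b hb]
  constructor
  · intro h
    rcases List.cons_lt_cons_iff.1 (g1 h) with h' | ⟨h', h''⟩
    · have hb1 : (P.kd b).number ≠ 1 := by
        have := (P.kd a).number_pos
        omega
      rw [if_neg hb1]
      refine Below.append_left (B := [1]) ?_ 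
      by_cases ha1 : (P.kd a).number = 1
      · rw [if_pos ha1, hnil a ha ha1]
        -- The leaf has no second letter; the default `1` of `headD` takes its place.
        exact ⟨[], [], _, _, rfl, rfl, by simpa [ha1] using h'⟩
      · rw [if_neg ha1]
        exact ⟨[], _, _, _, rfl, rfl, by simpa using h'⟩
    · rw [← List.map_reverse, ← List.map_reverse] at h''
      rw [h']
      exact (((key h').1 h'').append_left _).append_left [1]
  · intro h
    have h' := g2 h
    rw [List.cons.injEq, ← List.map_reverse, ← List.map_reverse] at h'
    rw [h'.1, (key h'.1).2 h'.2]

/-- The rank of `v` by the number of elements of `L` below it. -/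
def rankIn {α : Type*} [LinearOrder α] (L : List ℕ) (f : ℕ → α) (v : ℕ) : ℕ :=
  L.countP fun u => f u < f v

/-- Strictness comes from `u` itself, which is counted for `v` but not for `u`. -/
theorem rankIn_lt_iff {α : Type*} [LinearOrder α] {L : List ℕ} {f : ℕ → α} {u v : ℕ}
    (hu : u ∈ L) (hv : v ∈ L) : rankIn L f u < rankIn L f v ↔ f u < f v := by
  have aux : ∀ u v, u ∈ L → f u < f v → rankIn L f u < rankIn L f v := by
    intro u v hu h
    unfold rankIn
    obtain ⟨l, l', rfl⟩ := List.append_of_mem hu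
    have hm : ∀ l : List ℕ, (l.countP fun w => f w < f u) ≤ l.countP fun w => f w < f v :=
      fun l => List.countP_mono_left fun w _ hw => by
        simp only [decide_eq_true_eq] at hw ⊢
        exact hw.trans h
    simp only [List.countP_append, List.countP_cons]
    have h1 := hm l
    have h2 := hm l'
    simp only [lt_irrefl, decide_false, Bool.false_eq_true, ↓reduceIte, h, decide_true]
    omega
  refine ⟨fun h => ?_, aux u v hu⟩
  by_contra hn
  rcases (not_lt.1 hn).eq_or_lt with he | hl
  · unfold rankIn at h
    rw [he] at h
    exact lt_irrefl _ h
  · exact lt_asymm h (aux v u hv hl)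

theorem rankIn_eq_iff {α : Type*} [LinearOrder α] {L : List ℕ} {f : ℕ → α} {u v : ℕ}
    (hu : u ∈ L) (hv : v ∈ L) : rankIn L f u = rankIn L f v ↔ f u = f v := by
  have h1 := rankIn_lt_iff (f := f) hu hv
  have h2 := rankIn_lt_iff (f := f) hv hu
  constructor
  · intro h
    exact le_antisymm (not_lt.1 fun h' => by have := h2.2 h'; omega)
      (not_lt.1 fun h' => by have := h1.2 h'; omega)
  · intro h
    rw [h] at h1 h2
    simp only [lt_irrefl, iff_false, not_lt] at h1 h2
    omega

theorem rankIn_lt_length {α : Type*} [LinearOrder α] {L : List ℕ} {f : ℕ → α} {v : ℕ}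
    (hv : v ∈ L) : rankIn L f v < L.length := by
  unfold rankIn
  refine lt_of_le_of_ne List.countP_le_length fun h => ?_
  have := List.countP_eq_length.1 h v hv
  simp at this

-- Bucket lists and loops over them

notation "rC" => (19 : ℕ)
notation "rJ" => (20 : ℕ)
notation "rM" => (21 : ℕ)
notation "rTop" => (22 : ℕ)
notation "rBase" => (23 : ℕ)
notation "rKey" => (24 : ℕ)
notation "rSt" => (25 : ℕ)
notation "rE" => (26 : ℕ)

notation "aCls" => (29 : ℕ)
notation "aStamp" => (31 : ℕ)
notation "aPtr" => (32 : ℕ)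
notation "aLr" => (33 : ℕ)
notation "aLc" => (34 : ℕ)

namespace RAM

open Program Instr Test

/-- A family of disjoint linked lists with common links. -/
structure Buckets (head nxt : ℕ → ℕ) (B : ℕ → List ℕ) : Prop where
  linked : ∀ i, Linked nxt (head i) (B i)
  nodup : ∀ i, (B i).Nodup
  disj : ∀ i j v, v ∈ B i → v ∈ B j → i = j

namespace Buckets

variable {head nxt : ℕ → ℕ} {B : ℕ → List ℕ}

theorem empty (nxt : ℕ → ℕ) : Buckets (fun _ => 0) nxt (fun _ => []) :=
  ⟨fun _ => rfl, fun _ => List.nodup_nil, fun _ _ _ h => absurd h (by simp)⟩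

theorem push (h : Buckets head nxt B) {v : ℕ} (hv : ∀ j, v ∉ B j) (i : ℕ) :
    Buckets (Function.update head i (v + 1)) (Function.update nxt v (head i))
      (Function.update B i (v :: B i)) := by
  constructor
  · intro j
    by_cases hj : j = i
    · subst hj
      simpa using (h.linked j).push (hv j)
    · simpa [hj] using (h.linked j).update (hv j)
  · intro j
    by_cases hj : j = i
    · subst hj
      simpa using ⟨hv j, h.nodup j⟩
    · simpa [hj] using h.nodup j
  · have aux : ∀ j w, w ∈ Function.update B i (v :: B i) j → (w = v ∧ j = i) ∨ w ∈ B j := by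
      intro j w hw
      by_cases hj : j = i
      · subst hj
        rw [Function.update_self] at hw
        rcases List.mem_cons.1 hw with hw | hw
        · exact .inl ⟨hw, rfl⟩
        · exact .inr hw
      · rw [Function.update_of_ne hj] at hw
        exact .inr hw
    intro j j' w hw hw'
    rcases aux _ _ hw with ⟨h0, h2'⟩ | hw <;> rcases aux _ _ hw' with ⟨h1, h2⟩ | hw'
    · exact h2'.trans h2.symm
    · exact absurd (h0 ▸ hw') (hv _)
    · exact absurd (h1 ▸ hw) (hv _)
    · exact h.disj _ _ _ hw hw'

theorem shrink (h : Buckets head nxt B) {i p : ℕ} {l : List ℕ} (hl : l.Sublist (B i))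
    (hp : Linked nxt p l) :
    Buckets (Function.update head i p) nxt (Function.update B i l) := by
  have aux : ∀ j, (Function.update B i l j).Sublist (B j) := by
    intro j
    by_cases hj : j = i
    · subst hj
      simpa using hl
    · simp [hj]
  constructor
  · intro j
    by_cases hj : j = i
    · subst hj
      simpa using hp
    · simpa [hj] using h.linked j
  · exact fun j => (h.nodup j).sublist (aux j)
  · exact fun j j' v hv hv' => h.disj j j' v ((aux j).subset hv) ((aux j').subset hv')

theorem pop (h : Buckets head nxt B) {i v : ℕ} {l : List ℕ} (hi : B i = v :: l) :
    Buckets (Function.update head i (nxt v)) nxt (Function.update B i l) := by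
  have := h.linked i
  rw [hi] at this
  exact h.shrink (by rw [hi]; exact List.sublist_cons_self _ _) this.2

theorem clear (h : Buckets head nxt B) (i : ℕ) :
    Buckets (Function.update head i 0) nxt (Function.update B i []) :=
  h.shrink (List.nil_sublist _) rfl

end Buckets

/-- Push the vertex in register `v` on the list whose number is in register `k`. -/
def pushProg (H N k v : ℕ) : Program := block [
  instr (load rX H k),
  instr (store N v rX),
  instr (copy rX v),
  instr (inc rX),
  instr (store H k rX)]

theorem runs_pushProg {H N k v : ℕ} {s : State} (hHN : H ≠ N) (hk : k ≠ rX) (hv : v ≠ rX) :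
    Runs (pushProg H N k v) s fun s' t =>
      s'.mem H = Function.update (s.mem H) (s.reg k) (s.reg v + 1) ∧
      s'.mem N = Function.update (s.mem N) (s.reg v) (s.mem H (s.reg k)) ∧ t ≤ 6 := by
  unfold pushProg
  simp only [runs_block_cons, runs_block_nil, runs_instr, Instr.apply, State.setReg_reg,
    State.setReg_mem, State.setMem_reg, State.setMem_mem, hk, hv, hHN, hHN.symm, ↓reduceIte]
  exact ⟨trivial, trivial, by omega⟩

/-- The rule for loops, with a potential that is a parameter of the invariant. -/
theorem runs_loop_of_inv {b : Test} {P : Program} {s₀ : State} {Q : State → ℕ → Prop} {m₀ : ℕ}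
    (I : State → ℕ → Prop) (h0 : I s₀ m₀)
    (step : ∀ s m, Same (loop b P) s₀ s → I s m → b.Holds s →
      Runs P s fun s' t => ∃ m', I s' m' ∧ t + 1 + m' ≤ m)
    (done : ∀ s t m, Same (loop b P) s₀ s → I s m → ¬ b.Holds s → t + m ≤ m₀ + 1 → Q s t) :
    Runs (.loop b P) s₀ Q := by
  have key : ∀ m s, Same (loop b P) s₀ s → I s m →
      ∃ s' t m', Run (.loop b P) s s' t ∧ Same (loop b P) s₀ s' ∧ I s' m' ∧ ¬ b.Holds s' ∧
        t + m' ≤ m + 1 := by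
    intro m
    induction m using Nat.strong_induction_on with
    | _ m ih =>
      intro s hsame hI
      by_cases hb : b.Holds s
      · obtain ⟨s', t, h1, m', h2, h3⟩ := step s m hsame hI hb
        obtain ⟨s'', t', m'', h4, h5, h6, h7, h8⟩ :=
          ih m' (by omega) s' (hsame.trans ⟨h1.same.reg, h1.same.mem⟩) h2
        exact ⟨s'', t + t' + 1, m'', .loop_true hb h1 h4, h5, h6, h7, by omega⟩
      · exact ⟨s, 1, m, .loop_false hb, hsame, hI, hb, by omega⟩
  obtain ⟨s', t, m', h1, h2, h3, h4, h5⟩ := key _ s₀ (.refl _ _) h0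
  exact ⟨s', t, h1, done s' t m' h2 h3 h4 h5⟩

/-- Run `body` for every vertex of the linked list with head `p`, the vertex being in `c`. -/
def walkProg (p c N : ℕ) (body : Program) : Program :=
  loop (lt rZ p) (block [instr (copy c p), instr (dec c), body, instr (load p N c)])

/-- `J D` describes the state once the vertices in `D` have been treated; it must not depend on the
two registers of the walk. The body may not write the array `N`, so the link loaded after it is
still that of the original list. -/
theorem runs_walkProg {p c N K : ℕ} {body : Program} {s : State} {l : List ℕ}
    (J : List ℕ → State → Prop)
    (hr : ∀ r ∈ [rZ, p, c], r ∉ body.regs) (ha : N ∉ body.arrs) (hpc : [rZ, p, c].Nodup)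
    (hz : s.reg rZ = 0) (hl : Linked (s.mem N) (s.reg p) l)
    (hJ : ∀ D s1 s2, (∀ r, r ≠ p → r ≠ c → s2.reg r = s1.reg r) → s2.mem = s1.mem →
      J D s1 → J D s2)
    (h0 : J [] s)
    (step : ∀ D v l' s1, l = D ++ v :: l' → Same (walkProg p c N body) s s1 → J D s1 →
      s1.reg c = v → Runs body s1 fun s2 t => J (D ++ [v]) s2 ∧ t ≤ K) :
    Runs (walkProg p c N body) s fun s' t => J l s' ∧ t ≤ (K + 5) * l.length + 1 := by
  have hN : N ∉ (walkProg p c N body).arrs := by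
    simpa [walkProg, block, arrs] using ha
  simp only [List.mem_cons, List.not_mem_nil, or_false, forall_eq_or_imp, forall_eq] at hr
  simp only [List.nodup_cons, List.mem_cons, List.not_mem_nil, or_false, not_or,
    not_false_eq_true, List.nodup_nil, and_true] at hpc
  obtain ⟨⟨hzp, hzc⟩, hpc⟩ := hpc
  have hz' : rZ ∉ (walkProg p c N body).regs := by
    simp [walkProg, block, regs, hr, hzp, hzc]
  refine runs_loop_of_inv (m₀ := (K + 5) * l.length)
    -- The overhead `5` per vertex is three instructions, the end of the block and the test.
    (fun s' m => ∃ D l', l = D ++ l' ∧ Linked (s.mem N) (s'.reg p) l' ∧ J D s' ∧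
      m = (K + 5) * l'.length) ⟨[], l, rfl, hl, h0, rfl⟩ ?_ ?_
  · rintro s1 m hs1 ⟨D, l', rfl, hl', hJD, rfl⟩ hb
    rw [← walkProg] at hs1
    have e0 : s1.reg rZ = 0 := (hs1.reg _ hz').trans hz
    simp only [Test.Holds, e0] at hb
    obtain ⟨v, l', rfl, hp, hl''⟩ := hl'.exists_cons hb
    simp only [runs_block_cons, runs_block_nil, runs_instr, Instr.apply]
    refine (step D v l' _ rfl (hs1.trans ⟨fun r hr' => ?_, fun A hA => ?_⟩)
      (hJ D s1 _ (fun r h1 h2 => ?_) ?_ hJD) ?_).mono ?_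
    · have : r ≠ c := by
        rintro rfl
        simp [walkProg, block, regs] at hr'
      simp [this]
    · rfl
    · simp [h2]
    · rfl
    · simp [hp]
    · rintro s2 t2 hs2 ⟨hJ2, ht2⟩
      have hc := hs2.reg c hr.2.2
      have hm := hs2.mem N ha
      simp only [State.setReg_reg, ↓reduceIte, State.setReg_mem, hp, Nat.add_sub_cancel,
        hs1.mem N hN] at hc hm
      refine ⟨_, ⟨D ++ [v], l', by simp, ?_, hJ _ s2 _ (fun r h1 h2 => by simp [h1]) rfl hJ2,
        rfl⟩, ?_⟩
      · simpa [hc, hm] using hl''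
      · simp only [List.length_cons, Nat.mul_add]
        omega
  · rintro s1 t m hs1 ⟨D, l', rfl, hl', hJD, rfl⟩ hb ht
    rw [← walkProg] at hs1
    have e0 : s1.reg rZ = 0 := (hs1.reg _ hz').trans hz
    simp only [Test.Holds, e0, not_lt, Nat.le_zero] at hb
    rw [hb] at hl'
    obtain rfl := hl'.eq_nil
    rw [List.append_nil] at ht ⊢
    exact ⟨hJD, by omega⟩

/-- The concatenation of the lists with numbers `lo + k, …, lo + 1`. -/
def drainList (B : ℕ → List ℕ) (lo : ℕ) : ℕ → List ℕ
  | 0 => []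
  | k + 1 => B (lo + k + 1) ++ drainList B lo k

theorem mem_drainList {B : ℕ → List ℕ} {lo k v : ℕ} :
    v ∈ drainList B lo k ↔ ∃ i, lo < i ∧ i ≤ lo + k ∧ v ∈ B i := by
  induction k with
  | zero => 
    simp only [drainList, List.not_mem_nil, false_iff, not_exists]
    omega
  | succ k ih =>
    rw [drainList, List.mem_append, ih]
    constructor
    · rintro (h | ⟨i, h1, h2, h3⟩)
      · exact ⟨_, by omega, by omega, h⟩
      · exact ⟨i, h1, by omega, h3⟩
    · rintro ⟨i, h1, h2, h3⟩
      rcases Nat.lt_or_ge (lo + k) i with h | h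
      · obtain rfl : i = lo + k + 1 := by omega
        exact .inl h3
      · exact .inr ⟨i, h1, h, h3⟩

theorem drainList_congr {B B' : ℕ → List ℕ} {lo k : ℕ}
    (h : ∀ i, lo < i → i ≤ lo + k → B i = B' i) : drainList B lo k = drainList B' lo k := by
  induction k with
  | zero => rfl
  | succ k ih =>
    rw [drainList, drainList, h _ (by omega) (by omega), ih fun i h1 h2 => h i h1 (by omega)]

theorem Buckets.nodup_drainList {head nxt : ℕ → ℕ} {B : ℕ → List ℕ} (h : Buckets head nxt B)
    (lo k : ℕ) : (drainList B lo k).Nodup := by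
  induction k with
  | zero => exact List.nodup_nil
  | succ k ih =>
    rw [drainList, List.nodup_append]
    refine ⟨h.nodup _, ih, fun a ha b hb => ?_⟩
    rintro rfl
    obtain ⟨i, h1, h2, h3⟩ := mem_drainList.1 hb
    have := h.disj _ _ _ ha h3
    omega

theorem pairwise_drainList {B : ℕ → List ℕ} {f : ℕ → ℕ} {lo k : ℕ}
    (h : ∀ i, ∀ v ∈ B i, f v = i) : (drainList B lo k).Pairwise fun a b => f b ≤ f a := by
  induction k with
  | zero => exact List.Pairwise.nil
  | succ k ih =>
    rw [drainList, List.pairwise_append]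
    refine ⟨List.pairwise_of_forall_mem_list fun a ha b hb => by rw [h _ a ha, h _ b hb], ih,
      fun a ha b hb => ?_⟩
    · obtain ⟨i, h1, h2, h3⟩ := mem_drainList.1 hb
      rw [h _ a ha, h _ b h3]
      omega

/-- Empty the lists with numbers `i, i - 1, …` down to `lo + 1`, running `body` for every vertex
met, the vertex being in `c`. -/
def drainProg (p c i lo H N : ℕ) (body : Program) : Program :=
  loop (lt lo i) (block [
    instr (load p H i),
    ite (lt rZ p) (block [
      instr (copy c p),
      instr (dec c),
      instr (load p N c),
      instr (store H i p),
      body]) (instr (dec i))])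

/-- Every round either pops one vertex or passes to the next lower number, which gives a cost linear
in the vertices plus the width `k` of the range. `J` must ignore the heads, since popping changes
them. -/
theorem runs_drainProg {p c i lo H N K k : ℕ} {body : Program} {s : State} {B : ℕ → List ℕ}
    (J : List ℕ → State → Prop)
    (hr : ∀ r ∈ [rZ, i, lo], r ∉ body.regs) (ha : ∀ A ∈ [H, N], A ∉ body.arrs)
    (hpc : [rZ, p, c, i, lo].Nodup) (hHN : H ≠ N)
    (hz : s.reg rZ = 0) (hi : s.reg i = s.reg lo + k) (hB : Buckets (s.mem H) (s.mem N) B)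
    (hJ : ∀ D s1 s2, (∀ r, r ≠ p → r ≠ c → r ≠ i → s2.reg r = s1.reg r) →
      (∀ A, A ≠ H → s2.mem A = s1.mem A) → J D s1 → J D s2)
    (h0 : J [] s)
    (step : ∀ D v l' s1, drainList B (s.reg lo) k = D ++ v :: l' →
      Same (drainProg p c i lo H N body) s s1 → J D s1 →
      s1.reg c = v → Runs body s1 fun s2 t => J (D ++ [v]) s2 ∧ t ≤ K) :
    Runs (drainProg p c i lo H N body) s fun s' t => J (drainList B (s.reg lo) k) s' ∧
      Buckets (s'.mem H) (s'.mem N)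
        (fun j => if s.reg lo < j ∧ j ≤ s.reg lo + k then [] else B j) ∧
      t ≤ (K + 9) * (drainList B (s.reg lo) k).length + 5 * k + 1 := by
  simp only [List.mem_cons, List.not_mem_nil, or_false, forall_eq_or_imp, forall_eq] at hr ha
  simp only [List.nodup_cons, List.mem_cons, List.not_mem_nil, or_false, not_or,
    not_false_eq_true, List.nodup_nil, and_true] at hpc
  obtain ⟨⟨hzp, hzc, hzi, hzl⟩, ⟨hp_c, hp_i, hp_lo⟩, ⟨hc_i, hc_lo⟩, hi_lo⟩ := hpc
  have hz' : rZ ∉ (drainProg p c i lo H N body).regs := by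
    simp [drainProg, block, regs, hr, hzp, hzc, hzi]
  have hlo' : lo ∉ (drainProg p c i lo H N body).regs := by
    simp [drainProg, block, regs, hr, Ne.symm hp_lo, Ne.symm hc_lo, Ne.symm hi_lo]
  refine runs_loop_of_inv (m₀ := (K + 9) * (drainList B (s.reg lo) k).length + 5 * k)
    -- Lists in the range above the current number are empty, those below it are untouched, and the
    -- current one may be partly popped. At `m = 0` the current number is `lo`, which is never
    -- popped, hence the separate clause.
    (fun s' M => ∃ D B' m, s'.reg i = s.reg lo + m ∧ m ≤ k ∧ Buckets (s'.mem H) (s'.mem N) B' ∧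
      (∀ j, ¬ (s.reg lo + m < j ∧ j ≤ s.reg lo + k) → j ≠ s.reg lo + m → B' j = B j) ∧
      (∀ j, s.reg lo + m < j → j ≤ s.reg lo + k → B' j = []) ∧
      (m = 0 → B' (s.reg lo) = B (s.reg lo)) ∧
      drainList B (s.reg lo) k = D ++ drainList B' (s.reg lo) m ∧ J D s' ∧
      M = (K + 9) * (drainList B' (s.reg lo) m).length + 5 * m) ?_ ?_ ?_
  · exact ⟨[], B, k, hi, le_rfl, hB, fun _ _ _ => rfl, fun j h1 h2 => by omega, fun _ => rfl,
      rfl, h0, rfl⟩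
  · rintro s1 _ hs1 ⟨D, B', m, him, hmk, hB', hB1, hB2, hB3, hS, hJD, rfl⟩ hb
    rw [← drainProg] at hs1
    have e0 : s1.reg rZ = 0 := (hs1.reg _ hz').trans hz
    have el : s1.reg lo = s.reg lo := hs1.reg _ hlo'
    simp only [Test.Holds, el, him] at hb
    obtain ⟨m, rfl⟩ : ∃ m', m = m' + 1 := ⟨m - 1, by omega⟩
    have hlm := hB'.linked (s.reg lo + (m + 1))
    simp only [runs_block_cons, runs_block_nil, runs_instr, runs_ite, Instr.apply]
    simp only [State.setReg_reg, State.setReg_mem, him, e0, Test.Holds, ↓reduceIte,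
      Ne.symm hp_i, Ne.symm hc_i, hzp]
    refine ⟨fun hpos => ?_, fun hnp => ?_⟩
    · obtain ⟨v, l, hv, hhead, hl'⟩ := hlm.exists_cons hpos
      have hdl : drainList B' (s.reg lo) (m + 1) = v ::
          drainList (Function.update B' (s.reg lo + (m + 1)) l) (s.reg lo) (m + 1) := by
        rw [drainList, drainList, ← add_assoc, Function.update_self, add_assoc, hv,
          List.cons_append, drainList_congr (B := B')]
        intro j h1 h2
        rw [Function.update_of_ne (by omega)]
      refine (step D v _ _ (hdl ▸ hS) (hs1.trans ⟨fun r hr' => ?_, fun A hA => ?_⟩)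
        (hJ D s1 _ (fun r h1 h2 h3 => ?_) (fun A hA => ?_) hJD) ?_).mono ?_
      · have h1 : r ≠ c := by
          rintro rfl
          simp [drainProg, block, regs] at hr'
        have h2 : r ≠ p := by
          rintro rfl
          simp [drainProg, block, regs] at hr'
        simp [h1, h2]
      · have h1 : A ≠ H := by
          rintro rfl
          simp [drainProg, block, arrs] at hA
        simp [h1]
      · simp [h1, h2]
      · simp [hA]
      · simp [Ne.symm hp_c, hhead]
      · rintro s2 t2 hs2 ⟨hJ2, ht2⟩
        have hm1 := hs2.mem H ha.1
        have hm2 := hs2.mem N ha.2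
        have hi2 := hs2.reg i hr.2.1
        simp only [State.setReg_reg, State.setReg_mem, State.setMem_reg, State.setMem_mem,
          ↓reduceIte, hHN.symm, Ne.symm hc_i, Ne.symm hp_i, him, hhead,
          Nat.add_sub_cancel] at hm1 hm2 hi2
        have hB2' := hB'.pop hv
        rw [← hm1, ← hm2] at hB2'
        refine ⟨_, ⟨D ++ [v], _, m + 1, hi2, hmk, hB2', ?_, ?_, by omega, ?_, hJ2, rfl⟩, ?_⟩
        · intro j h1 h2
          rw [Function.update_of_ne h2]
          exact hB1 j h1 h2
        · intro j h1 h2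
          rw [Function.update_of_ne (by omega)]
          exact hB2 j h1 h2
        · rw [hS, hdl]
          simp
        · rw [hdl]
          simp only [List.length_cons, Nat.mul_add]
          omega
    · have hnil : B' (s.reg lo + (m + 1)) = [] := by
        rw [show s1.mem H (s.reg lo + (m + 1)) = 0 by omega] at hlm
        exact hlm.eq_nil
      have hdl : drainList B' (s.reg lo) (m + 1) = drainList B' (s.reg lo) m := by
        rw [drainList, add_assoc, hnil, List.nil_append]
      refine ⟨_, ⟨D, B', m, by omega, by omega, hB', ?_, ?_, ?_,
        by rw [hS, hdl], hJ D s1 _ (fun r h1 h2 h3 => by simp [h1, h3]) (fun A hA => rfl)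
        hJD, rfl⟩, ?_⟩
      · intro j h1 h2
        exact hB1 j (by omega) (by omega)
      · intro j h1 h2
        by_cases hj : j = s.reg lo + (m + 1)
        · rw [hj, hnil]
        · exact hB2 j (by omega) h2
      · intro h
        exact hB1 _ (by omega) (by omega)
      · rw [hdl]
        omega
  · rintro s1 t _ hs1 ⟨D, B', m, him, hmk, hB', hB1, hB2, hB3, hS, hJD, rfl⟩ hb ht
    rw [← drainProg] at hs1
    have el : s1.reg lo = s.reg lo := hs1.reg _ hlo'
    simp only [Test.Holds, el, him] at hb
    obtain rfl : m = 0 := by omega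
    rw [drainList, List.append_nil] at hS
    refine ⟨hS ▸ hJD, ?_, by omega⟩
    convert hB' using 1
    funext j
    split_ifs with hj
    · exact (hB2 j (by omega) hj.2).symm
    · by_cases hj' : j = s.reg lo
      · rw [hj', hB3 rfl]
      · exact (hB1 j (by omega) (by omega)).symm

end RAM

/-! ### Partition refinement -/

namespace RAM

open Program Instr Test

/-- One step of the refinement of a partition: the vertex `rV` of the class `rK` is put into a
subclass according to its key `rKey`; the keys arrive in non-decreasing order, and `rSt`
identifies the pass. The subclasses of the class `k` are numbered `k, k + 1, …`, skipping as many
numbers as there are vertices. -/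
def refineProg : Program := block [
  instr (load rX aStamp rK),
  ite (eq rX rSt) (block [
    instr (load rX aLr rK),
    ite (eq rX rKey) (block [instr (load rX aLc rK), instr (store aCls rV rX)]) (block [
      instr (load rX aPtr rK),
      instr (store aLc rK rX),
      instr (store aLr rK rKey),
      instr (store aCls rV rX)])])
    (block [
      instr (store aStamp rK rSt),
      instr (store aPtr rK rK),
      instr (store aLr rK rKey),
      instr (store aLc rK rK),
      instr (store aCls rV rK)]),
  instr (load rX aPtr rK),
  instr (inc rX),
  instr (store aPtr rK rX)]

/-- The state after a refinement pass has dealt with the vertices in `D`. -/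
structure Refining (k₀ key : ℕ → ℕ) (J : ℕ) (D : List ℕ) (s : State) : Prop where
  cls : ∀ v ∈ D, s.mem aCls v = k₀ v + D.countP fun u => k₀ u = k₀ v ∧ key u < key v
  stamp : ∀ k, s.mem aStamp k = J ↔ ∃ u ∈ D, k₀ u = k
  ptr : ∀ k, (∃ u ∈ D, k₀ u = k) → s.mem aPtr k = k + D.countP fun u => k₀ u = k
  lr : ∀ k, (∃ u ∈ D, k₀ u = k) → (∃ u ∈ D, k₀ u = k ∧ s.mem aLr k = key u) ∧
    ∀ u ∈ D, k₀ u = k → key u ≤ s.mem aLr k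
  lc : ∀ k, (∃ u ∈ D, k₀ u = k) →
    s.mem aLc k = k + D.countP fun u => k₀ u = k ∧ key u < s.mem aLr k

theorem Refining.congr {k₀ key : ℕ → ℕ} {J : ℕ} {D : List ℕ} {s s' : State}
    (h : Refining k₀ key J D s)
    (hm : ∀ A ∈ [aCls, aStamp, aPtr, aLr, aLc], s'.mem A = s.mem A) :
    Refining k₀ key J D s' := by
  simp only [List.mem_cons, List.not_mem_nil, or_false, forall_eq_or_imp, forall_eq] at hm
  obtain ⟨h1, h2, h3, h4, h5⟩ := hm
  constructor
  · rw [h1]; exact h.cls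
  · rw [h2]; exact h.stamp
  · rw [h3]; exact h.ptr
  · rw [h4]; exact h.lr
  · rw [h4, h5]; exact h.lc

theorem Refining.nil {k₀ key : ℕ → ℕ} {J : ℕ} {s : State} (h : ∀ k, s.mem aStamp k ≠ J) :
    Refining k₀ key J [] s where
  cls := by simp
  stamp := by simp [h]
  ptr := by simp
  lr := by simp
  lc := by simp

/-- Keys arrive in non-decreasing order, so the arrival of `v` adds no smaller key for earlier
vertices and their class numbers remain correct. -/
theorem Refining.step {k₀ key : ℕ → ℕ} {J : ℕ} {D : List ℕ} {s s' : State} {v c : ℕ}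
    (h : Refining k₀ key J D s) (hv : v ∉ D) (hkey : ∀ u ∈ D, key u ≤ key v)
    (hc : c = k₀ v + D.countP fun u => k₀ u = k₀ v ∧ key u < key v)
    (cls : s'.mem aCls = Function.update (s.mem aCls) v c)
    (stamp : s'.mem aStamp = Function.update (s.mem aStamp) (k₀ v) J)
    (ptr : s'.mem aPtr = Function.update (s.mem aPtr) (k₀ v)
      (k₀ v + D.countP (fun u => k₀ u = k₀ v) + 1))
    (lr : s'.mem aLr = Function.update (s.mem aLr) (k₀ v) (key v))
    (lc : s'.mem aLc = Function.update (s.mem aLc) (k₀ v) c) :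
    Refining k₀ key J (D ++ [v]) s' := by
  have hmem : ∀ k, k ≠ k₀ v → ((∃ u ∈ D ++ [v], k₀ u = k) ↔ ∃ u ∈ D, k₀ u = k) := by
    intro k hk
    simp only [List.mem_append, List.mem_singleton]
    constructor
    · rintro ⟨u, hu | rfl, rfl⟩
      · exact ⟨u, hu, rfl⟩
      · exact absurd rfl hk
    · rintro ⟨u, hu, rfl⟩
      exact ⟨u, .inl hu, rfl⟩
  constructor
  · intro u hu
    rw [cls, List.countP_append]
    by_cases huv : u = v
    · subst huv
      simp [hc]
    · rw [Function.update_of_ne huv]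
      have hu' : u ∈ D := by simpa [huv] using hu
      have := hkey u hu'
      rw [h.cls u hu']
      simp
      omega
  · intro k
    rw [stamp]
    by_cases hk : k = k₀ v
    · subst hk
      simp
    · rw [hmem k hk, Function.update_of_ne hk]
      exact h.stamp k
  · intro k hk'
    rw [ptr, List.countP_append]
    by_cases hk : k = k₀ v
    · subst hk
      simp [add_assoc]
    · rw [Function.update_of_ne hk, h.ptr k ((hmem k hk).1 hk')]
      simp [Ne.symm hk]
  · intro k hk'
    rw [lr]
    by_cases hk : k = k₀ v
    · subst hk
      refine ⟨⟨v, by simp, rfl, by simp⟩, fun u hu _ => ?_⟩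
      rw [Function.update_self]
      rcases List.mem_append.1 hu with hu | hu
      · exact hkey u hu
      · rw [List.mem_singleton.1 hu]
    · rw [Function.update_of_ne hk]
      obtain ⟨⟨u, h1, h2, h3⟩, h4⟩ := h.lr k ((hmem k hk).1 hk')
      refine ⟨⟨u, by simp [h1], h2, h3⟩, fun w hw hwk => ?_⟩
      rcases List.mem_append.1 hw with hw | hw
      · exact h4 w hw hwk
      · rw [List.mem_singleton.1 hw] at hwk
        exact absurd hwk.symm hk
  · intro k hk'
    rw [lc, lr, List.countP_append]
    by_cases hk : k = k₀ v
    · subst hk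
      simp [hc]
    · rw [Function.update_of_ne hk, Function.update_of_ne hk, h.lc k ((hmem k hk).1 hk')]
      simp [Ne.symm hk]

/-- The stamp says whether the class of `v` has been met in this pass. If so and the key repeats,
the latest subclass is reused; if the key is new, a subclass opens at the pointer; an unmet class
starts at its own number. Stamps avoid any reinitialization between passes. -/
theorem runs_refineProg {k₀ key : ℕ → ℕ} {J : ℕ} {D : List ℕ} {s : State} {v : ℕ}
    (h : Refining k₀ key J D s) (hv : v ∉ D) (hkey : ∀ u ∈ D, key u ≤ key v)
    (rv : s.reg rV = v) (rk : s.reg rK = k₀ v) (rkey : s.reg rKey = key v)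
    (rst : s.reg rSt = J) :
    Runs refineProg s fun s' t => Refining k₀ key J (D ++ [v]) s' ∧
      (∀ u, u ≠ v → s'.mem aCls u = s.mem aCls u) ∧
      (∀ k, s'.mem aStamp k = J ∨ s'.mem aStamp k = s.mem aStamp k) ∧
      t ≤ 15 := by
  unfold refineProg
  simp only [runs_block_cons, runs_block_nil, runs_instr, runs_ite, Instr.apply]
  simp only [State.setReg_reg, State.setReg_mem, State.setMem_reg, State.setMem_mem, Test.Holds,
    ↓reduceIte, Nat.reduceEqDiff, rv, rk, rkey, rst]
  have upd : ∀ (f : ℕ → ℕ) x y, f x = y → f = Function.update f x y := by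
    rintro f x _ rfl
    simp
  refine ⟨fun hst => ?_, fun hst => ?_⟩
  · have hex := (h.stamp _).1 hst
    have hptr := h.ptr _ hex
    obtain ⟨⟨w, w1, w2, w3⟩, hle⟩ := h.lr _ hex
    have hlc := h.lc _ hex
    refine ⟨fun hlr => ?_, fun hlr => ?_⟩
    · rw [hlr] at hlc
      refine ⟨h.step hv hkey rfl ?_ ?_ ?_ ?_ ?_, fun u hu => by simp [hu], by simp, by omega⟩
      · simp [hlc]
      · simpa using upd _ _ _ hst
      · simp [hptr]
      · simpa using upd _ _ _ hlr
      · simpa using upd _ _ _ hlc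
    -- A new key exceeds all keys met in this class, so counting all members met is the same as
    -- counting those with smaller key.
    · have hc : s.mem aPtr (k₀ v) =
          k₀ v + D.countP fun u => k₀ u = k₀ v ∧ key u < key v := by
        rw [hptr]
        congr 1
        refine List.countP_congr fun u hu => ?_
        simp only [decide_eq_true_eq]
        refine ⟨fun he => ⟨he, ?_⟩, fun he => he.1⟩
        have h1 := hle u hu he
        have h2 := hkey w w1
        omega
      refine ⟨h.step hv hkey hc ?_ ?_ ?_ ?_ ?_, fun u hu => by simp [hu], by simp, by omega⟩
      · simp
      · simpa using upd _ _ _ hst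
      · simp [hptr]
      · simp
      · simp
  · have hno : ∀ u ∈ D, k₀ u ≠ k₀ v := fun u hu he => hst ((h.stamp _).2 ⟨u, hu, he⟩)
    have h1 : (D.countP fun u => k₀ u = k₀ v ∧ key u < key v) = 0 := by
      rw [List.countP_eq_zero]
      intro u hu
      simp [hno u hu]
    have h2 : (D.countP fun u => k₀ u = k₀ v) = 0 := by
      rw [List.countP_eq_zero]
      intro u hu
      simp [hno u hu]
    refine ⟨h.step hv hkey (c := k₀ v) (by rw [h1]; rfl) ?_ ?_ ?_ ?_ ?_, fun u hu => by simp [hu],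
      fun k => ?_, by omega⟩
    · simp
    · simp
    · simp [h2]
    · simp
    · simp
    · by_cases hk : k = k₀ v
      · simp [hk]
      · simp [hk]

end RAM

-- Parents, depths and levels of the parse tree

notation "aPar" => (16 : ℕ)
notation "aDep" => (17 : ℕ)
notation "aLast" => (18 : ℕ)
notation "aHk" => (19 : ℕ)
notation "aNk" => (20 : ℕ)
notation "aHl" => (21 : ℕ)
notation "aNl" => (22 : ℕ)

/-- The elements of `D` sorted into lists by `f`, the latest first. -/
def bucketsOf (f : ℕ → ℕ) (D : List ℕ) (i : ℕ) : List ℕ := (D.filter fun v => f v = i).reverse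

theorem mem_bucketsOf {f : ℕ → ℕ} {D : List ℕ} {i v : ℕ} :
    v ∈ bucketsOf f D i ↔ v ∈ D ∧ f v = i := by
  simp [bucketsOf]

theorem bucketsOf_nil (f : ℕ → ℕ) : bucketsOf f [] = fun _ => [] := rfl

theorem bucketsOf_append (f : ℕ → ℕ) (D : List ℕ) (v : ℕ) :
    bucketsOf f (D ++ [v]) = Function.update (bucketsOf f D) (f v) (v :: bucketsOf f D (f v)) := by
  funext i
  by_cases h : i = f v
  · subst h
    simp [bucketsOf]
  · rw [Function.update_of_ne h]
    simp [bucketsOf, Ne.symm h]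

theorem RAM.Buckets.push_bucketsOf {head nxt : ℕ → ℕ} {f : ℕ → ℕ} {D : List ℕ}
    (h : RAM.Buckets head nxt (bucketsOf f D)) {v i : ℕ} (hv : v ∉ D) (hi : f v = i) :
    RAM.Buckets (Function.update head i (v + 1)) (Function.update nxt v (head i))
      (bucketsOf f (D ++ [v])) := by
  subst hi
  rw [bucketsOf_append]
  exact h.push (fun j hj => hv (mem_bucketsOf.1 hj).1) _

/-- A child not adjacent to `v` is reached through the first child, and an edge leaving the first
child ends at the source or at the last child. So the adjacency list and the last child give all
children. -/
theorem Parse.OnRange.child_iff {P : Parse ℕ} {n : ℕ} {adj : ℕ → List ℕ} (h : P.OnRange n adj)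
    {v c : ℕ} (hk : P.kd v ≠ .trivial) :
    P.Child v c ↔ c = P.ch v ((P.kd v).order - 1) ∨ c ∈ adj v := by
  rw [h.mem_adj v (h.lt_of_kd v hk), h.valid.arc_of_kd_ne hk]
  constructor
  · rintro ⟨j, h0, hj, rfl⟩
    rcases StatementKind.exists_edge_to h0 hj with he | ⟨-, he⟩
    · exact .inr ⟨j, he, rfl⟩
    · rcases he.eq_or_eq one_pos with rfl | rfl
      · omega
      · exact .inl rfl
  · rintro (rfl | ⟨j, he, rfl⟩)
    · exact Parse.Valid.child_last hk
    · exact ⟨j, by have := he.ne; omega, he.lt_right, rfl⟩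

theorem Parse.Child.ne_trivial {P : Parse ℕ} {v c : ℕ} (h : P.Child v c) :
    P.kd v ≠ .trivial := by
  obtain ⟨j, h0, hj, -⟩ := h
  exact StatementKind.ne_trivial_of_lt_order h0 hj

/-- Bounds the range of buckets when sorting by kind: `order - 1` counts distinct vertices, and the
number exceeds the order by at most two. -/
theorem Parse.OnRange.number_le {P : Parse ℕ} {n : ℕ} {adj : ℕ → List ℕ} (h : P.OnRange n adj)
    {v : ℕ} (hv : v < n) : (P.kd v).number ≤ n + 3 := by
  have h1 : (P.kd v).order - 1 ≤ n :=
    (Finset.single_le_sum (f := fun v => (P.kd v).order - 1) (fun _ _ => Nat.zero_le _)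
      (Finset.mem_range.2 hv)).trans h.sum_order_le
  have h2 : (P.kd v).number ≤ (P.kd v).order + 2 := by
    cases P.kd v <;> simp [StatementKind.number, StatementKind.order]
  omega

namespace RAM

open Program Instr Test

/-- Set the parents and depths of the `rK` vertices listed from `rP` on. -/
def markProg : Program := loop (lt rZ rK) (block [
  instr (load rY 0 rP),
  instr (store aPar rY rV),
  instr (store aDep rY rD),
  instr (inc rP),
  instr (dec rK)])

theorem runs_markProg {s : State} {l : List ℕ} (h0 : s.reg rZ = 0)
    (hl : Reads (s.mem 0) (s.reg rP) l) (hlen : s.reg rK = l.length) :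
    Runs markProg s fun s' t =>
      (∀ w, s'.mem aPar w = if w ∈ l then s.reg rV else s.mem aPar w) ∧
      (∀ w, s'.mem aDep w = if w ∈ l then s.reg rD else s.mem aDep w) ∧
      t ≤ 7 * l.length + 1 := by
  refine runs_loop_of_inv (m₀ := 7 * l.length)
    (fun s' m => ∃ D l', l = D ++ l' ∧ Reads (s.mem 0) (s'.reg rP) l' ∧ s'.reg rK = l'.length ∧
      (∀ w, s'.mem aPar w = if w ∈ D then s.reg rV else s.mem aPar w) ∧
      (∀ w, s'.mem aDep w = if w ∈ D then s.reg rD else s.mem aDep w) ∧ m = 7 * l'.length)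
    ⟨[], l, rfl, hl, hlen, by simp, by simp, rfl⟩ ?_ ?_
  · rintro s1 _ hs1 ⟨D, l', rfl, hl', hlen', hp, hd, rfl⟩ hb
    have e0 := (hs1.reg rZ (by decide)).trans h0
    have eV := hs1.reg rV (by decide)
    have eD := hs1.reg rD (by decide)
    have m0 := hs1.mem 0 (by decide)
    simp only [Test.Holds, e0, hlen'] at hb
    obtain ⟨v, l', rfl⟩ := List.exists_cons_of_length_pos hb
    simp only [runs_block_cons, runs_block_nil, runs_instr, Instr.apply]
    simp only [State.setReg_reg, State.setReg_mem, State.setMem_reg, State.setMem_mem,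
      ↓reduceIte, Nat.reduceEqDiff, eV, eD, m0, hl'.1]
    refine ⟨_, ⟨D ++ [v], l', by simp, hl'.2, by simp [hlen'], fun w => ?_, fun w => ?_, rfl⟩, ?_⟩
    · by_cases hw : w = v <;> simp [hw, hp]
    · by_cases hw : w = v <;> simp [hw, hd]
    · simp only [List.length_cons]
      omega
  · rintro s1 t _ hs1 ⟨D, l', rfl, hl', hlen', hp, hd, rfl⟩ hb ht
    have e0 := (hs1.reg rZ (by decide)).trans h0
    simp only [Test.Holds, e0, hlen', not_lt, Nat.le_zero, List.length_eq_zero_iff] at hb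
    subst hb
    rw [List.append_nil] at *
    exact ⟨hp, hd, by simp at ht; omega⟩

/-- Parents, depths, and the marks of the last children, from the root down. -/
def treeProg : Program := block [
  instr (copy rI rN),
  loop (lt rZ rI) (block [
    instr (dec rI),
    instr (load rV aOrd rI),
    instr (load rX aKind rV),
    ite (eq rX rOne) skip (block [
      instr (load rD aDep rV),
      instr (inc rD),
      instr (load rY aTl rV),
      instr (store aPar rY rV),
      instr (store aDep rY rD),
      instr (store aLast rY rOne),
      instr (load rP aStart rV),
      instr (load rK aDeg rV),
      markProg])])]

/-- Parents, depths and marks are right for the children of the vertices in `D`. -/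
structure TreeInv (P : Parse ℕ) (D : List ℕ) (s : State) : Prop where
  par : ∀ v ∈ D, ∀ c, P.Child v c → s.mem aPar c = v
  dep : ∀ v ∈ D, ∀ c, P.Child v c → s.mem aDep c = s.mem aDep v + 1
  dep_root : s.mem aDep P.root = 0
  last : ∀ c, s.mem aLast c = 1 ↔
    ∃ v ∈ D, P.kd v ≠ .trivial ∧ c = P.ch v ((P.kd v).order - 1)

theorem TreeInv.step {P : Parse ℕ} {D : List ℕ} {s s' : State} (hP : P.Valid)
    (h : TreeInv P D s) {v : ℕ} (hD : ∀ u ∈ D, ¬ P.Child v u) (hv : v ∉ D)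
    (hk : P.kd v ≠ .trivial) (par : ∀ c, P.Child v c → s'.mem aPar c = v)
    (par' : ∀ c, ¬ P.Child v c → s'.mem aPar c = s.mem aPar c)
    (dep : ∀ c, P.Child v c → s'.mem aDep c = s.mem aDep v + 1)
    (dep' : ∀ c, ¬ P.Child v c → s'.mem aDep c = s.mem aDep c)
    (last : s'.mem aLast = Function.update (s.mem aLast) (P.ch v ((P.kd v).order - 1)) 1) :
    TreeInv P (v :: D) s' := by
  have hvv : ¬ P.Child v v := fun hc => absurd (hP.num_lt_of_child hc) (lt_irrefl _)
  have hne : ∀ u ∈ D, ∀ c, P.Child u c → ¬ P.Child v c := fun u hu c h1 h2 => by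
    rw [hP.child_unique h2 h1] at hv
    exact hv hu
  constructor
  · intro u hu c hc
    rcases List.mem_cons.1 hu with rfl | hu
    · exact par c hc
    · rw [par' c (hne u hu c hc)]
      exact h.par u hu c hc
  · intro u hu c hc
    rcases List.mem_cons.1 hu with rfl | hu
    · rw [dep c hc, dep' u hvv]
    · rw [dep' c (hne u hu c hc), dep' u (hD u hu)]
      exact h.dep u hu c hc
  · rw [dep' _ fun hc => ?_, h.dep_root]
    obtain ⟨i, h0, h1, h2⟩ := hc
    exact hP.ch_ne_root v i h0 h1 h2
  · intro c
    rw [last]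
    by_cases hc : c = P.ch v ((P.kd v).order - 1)
    · subst hc
      simpa using .inl hk
    · rw [Function.update_of_ne hc, h.last c]
      simp [hc]

/-- Read backwards, the finishing order puts parents before children, so the depth of a vertex is
final when it is passed on. Besides a constant per vertex, only adjacency lists are scanned. -/
theorem runs_treeProg {P : Parse ℕ} {n : ℕ} {O : List ℕ} {adj : ℕ → List ℕ} {s : State}
    (hP : P.OnRange n adj) (hG : HasGraph n P.root adj s) (hO : HasOrder P n O s)
    (hT : HasParse P n s) (hm : ∀ A, A ∈ [aPar, aDep, aLast] → s.mem A = fun _ => 0) :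
    Runs treeProg s fun s' t => TreeInv P O s' ∧ t ≤ 7 * degSum n adj 0 + 30 * n + 5 := by
  have hlen : O.length = n := length_eq_of_mem_iff_lt hO.nodup hO.mem
  have hdeg : degSum n adj 0 = (O.map fun v => (adj v).length).sum := by
    rw [degSum, ← List.sum_toFinset _ hO.nodup]
    congr 1
    ext v
    simp [hO.mem]
  unfold treeProg
  simp only [runs_block_cons, runs_block_nil, runs_instr, Instr.apply]
  refine runs_loop_of_inv
    (m₀ := 7 * ((O.take n).map fun v => (adj v).length).sum + 30 * n)
    (fun s' m => s'.reg rI ≤ n ∧ TreeInv P (O.drop (s'.reg rI)) s' ∧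
      m = 7 * ((O.take (s'.reg rI)).map fun v => (adj v).length).sum + 30 * s'.reg rI) ?_ ?_ ?_
  · refine ⟨by simp [hG.num], ?_, by simp [hG.num]⟩
    rw [List.drop_eq_nil_of_le (by simp [hG.num, hlen])]
    constructor <;> simp [hm aPar, hm aDep, hm aLast]
  · rintro s1 _ hs1 ⟨hle, hI, rfl⟩ hb
    have e0 := hs1.reg rZ (by decide)
    have e1 := hs1.reg rOne (by decide)
    have m0 := hs1.mem 0 (by decide)
    have m2 := hs1.mem aDeg (by decide)
    have m4 := hs1.mem aStart (by decide)
    have m10 := hs1.mem aOrd (by decide)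
    have m13 := hs1.mem aKind (by decide)
    have m14 := hs1.mem aTl (by decide)
    simp only [State.setReg_reg, State.setReg_mem, Nat.reduceEqDiff, ↓reduceIte, hG.zero,
      hG.one] at e0 e1 m0 m2 m4 m10 m13 m14
    simp only [Test.Holds, e0] at hb
    obtain ⟨i, hi⟩ : ∃ i, s1.reg rI = i + 1 := ⟨s1.reg rI - 1, by omega⟩
    rw [hi] at hle hI ⊢
    have hil : i < O.length := by omega
    have hv := (hO.mem _).1 (List.getElem_mem hil)
    have hload : s1.mem aOrd i = O[i] := by
      have := reads_getElem hO.ord hil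
      rwa [zero_add, ← m10] at this
    have hdrop : O.drop i = O[i] :: O.drop (i + 1) := (List.cons_getElem_drop_succ).symm
    have hsum : ((O.take (i + 1)).map fun v => (adj v).length).sum =
        ((O.take i).map fun v => (adj v).length).sum + (adj O[i]).length := by
      rw [List.take_succ_eq_append_getElem hil, List.map_append, List.sum_append]
      simp
    have hnd := hO.nodup
    rw [← List.take_append_drop i O, hdrop, List.nodup_append] at hnd
    obtain ⟨-, hnd1, hnd2⟩ := hnd
    have hvD : O[i] ∉ O.drop (i + 1) := (List.nodup_cons.1 hnd1).1
    have hcD : ∀ u ∈ O.drop (i + 1), ¬ P.Child O[i] u := fun u hu hc =>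
      hnd2 u (hO.child_mem_take hP hil hc) u (List.mem_cons_of_mem _ hu) rfl
    simp only [runs_block_cons, runs_block_nil, runs_instr, runs_ite, runs_skip, Instr.apply]
    simp only [State.setReg_reg, State.setReg_mem, Test.Holds, ↓reduceIte, Nat.reduceEqDiff,
      hi, hload, m13, Nat.add_sub_cancel, hT.kind _ hv, e1, StatementKind.number_eq_one]
    refine ⟨fun hk => ⟨_, ⟨by omega, ?_, rfl⟩, by omega⟩, fun hk => ?_⟩
    · rw [hdrop]
      constructor
      · intro v hv' c hc
        rcases List.mem_cons.1 hv' with rfl | hv'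
        · exact absurd hk hc.ne_trivial
        · exact hI.par v hv' c hc
      · intro v hv' c hc
        rcases List.mem_cons.1 hv' with rfl | hv'
        · exact absurd hk hc.ne_trivial
        · exact hI.dep v hv' c hc
      · exact hI.dep_root
      · intro c
        rw [State.setReg_mem, State.setReg_mem, State.setReg_mem, hI.last c]
        simp only [List.mem_cons, exists_eq_or_imp, hk, ne_eq, not_true_eq_false, false_and,
          false_or]
    · refine (runs_markProg (l := adj O[i]) ?_ ?_ ?_).mono ?_
      · simp [e0]
      · simp [m0, m4, hG.start _ hv]
      · simp [m2, hG.deg _ hv]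
      · rintro s2 t2 hs2 ⟨hp2, hd2, ht2⟩
        have f14 := hs2.reg rI (by decide)
        have k18 := hs2.mem aLast (by decide)
        simp only [State.setReg_reg, State.setReg_mem, State.setMem_reg, State.setMem_mem,
          ↓reduceIte, Nat.reduceEqDiff, m14, hT.last _ hv, e1] at f14 k18 hp2 hd2
        refine ⟨_, ⟨by omega, ?_, rfl⟩, by rw [f14, hsum]; omega⟩
        rw [f14, hdrop]
        refine hI.step hP.valid hcD hvD hk ?_ ?_ ?_ ?_ k18
        · intro c hc
          rw [hP.child_iff hk] at hc
          rw [hp2]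
          by_cases hca : c ∈ adj O[i]
          · simp [hca]
          · simp [hc.resolve_right hca]
        · intro c hc
          rw [hP.child_iff hk, not_or] at hc
          rw [hp2]
          simp [hc.1, hc.2]
        · intro c hc
          rw [hP.child_iff hk] at hc
          rw [hd2]
          by_cases hca : c ∈ adj O[i]
          · simp [hca]
          · simp [hc.resolve_right hca]
        · intro c hc
          rw [hP.child_iff hk, not_or] at hc
          rw [hd2]
          simp [hc.1, hc.2]
  · rintro s1 t _ hs1 ⟨hle, hI, rfl⟩ hb ht
    have e0 := hs1.reg rZ (by decide)
    simp only [State.setReg_reg, Nat.reduceEqDiff, ↓reduceIte, hG.zero] at e0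
    simp only [Test.Holds, e0, not_lt, Nat.le_zero] at hb
    rw [hb, List.drop_zero] at hI
    rw [hb, ← hlen, List.take_length, ← hdeg] at ht
    exact ⟨hI, by simp at ht; omega⟩

/-- The arrays describing the tree of the parse, with the vertices of every depth sorted by
kind. -/
structure HasTree (P : Parse ℕ) (n : ℕ) (L : ℕ → List ℕ) (dep : ℕ → ℕ) (s : State) : Prop where
  par : ∀ v c, P.Child v c → s.mem aPar c = v
  last : ∀ v c, P.Child v c → (s.mem aLast c = 1 ↔ c = P.ch v ((P.kd v).order - 1))
  kind : ∀ v, v < n → s.mem aKind v = (P.kd v).number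
  level : ∀ d, Linked (s.mem aNl) (s.mem aHl d) (L d)
  dep_child : ∀ v c, P.Child v c → dep c = dep v + 1
  dep_lt : ∀ v, v < n → dep v < n
  dep_root : dep P.root = 0
  mem_level : ∀ d v, v ∈ L d ↔ v < n ∧ dep v = d
  nodup_level : ∀ d, (L d).Nodup
  sorted : ∀ d, (L d).Pairwise fun a b => (P.kd a).number ≤ (P.kd b).number

/-- The vertices of every depth, sorted by kind. -/
def levelProg : Program := block [
  instr (const rV 0),
  loop (lt rV rN) (block [
    instr (load rK aKind rV),
    pushProg aHk aNk rK rV,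
    instr (inc rV)]),
  instr (const rBase 0),
  instr (copy rI rN),
  instr (inc rI),
  instr (inc rI),
  instr (inc rI),
  drainProg rP rC rI rBase aHk aNk (block [
    instr (load rK aDep rC),
    pushProg aHl aNl rK rC])]

/-- Depth plus position in the finishing order stays below `n`: from parent to child the depth grows
by one and the position drops by at least one. -/
theorem TreeInv.dep_lt {P : Parse ℕ} {n : ℕ} {O : List ℕ} {adj : ℕ → List ℕ} {s s' : State}
    (hP : P.OnRange n adj) (hO : HasOrder P n O s) (h : TreeInv P O s') {v : ℕ} (hv : v < n) :
    s'.mem aDep v < n := by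
  have hlen : O.length = n := length_eq_of_mem_iff_lt hO.nodup hO.mem
  have key : ∀ m i (hi : i < O.length), n - i ≤ m → s'.mem aDep O[i] + i < n := by
    intro m
    induction m with
    | zero => intro i hi h1; omega
    | succ m ih =>
      intro i hi h1
      rcases hP.full _ ((hO.mem _).1 (List.getElem_mem hi)) with hr | ⟨w, hw⟩
      · rw [hr, h.dep_root]
        omega
      · have hwn : w < n := hP.lt_of_kd w hw.ne_trivial
        obtain ⟨j, hj, rfl⟩ := List.getElem_of_mem ((hO.mem _).2 hwn)
        rw [h.dep _ (List.getElem_mem hj) _ hw]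
        obtain ⟨k, hk, he⟩ := List.mem_take_iff_getElem.1 (hO.child_mem_take hP hj hw)
        obtain rfl : k = i := (List.Nodup.getElem_inj_iff hO.nodup).1 he
        have := ih j hj (by omega)
        omega
  obtain ⟨i, hi, rfl⟩ := List.getElem_of_mem ((hO.mem _).2 hv)
  have := key n i hi (by omega)
  omega

/-- A radix sort, first by kind and then by depth. The buckets of kinds are drained from the largest
kind, and pushing reverses the order, so each level ends up sorted by increasing kind. The `n + 3`
buckets suffice by `number_le`. -/
theorem runs_levelProg {P : Parse ℕ} {n : ℕ} {O : List ℕ} {adj : ℕ → List ℕ} {s : State}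
    (hP : P.OnRange n adj) (hz : s.reg rZ = 0) (hn : s.reg rN = n) (hO : HasOrder P n O s)
    (hT : HasParse P n s) (h : TreeInv P O s)
    (hm : ∀ A, A ∈ [aHk, aNk, aHl, aNl] → s.mem A = fun _ => 0) :
    Runs levelProg s fun s' t => (∃ L dep, HasTree P n L dep s') ∧ t ≤ 60 * n + 40 := by
  unfold levelProg
  simp only [runs_block_cons, runs_block_nil, runs_instr, Instr.apply]
  refine runs_loop_of_inv (m₀ := 11 * n)
    (fun s' m => s'.reg rV ≤ n ∧ m = 11 * (n - s'.reg rV) ∧ Buckets (s'.mem aHk) (s'.mem aNk)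
      (bucketsOf (fun v => (P.kd v).number) (List.range (s'.reg rV)))) ?_ ?_ ?_
  · refine ⟨by simp, by simp, ?_⟩
    simpa [hm aHk, hm aNk, bucketsOf_nil] using Buckets.empty _
  · rintro s1 _ hs1 ⟨hle, rfl, hB⟩ hb
    have e3 := hs1.reg rN (by decide)
    have m13 := hs1.mem aKind (by decide)
    simp only [State.setReg_reg, State.setReg_mem, Nat.reduceEqDiff, ↓reduceIte, hn] at e3 m13
    simp only [Test.Holds, e3] at hb
    simp only [runs_block_cons, runs_block_nil, runs_instr, Instr.apply]
    refine (runs_pushProg (by decide) (by decide) (by decide)).mono ?_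
    rintro s2 t2 hs2 ⟨h1, h2, ht2⟩
    have f5 := hs2.reg rV (by decide)
    simp only [State.setReg_reg, State.setReg_mem, ↓reduceIte, Nat.reduceEqDiff, m13,
      hT.kind _ hb] at f5 h1 h2
    refine ⟨_, ⟨by simp [f5]; omega, rfl, ?_⟩, by simp [f5]; omega⟩
    simp only [State.setReg_reg, State.setReg_mem, ↓reduceIte, f5, h1, h2, List.range_succ]
    exact hB.push_bucketsOf (by simp) rfl
  · rintro s1 t1 _ hs1 ⟨hle, rfl, hB⟩ hb ht1
    have e0 := hs1.reg rZ (by decide)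
    have e3 := hs1.reg rN (by decide)
    have m13 := hs1.mem aKind (by decide)
    have m16 := hs1.mem aPar (by decide)
    have m17 := hs1.mem aDep (by decide)
    have m18 := hs1.mem aLast (by decide)
    have m21 := hs1.mem aHl (by decide)
    have m22 := hs1.mem aNl (by decide)
    simp only [State.setReg_reg, State.setReg_mem, Nat.reduceEqDiff, ↓reduceIte, hn, hz, hm aHl,
      hm aNl, List.mem_cons, true_or, or_true] at e0 e3 m13 m16 m17 m18 m21 m22
    simp only [Test.Holds, e3] at hb
    rw [show s1.reg rV = n by omega] at hB
    have hmem : ∀ v, v ∈ drainList (bucketsOf (fun v => (P.kd v).number) (List.range n)) 0 (n + 3)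
        ↔ v < n := by
      intro v
      simp only [mem_drainList, mem_bucketsOf, List.mem_range]
      constructor
      · rintro ⟨i, -, -, h, -⟩
        exact h
      · intro hv
        exact ⟨_, (P.kd v).number_pos, by have := hP.number_le hv; omega, hv, rfl⟩
    refine (runs_drainProg (k := n + 3) (K := 8)
      (B := bucketsOf (fun v => (P.kd v).number) (List.range n))
      (fun D s' => Buckets (s'.mem aHl) (s'.mem aNl) (bucketsOf (s.mem aDep) D))
      (by decide) (by decide) (by decide) (by decide) ?_ ?_ ?_ ?_ ?_ ?_).mono ?_
    · simp [e0]
    · simp [e3]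
    · simpa using hB
    · intro D s2 s3 _ h2 h3
      rwa [h2 _ (by decide), h2 _ (by decide)]
    · simpa [m21, m22, bucketsOf_nil] using Buckets.empty _
    · intro D v l' s2 hS hs2 hJ hv
      have g17 := hs2.mem aDep (by decide)
      simp only [State.setReg_mem, m17] at g17
      simp only [runs_block_cons, runs_block_nil, runs_instr, Instr.apply]
      refine (runs_pushProg (by decide) (by decide) (by decide)).mono ?_
      rintro s3 t3 hs3 ⟨h1, h2, ht3⟩
      simp only [State.setReg_reg, State.setReg_mem, ↓reduceIte, Nat.reduceEqDiff, g17,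
        hv] at h1 h2
      refine ⟨?_, by omega⟩
      rw [h1, h2]
      refine hJ.push_bucketsOf (fun hvD => ?_) rfl
      have := hB.nodup_drainList 0 (n + 3)
      simp only [State.setReg_reg, ↓reduceIte, Nat.reduceEqDiff] at hS
      rw [hS, List.nodup_append] at this
      exact this.2.2 v hvD v (by simp) rfl
    · rintro s2 t2 hs2 ⟨hJ, -, ht2⟩
      have g13 := hs2.mem aKind (by decide)
      have g16 := hs2.mem aPar (by decide)
      have g18 := hs2.mem aLast (by decide)
      simp only [State.setReg_mem, State.setReg_reg, ↓reduceIte, Nat.reduceEqDiff, m13, m16,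
        m18] at g13 g16 g18 ht2 hJ
      generalize hSe : drainList (bucketsOf (fun v => (P.kd v).number) (List.range n)) 0 (n + 3) = S
        at *
      have hnd : S.Nodup := hSe ▸ hB.nodup_drainList 0 (n + 3)
      have hslen : S.length = n := length_eq_of_mem_iff_lt hnd hmem
      refine ⟨⟨bucketsOf (s.mem aDep) S, s.mem aDep, ?_⟩, by rw [hslen] at ht2; omega⟩
      constructor
      · rw [g16]
        exact fun v c hc => h.par v ((hO.mem v).2 (hP.lt_of_kd v hc.ne_trivial)) c hc
      · rw [g18]
        intro v c hc
        rw [h.last]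
        constructor
        · rintro ⟨w, -, hk, rfl⟩
          obtain rfl := hP.valid.child_unique (Parse.Valid.child_last hk) hc
          rfl
        · exact fun he => ⟨v, (hO.mem v).2 (hP.lt_of_kd v hc.ne_trivial), hc.ne_trivial, he⟩
      · rw [g13]
        exact hT.kind
      · exact hJ.linked
      · exact fun v c hc => h.dep v ((hO.mem v).2 (hP.lt_of_kd v hc.ne_trivial)) c hc
      · exact fun v hv => h.dep_lt hP hO hv
      · exact h.dep_root
      · intro d v
        rw [mem_bucketsOf, hmem]
      · exact hJ.nodup
      · intro d
        unfold bucketsOf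
        rw [List.pairwise_reverse]
        refine List.Pairwise.filter _ ?_
        rw [← hSe]
        exact pairwise_drainList (f := fun v => (P.kd v).number) fun i v hv => (mem_bucketsOf.1 hv).2

end RAM

/-! ### Places of siblings and key sequences -/

/-- The place of `c` among its siblings in reverse order of emission: the last child comes first,
the others follow in the order of the list `S`. -/
def place (par last : ℕ → ℕ) (S : List ℕ) (c : ℕ) : ℕ :=
  if last c = 1 then 1 else (S.filter fun x => par x = par c ∧ last x ≠ 1).idxOf c + 2

/-- `S` lists the children of the vertices in `M`, in non-increasing order of their classes. -/
structure Siblings (P : Parse ℕ) (par last cls : ℕ → ℕ) (M S : List ℕ) : Prop where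
  nodup : S.Nodup
  child : ∀ c ∈ S, P.Child (par c) c
  par_mem : ∀ c ∈ S, par c ∈ M
  last_iff : ∀ c ∈ S, last c = 1 ↔ c = P.ch (par c) ((P.kd (par c)).order - 1)
  mem : ∀ v ∈ M, ∀ c, P.Child v c → c ∈ S
  sorted : S.Pairwise fun a b => cls b ≤ cls a

namespace Siblings

variable {P : Parse ℕ} {par last cls : ℕ → ℕ} {M S : List ℕ}

theorem par_eq_iff (h : Siblings P par last cls M S) (hP : P.Valid) {v c : ℕ} (hc : c ∈ S) :
    par c = v ↔ P.Child v c :=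
  ⟨fun e => e ▸ h.child c hc, fun e => hP.child_unique (h.child c hc) e⟩

theorem mem_alternatives (h : Siblings P par last cls M S) (hP : P.Valid) {v c : ℕ}
    (hv : v ∈ M) : (c ∈ S.filter fun x => par x = v ∧ last x ≠ 1) ↔
      P.Child v c ∧ c ≠ P.ch v ((P.kd v).order - 1) := by
  simp only [List.mem_filter, decide_eq_true_eq]
  constructor
  · rintro ⟨hc, rfl, h2⟩
    exact ⟨h.child c hc, fun e => h2 ((h.last_iff c hc).2 e)⟩
  · rintro ⟨h1, h2⟩
    have hc := h.mem v hv c h1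
    obtain rfl := (h.par_eq_iff hP hc).2 h1
    exact ⟨hc, rfl, fun e => h2 ((h.last_iff c hc).1 e)⟩

theorem length_alternatives (h : Siblings P par last cls M S) (hP : P.Valid) {v : ℕ}
    (hv : v ∈ M) (hk : P.kd v ≠ .trivial) :
    (S.filter fun x => par x = v ∧ last x ≠ 1).length = (P.kd v).order - 2 := by
  rw [← (hP.perm_alternatives hk (h.nodup.filter _) fun c => h.mem_alternatives hP hv).length_eq]
  simp

/-- Place `1` belongs to the last child and the `order - 2` alternatives fill the places from `2` on
without gaps. So the places in use depend on the kind only, and vertices of equal kind take part in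
the same passes. -/
theorem exists_place_iff (h : Siblings P par last cls M S) (hP : P.Valid) {v j : ℕ} (hv : v ∈ M) :
    (∃ c ∈ S, par c = v ∧ place par last S c = j) ↔ 0 < j ∧ j < (P.kd v).order := by
  constructor
  · rintro ⟨c, hc, rfl, rfl⟩
    have hk := (h.child c hc).ne_trivial
    have h2 := StatementKind.two_le_order hk
    unfold place
    split_ifs with hl
    · omega
    · have := List.idxOf_lt_length_of_mem
        (show c ∈ S.filter fun x => par x = par c ∧ last x ≠ 1 by simp [hc, hl])
      rw [h.length_alternatives hP hv hk] at this
      omega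
  · rintro ⟨h0, hj⟩
    have hk := StatementKind.ne_trivial_of_lt_order h0 hj
    have h2 := StatementKind.two_le_order hk
    by_cases h1 : j = 1
    · have hch : P.Child v _ := Parse.Valid.child_last hk
      have hc := h.mem v hv _ hch
      have hp := (h.par_eq_iff hP hc).2 hch
      refine ⟨_, hc, hp, ?_⟩
      rw [place, if_pos ((h.last_iff _ hc).2 (by rw [hp])), h1]
    · have hlen := h.length_alternatives hP hv hk
      have hlt : j - 2 < (S.filter fun x => par x = v ∧ last x ≠ 1).length := by omega
      have hm := List.getElem_mem hlt
      set c := (S.filter fun x => par x = v ∧ last x ≠ 1)[j - 2] with hcdef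
      have hm' := hm
      simp only [List.mem_filter, decide_eq_true_eq] at hm'
      refine ⟨c, hm'.1, hm'.2.1, ?_⟩
      rw [place, if_neg hm'.2.2, hm'.2.1, hcdef, (h.nodup.filter _).idxOf_getElem]
      omega

theorem place_inj (h : Siblings P par last cls M S) {c c' : ℕ} (hc : c ∈ S)
    (hc' : c' ∈ S) (hp : par c = par c') (he : place par last S c = place par last S c') :
    c = c' := by
  unfold place at he
  split_ifs at he with h1 h2 h2
  · rw [(h.last_iff c hc).1 h1, (h.last_iff c' hc').1 h2, hp]
  · omega
  · omega
  · rw [hp, Nat.add_right_cancel_iff] at he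
    exact (List.idxOf_inj (by simp [hc, h1, hp])).1 he

theorem place_eq_one (h : Siblings P par last cls M S) {c : ℕ} (hc : c ∈ S) :
    place par last S c = 1 ↔ c = P.ch (par c) ((P.kd (par c)).order - 1) := by
  rw [← h.last_iff c hc]
  unfold place
  split_ifs with h1 <;> simp [h1]

theorem cls_le (h : Siblings P par last cls M S) {c c' : ℕ} (hc : c ∈ S)
    (hc' : c' ∈ S) (hp : par c = par c') (h1 : place par last S c ≠ 1)
    (hlt : place par last S c < place par last S c') : cls c' ≤ cls c := by
  have hl : last c ≠ 1 := fun e => h1 (by rw [place, if_pos e])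
  have hl' : last c' ≠ 1 := fun e => by
    rw [place, if_neg hl, place, if_pos e] at hlt
    omega
  rw [place, if_neg hl, place, if_neg hl', hp] at hlt
  have m1 : c ∈ S.filter fun x => par x = par c' ∧ last x ≠ 1 := by simp [hc, hl, hp]
  have m2 : c' ∈ S.filter fun x => par x = par c' ∧ last x ≠ 1 := by simp [hc', hl']
  have hpw := List.pairwise_iff_getElem.1 (h.sorted.filter fun x => par x = par c' ∧ last x ≠ 1)
    _ _ (List.idxOf_lt_length_of_mem m1) (List.idxOf_lt_length_of_mem m2) (by omega)
  simpa using hpw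

/-- `T` lists the children with places above `j`, by decreasing place. -/
structure Above (par last : ℕ → ℕ) (S T : List ℕ) (j : ℕ) : Prop where
  nodup : T.Nodup
  mem : ∀ c, c ∈ T ↔ c ∈ S ∧ j < place par last S c
  sorted : T.Pairwise fun a b => place par last S b ≤ place par last S a

/-- Through `place`, the children in question correspond to the numbers above `j` and below the
order, a set determined by the kind. -/
theorem length_filter_eq (h : Siblings P par last cls M S) (hP : P.Valid) {T : List ℕ} {j : ℕ}
    (hT : Above par last S T j) {u v : ℕ} (hu : u ∈ M) (hv : v ∈ M)
    (he : P.kd u = P.kd v) :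
    (T.filter fun c => par c = u).length = (T.filter fun c => par c = v).length := by
  have hnd : ∀ w, ((T.filter fun c => par c = w).map (place par last S)).Nodup := by
    intro w
    refine List.Nodup.map_on (fun a ha b hb hab => ?_) (hT.nodup.filter _)
    simp only [List.mem_filter, decide_eq_true_eq, hT.mem] at ha hb
    exact h.place_inj ha.1.1 hb.1.1 (ha.2.trans hb.2.symm) hab
  have hm : ∀ w ∈ M, ∀ i, i ∈ (T.filter fun c => par c = w).map (place par last S) ↔
      j < i ∧ i < (P.kd w).order := by
    intro w hw i
    simp only [List.mem_map, List.mem_filter, decide_eq_true_eq, hT.mem]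
    constructor
    · rintro ⟨c, ⟨⟨hc, h1⟩, h2⟩, rfl⟩
      exact ⟨h1, ((h.exists_place_iff hP hw).1 ⟨c, hc, h2, rfl⟩).2⟩
    · rintro ⟨h1, h2⟩
      obtain ⟨c, hc, h3, rfl⟩ := (h.exists_place_iff hP hw).2 ⟨by omega, h2⟩
      exact ⟨c, ⟨⟨hc, h1⟩, h3⟩, rfl⟩
  have := ((List.perm_ext_iff_of_nodup (hnd u) (hnd v)).2 fun i => by
    rw [hm u hu, hm v hv, he]).length_eq
  simpa using this

end Siblings

/-- With equal lengths neither list is a proper prefix of the other, so the appended letters matter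
only in a tie. -/
theorem List.append_singleton_lt_iff {x y : List ℕ} {a b : ℕ} (h : x.length = y.length) :
    x ++ [a] < y ++ [b] ↔ x < y ∨ (x = y ∧ a < b) := by
  induction x generalizing y with
  | nil =>
    obtain rfl : y = [] := (List.length_eq_zero_iff.1 h.symm)
    simp [List.cons_lt_cons_iff]
  | cons c x ih =>
    cases y with
    | nil => simp at h
    | cons d y =>
      simp only [List.cons_append, List.cons_lt_cons_iff, ih (by simpa using h), List.cons.injEq]
      tauto

/-- The sequence of keys of the vertex `v` read from the list `T` of children. -/
def keys (kind par cls : ℕ → ℕ) (T : List ℕ) (v : ℕ) : List ℕ :=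
  kind v :: (T.filter fun c => par c = v).map cls

/-- One more key leaves strict inequalities alone and breaks ties. Tied vertices share their kind,
so either all or none of them receive a key from `Q`; the new rank is the old one plus the number of
tied vertices with smaller new key. This is exactly the number computed by a refinement pass. `g`
inverts `par` on `Q`. -/
theorem rankIn_keys_append {kind par cls g : ℕ → ℕ} {M T Q : List ℕ} (hM : M.Nodup)
    (hQ : (Q.map par).Nodup) (hQM : ∀ c ∈ Q, par c ∈ M) (hg : ∀ c ∈ Q, g (par c) = c)
    (hlen : ∀ u ∈ M, ∀ v ∈ M, kind u = kind v →
      (T.filter fun c => par c = u).length = (T.filter fun c => par c = v).length)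
    (hex : ∀ u ∈ M, ∀ v ∈ M, kind u = kind v → u ∈ Q.map par → v ∈ Q.map par) {v : ℕ}
    (hv : v ∈ M) :
    rankIn M (keys kind par cls (T ++ Q)) v = rankIn M (keys kind par cls T) v +
      if v ∈ Q.map par then (Q.map par).countP fun u =>
        rankIn M (keys kind par cls T) u = rankIn M (keys kind par cls T) v ∧
          cls (g u) < cls (g v) else 0 := by
  have hkeys : ∀ u, keys kind par cls (T ++ Q) u = keys kind par cls T u ++
      if u ∈ Q.map par then [cls (g u)] else [] := by
    intro u
    have : Q.filter (fun c => par c = u) = if u ∈ Q.map par then [g u] else [] := by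
      split_ifs with h
      · obtain ⟨c, hc, rfl⟩ := List.mem_map.1 h
        rw [hg c hc]
        refine List.eq_singleton_of_forall_mem (hQ.of_map.filter _) fun w => ?_
        simp only [List.mem_filter, decide_eq_true_eq]
        refine ⟨fun hw => ?_, fun hw => by simp [hw, hc]⟩
        rw [← hg c hc, ← hw.2, hg w hw.1]
      · rw [List.filter_eq_nil_iff]
        intro c hc
        simp only [decide_eq_true_eq]
        rintro rfl
        exact h (List.mem_map_of_mem hc)
    simp only [keys, List.filter_append, List.map_append, this, List.cons_append]
    split_ifs <;> simp
  have hlt : ∀ u ∈ M, keys kind par cls (T ++ Q) u < keys kind par cls (T ++ Q) v ↔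
      keys kind par cls T u < keys kind par cls T v ∨
        (keys kind par cls T u = keys kind par cls T v ∧ u ∈ Q.map par ∧ v ∈ Q.map par ∧
          cls (g u) < cls (g v)) := by
    intro u hu
    rw [hkeys, hkeys]
    by_cases hk : kind u = kind v
    · have hl : (keys kind par cls T u).length = (keys kind par cls T v).length := by
        simpa [keys] using hlen u hu v hv hk
      by_cases huQ : u ∈ Q.map par
      · have hvQ := hex u hu v hv hk huQ
        rw [if_pos huQ, if_pos hvQ, List.append_singleton_lt_iff hl]
        simp only [huQ, hvQ, true_and]
      · have hvQ : v ∉ Q.map par := fun h => huQ (hex v hv u hu hk.symm h)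
        rw [if_neg huQ, if_neg hvQ, List.append_nil, List.append_nil]
        simp only [huQ, false_and, and_false, or_false]
    · simp [keys, List.cons_lt_cons_iff, hk]
  -- The vertices below `v` split disjointly into those below it before and those tied with it
  -- before.
  have h1 : rankIn M (keys kind par cls (T ++ Q)) v = rankIn M (keys kind par cls T) v +
      M.countP fun u => keys kind par cls T u = keys kind par cls T v ∧ u ∈ Q.map par ∧
        v ∈ Q.map par ∧ cls (g u) < cls (g v) := by
    unfold rankIn
    rw [List.countP_eq_length_filter, List.countP_eq_length_filter, List.countP_eq_length_filter,
      ← List.toFinset_card_of_nodup (hM.filter _), ← List.toFinset_card_of_nodup (hM.filter _),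
      ← List.toFinset_card_of_nodup (hM.filter _), ← Finset.card_union_of_disjoint]
    · congr 1
      ext u
      simp only [List.mem_toFinset, List.mem_filter, decide_eq_true_eq, Finset.mem_union]
      constructor
      · rintro ⟨hu, hlt'⟩
        rcases (hlt u hu).1 hlt' with h | h
        · exact .inl ⟨hu, h⟩
        · exact .inr ⟨hu, h⟩
      · rintro (⟨hu, h⟩ | ⟨hu, h⟩)
        · exact ⟨hu, (hlt u hu).2 (.inl h)⟩
        · exact ⟨hu, (hlt u hu).2 (.inr h)⟩
    · rw [Finset.disjoint_left]
      intro u hu hu'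
      simp only [List.mem_toFinset, List.mem_filter, decide_eq_true_eq] at hu hu'
      rw [hu'.2.1] at hu
      exact lt_irrefl _ hu.2
  rw [h1]
  congr 1
  split_ifs with hvQ
  · rw [List.countP_eq_length_filter, List.countP_eq_length_filter,
      ← List.toFinset_card_of_nodup (hM.filter _), ← List.toFinset_card_of_nodup (hQ.filter _)]
    congr 1
    ext u
    simp only [List.mem_toFinset, List.mem_filter, decide_eq_true_eq, hvQ, true_and]
    have : u ∈ Q.map par → u ∈ M := fun h => by
      obtain ⟨c, hc, rfl⟩ := List.mem_map.1 h
      exact hQM c hc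
    constructor
    · rintro ⟨hu, h1, h2, h3⟩
      exact ⟨h2, (rankIn_eq_iff hu hv).2 h1, h3⟩
    · rintro ⟨h2, h1, h3⟩
      exact ⟨this h2, (rankIn_eq_iff (this h2) hv).1 h1, h2, h3⟩
  · rw [List.countP_eq_zero]
    simp [hvQ]

-- Programs for places, classes and refinement passes

notation "aHc" => (23 : ℕ)
notation "aNc" => (24 : ℕ)
notation "aHp" => (25 : ℕ)
notation "aNp" => (26 : ℕ)
notation "aHch" => (27 : ℕ)
notation "aNch" => (28 : ℕ)
notation "aCnt" => (30 : ℕ)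

namespace RAM

open Program Instr Test

/-- Put the vertex `rC` on the list of its place. -/
def placeProg : Program := block [
  instr (load rX aLast rC),
  instr (const rJ 1),
  ite (eq rX rOne) skip (block [
    instr (load rY aPar rC),
    instr (load rJ aCnt rY),
    instr (inc rJ),
    instr (store aCnt rY rJ),
    instr (inc rJ)]),
  pushProg aHp aNp rJ rC,
  ite (lt rM rJ) (instr (copy rM rJ)) skip]

/-- The counter of the parent holds the number of its non-last children met so far, which is the
index of `c` among them in the draining order; place `1` is reserved for the last child. The bound
on `rM` keeps the number of passes linear in the size of the level. -/
theorem runs_drainProg_placeProg {P : Parse ℕ} {M : List ℕ} {B : ℕ → List ℕ} {k : ℕ}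
    {cls : ℕ → ℕ} {s : State}
    (h : Siblings P (s.mem aPar) (s.mem aLast) cls M (drainList B (s.reg rBase) k))
    (hz : s.reg rZ = 0) (ho : s.reg rOne = 1) (hm : s.reg rM = 0)
    (hi : s.reg rI = s.reg rBase + k) (hB : Buckets (s.mem aHc) (s.mem aNc) B)
    (hp : Buckets (s.mem aHp) (s.mem aNp) fun _ => []) (hc : ∀ v ∈ M, s.mem aCnt v = 0) :
    Runs (drainProg rP rC rI rBase aHc aNc placeProg) s fun s' t =>
      Buckets (s'.mem aHp) (s'.mem aNp) (bucketsOf (place (s.mem aPar) (s.mem aLast)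
        (drainList B (s.reg rBase) k)) (drainList B (s.reg rBase) k)) ∧
      (∀ c ∈ drainList B (s.reg rBase) k, place (s.mem aPar) (s.mem aLast)
        (drainList B (s.reg rBase) k) c ≤ s'.reg rM) ∧
      s'.reg rM ≤ (drainList B (s.reg rBase) k).length + 1 ∧
      (∀ v, v ∉ M → s'.mem aCnt v = s.mem aCnt v) ∧
      Buckets (s'.mem aHc) (s'.mem aNc)
        (fun j => if s.reg rBase < j ∧ j ≤ s.reg rBase + k then [] else B j) ∧
      t ≤ 40 * (drainList B (s.reg rBase) k).length + 5 * k + 1 := by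
  generalize hS : drainList B (s.reg rBase) k = S at *
  refine (runs_drainProg (K := 25) (fun D s' =>
    Buckets (s'.mem aHp) (s'.mem aNp) (bucketsOf (place (s.mem aPar) (s.mem aLast) S) D) ∧
    (∀ c ∈ D, place (s.mem aPar) (s.mem aLast) S c ≤ s'.reg rM) ∧ s'.reg rM ≤ D.length + 1 ∧
    (∀ v ∈ M, s'.mem aCnt v =
      (D.filter fun c => s.mem aPar c = v ∧ s.mem aLast c ≠ 1).length) ∧
    (∀ v, v ∉ M → s'.mem aCnt v = s.mem aCnt v))
    (by decide) (by decide) (by decide) (by decide) hz hi hB ?_ ?_ ?_).mono ?_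
  · intro D s1 s2 h1 h2 hJ
    rw [h2 aHp (by decide), h2 aNp (by decide), h2 aCnt (by decide),
      h1 rM (by decide) (by decide) (by decide)]
    exact hJ
  · refine ⟨by simpa [bucketsOf_nil] using hp, by simp, by simp [hm], by simpa using hc, by simp⟩
  · rintro D c l' s1 hD hs1 ⟨hJ1, hJ2, hJ3, hJ4, hJ5⟩ hv
    rw [hS] at hD
    have e1 := (hs1.reg rOne (by decide)).trans ho
    have m16 := hs1.mem aPar (by decide)
    have m18 := hs1.mem aLast (by decide)
    have hcS : c ∈ S := by simp [hD]
    have hnd := h.nodup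
    rw [hD, List.nodup_append] at hnd
    have hcD : c ∉ D := fun hc' => hnd.2.2 c hc' c (by simp) rfl
    -- Both branches end with the same push and update of the maximum, so these are treated once for
    -- any state with the right place in `rJ`.
    have main : ∀ s2 : State, s2.mem aHp = s1.mem aHp → s2.mem aNp = s1.mem aNp →
        s2.reg rM = s1.reg rM → s2.reg rC = c → s2.reg rJ = place (s.mem aPar) (s.mem aLast) S c →
        (∀ v ∈ M, s2.mem aCnt v =
          ((D ++ [c]).filter fun c => s.mem aPar c = v ∧ s.mem aLast c ≠ 1).length) →
        (∀ v, v ∉ M → s2.mem aCnt v = s.mem aCnt v) →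
        s2.reg rJ ≤ D.length + 2 →
        Runs (pushProg aHp aNp rJ rC) s2 fun s3 t3 =>
          ((s3.reg rM < s3.reg rJ → Buckets (s3.mem aHp) (s3.mem aNp)
              (bucketsOf (place (s.mem aPar) (s.mem aLast) S) (D ++ [c])) ∧
            (∀ c' ∈ D ++ [c], place (s.mem aPar) (s.mem aLast) S c' ≤ s3.reg rJ) ∧
            s3.reg rJ ≤ (D ++ [c]).length + 1 ∧
            (∀ v ∈ M, s3.mem aCnt v =
              ((D ++ [c]).filter fun c => s.mem aPar c = v ∧ s.mem aLast c ≠ 1).length) ∧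
            (∀ v, v ∉ M → s3.mem aCnt v = s.mem aCnt v)) ∧
          (¬ s3.reg rM < s3.reg rJ → Buckets (s3.mem aHp) (s3.mem aNp)
              (bucketsOf (place (s.mem aPar) (s.mem aLast) S) (D ++ [c])) ∧
            (∀ c' ∈ D ++ [c], place (s.mem aPar) (s.mem aLast) S c' ≤ s3.reg rM) ∧
            s3.reg rM ≤ (D ++ [c]).length + 1 ∧
            (∀ v ∈ M, s3.mem aCnt v =
              ((D ++ [c]).filter fun c => s.mem aPar c = v ∧ s.mem aLast c ≠ 1).length) ∧
            (∀ v, v ∉ M → s3.mem aCnt v = s.mem aCnt v))) ∧ t3 ≤ 6 := by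
      intro s2 g1 g2 g3 g4 g5 g6 g7 g8
      refine (runs_pushProg (by decide) (by decide) (by decide)).mono ?_
      rintro s3 t3 hs3 ⟨h1, h2, ht3⟩
      have f20 := hs3.reg rJ (by decide)
      have f21 := hs3.reg rM (by decide)
      have m30 := hs3.mem aCnt (by decide)
      rw [g1, g5, g4] at h1
      rw [g2, g4, g1, g5] at h2
      rw [h1, h2, f20, f21, m30, g3, g5]
      have hb := hJ1.push_bucketsOf hcD rfl
      refine ⟨⟨fun hlt => ⟨hb, ?_, ?_, g6, g7⟩, fun hlt => ⟨hb, ?_, ?_, g6, g7⟩⟩, ht3⟩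
      · intro c' hc'
        rcases List.mem_append.1 hc' with hc' | hc'
        · have := hJ2 c' hc'
          omega
        · rw [List.mem_singleton.1 hc']
      · simp
        omega
      · intro c' hc'
        rcases List.mem_append.1 hc' with hc' | hc'
        · exact hJ2 c' hc'
        · rw [List.mem_singleton.1 hc']
          omega
      · simp
        omega
    unfold placeProg
    simp only [runs_block_cons, runs_block_nil, runs_instr, runs_ite, runs_skip, Instr.apply]
    simp only [State.setReg_reg, State.setReg_mem, State.setMem_reg, Test.Holds,
      ↓reduceIte, Nat.reduceEqDiff, hv, e1, m16, m18]
    refine ⟨fun hl => ?_, fun hl => ?_⟩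
    · refine (main _ (by simp) (by simp) (by simp) (by simp [hv]) ?_ ?_ ?_ ?_).mono ?_
      · simp [place, hl]
      · simpa [hl] using hJ4
      · simpa using hJ5
      · simp
      · rintro s3 t3 hs3 ⟨⟨h1, h2⟩, ht3⟩
        exact ⟨fun hlt => ⟨h1 hlt, by omega⟩, fun hlt => ⟨h2 hlt, by omega⟩⟩
    · have hvM := h.par_mem c hcS
      have hcnt := hJ4 _ hvM
      have hpl : place (s.mem aPar) (s.mem aLast) S c = s1.mem aCnt (s.mem aPar c) + 1 + 1 := by
        rw [place, if_neg hl, hcnt]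
        have hS' : (S.filter fun x => s.mem aPar x = s.mem aPar c ∧ s.mem aLast x ≠ 1) =
            (D.filter fun x => s.mem aPar x = s.mem aPar c ∧ s.mem aLast x ≠ 1) ++
              c :: (l'.filter fun x => s.mem aPar x = s.mem aPar c ∧ s.mem aLast x ≠ 1) := by
          rw [hD, List.filter_append, List.filter_cons_of_pos (by simpa using hl)]
        rw [hS', List.idxOf_append_of_notMem (fun hm => hcD (List.mem_filter.1 hm).1),
          List.idxOf_cons_self]
      refine (main _ (by simp) (by simp) (by simp) (by simp [hv]) ?_ ?_ ?_ ?_).mono ?_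
      · simp [hpl]
      · intro v hv'
        by_cases hvc : v = s.mem aPar c
        · subst hvc
          simp [hl, hcnt]
        · simp [hvc, Ne.symm hvc, hJ4 v hv']
      · intro v hv'
        have : v ≠ s.mem aPar c := fun e => hv' (e ▸ hvM)
        simp [this, hJ5 v hv']
      · have : s1.mem aCnt (s.mem aPar c) ≤ D.length := by
          rw [hcnt]
          exact List.length_filter_le _ _
        simp
        omega
      · rintro s3 t3 hs3 ⟨⟨h1, h2⟩, ht3⟩
        exact ⟨fun hlt => ⟨h1 hlt, by omega⟩, fun hlt => ⟨h2 hlt, by omega⟩⟩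
  · rintro s' t hs' ⟨⟨h1, h2, h3, h4, h5⟩, h6, h7⟩
    rw [hS] at h1 h2 h3 h7
    exact ⟨h1, h2, h3, h5, h6, by omega⟩

/-- Classify the vertices of one depth by their kinds. -/
def classProg : Program := walkProg rP rV aNl (block [
  instr (load rKey aKind rV),
  instr (copy rK rW),
  refineProg,
  instr (inc rTop)])

/-- A refinement of the single class `b` with the kind as key: the level is already sorted by kind,
and the new class number is `b` plus the number of vertices of smaller kind. -/
theorem runs_classProg {M : List ℕ} {s : State} {b : ℕ} (hz : s.reg rZ = 0)
    (hl : Linked (s.mem aNl) (s.reg rP) M) (hM : M.Nodup)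
    (hs : M.Pairwise fun x y => s.mem aKind x ≤ s.mem aKind y)
    (hst : ∀ k, s.mem aStamp k < s.reg rSt) (hw : s.reg rW = b) :
    Runs classProg s fun s' t =>
      (∀ v ∈ M, s'.mem aCls v = b + rankIn M (s.mem aKind) v) ∧
      (∀ v, v ∉ M → s'.mem aCls v = s.mem aCls v) ∧ s'.reg rTop = s.reg rTop + M.length ∧
      (∀ k, s'.mem aStamp k ≤ s.reg rSt) ∧ t ≤ 40 * M.length + 1 := by
  refine (runs_walkProg (K := 20) (fun D s' =>
    Refining (fun _ => b) (s.mem aKind) (s.reg rSt) D s' ∧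
    (∀ v, v ∉ D → s'.mem aCls v = s.mem aCls v) ∧ s'.reg rTop = s.reg rTop + D.length ∧
    (∀ k, s'.mem aStamp k ≤ s.reg rSt))
    (by decide) (by decide) (by decide) hz hl ?_ ?_ ?_).mono ?_
  · intro D s1 s2 h1 h2 hJ
    rw [h2, h1 rTop (by decide) (by decide)]
    exact ⟨hJ.1.congr fun A _ => by rw [h2], hJ.2⟩
  · exact ⟨.nil fun k => (hst k).ne, by simp, by simp, fun k => (hst k).le⟩
  · rintro D v l' s1 hD hs1 ⟨hJ1, hJ2, hJ3, hJ4⟩ hv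
    have e13 := (hs1.reg rW (by decide)).trans hw
    have e25 := hs1.reg rSt (by decide)
    have m13 := hs1.mem aKind (by decide)
    have hnd := hM
    rw [hD, List.nodup_append] at hnd
    rw [hD, List.pairwise_append] at hs
    simp only [runs_block_cons, runs_block_nil, runs_instr, Instr.apply]
    refine (runs_refineProg (v := v) (hJ1.congr (s' := _) fun A _ => ?_)
      (fun h => hnd.2.2 v h v (by simp) rfl)
      (fun u hu => hs.2.2 u hu v (by simp)) ?_ ?_ ?_ ?_).mono ?_
    · simp
    · simp [hv]
    · simp [e13]
    · simp [hv, m13]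
    · simp [e25]
    · rintro s2 t2 hs2 ⟨h1, h2, h3, ht2⟩
      have f22 := hs2.reg rTop (by decide)
      simp only [State.setReg_reg, State.setReg_mem, ↓reduceIte, Nat.reduceEqDiff] at h2 h3 f22
      refine ⟨⟨h1.congr fun A _ => by simp, fun u hu => ?_, ?_, fun k => ?_⟩, by omega⟩
      · simp only [List.mem_append, List.mem_singleton, not_or] at hu
        simp [h2 u hu.2, hJ2 u hu.1]
      · simp [f22, hJ3, add_assoc]
      · rcases h3 k with h | h
        · simp [h]
        · simpa [h] using hJ4 k
  · rintro s' t hs' ⟨⟨h1, h2, h3, h4⟩, ht⟩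
    refine ⟨fun v hv => ?_, h2, h3, h4, by omega⟩
    rw [h1.cls v hv]
    simp [rankIn]

/-- Refine the classes by the children with one place, and append them to the lists of
children. -/
def passProg : Program := walkProg rP rC aNp (block [
  instr (load rV aPar rC),
  instr (load rKey aCls rC),
  instr (load rK aCls rV),
  refineProg,
  pushProg aHch aNch rV rC])

/-- Every parent occurs at most once in `Q`, so the class read for it is the one from before the
pass; the children lie outside `M`, so their own classes serve unchanged as keys. Appending each
child to the list of its parent in the same walk builds the lists needed for output. -/
theorem runs_passProg {kind cls g : ℕ → ℕ} {M T Q : List ℕ} {C : ℕ → List ℕ} {s : State} {b : ℕ}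
    (hz : s.reg rZ = 0) (hl : Linked (s.mem aNp) (s.reg rP) Q)
    (hst : ∀ k, s.mem aStamp k < s.reg rSt) (hM : M.Nodup)
    (hQ : (Q.map (s.mem aPar)).Nodup) (hQM : ∀ c ∈ Q, s.mem aPar c ∈ M)
    (hg : ∀ c ∈ Q, g (s.mem aPar c) = c)
    (hlen : ∀ u ∈ M, ∀ v ∈ M, kind u = kind v →
      (T.filter fun c => s.mem aPar c = u).length = (T.filter fun c => s.mem aPar c = v).length)
    (hex : ∀ u ∈ M, ∀ v ∈ M, kind u = kind v → u ∈ Q.map (s.mem aPar) → v ∈ Q.map (s.mem aPar))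
    (hcls : ∀ v ∈ M, s.mem aCls v = b + rankIn M (keys kind (s.mem aPar) cls T) v)
    (hclsQ : ∀ c ∈ Q, s.mem aCls c = cls c ∧ c ∉ M)
    (hs : Q.Pairwise fun a b => cls a ≤ cls b)
    (hB : Buckets (s.mem aHch) (s.mem aNch) fun v => bucketsOf (s.mem aPar) T v ++ C v)
    (hQT : ∀ c ∈ Q, c ∉ T ∧ ∀ v, c ∉ C v) :
    Runs passProg s fun s' t =>
      (∀ v ∈ M, s'.mem aCls v = b + rankIn M (keys kind (s.mem aPar) cls (T ++ Q)) v) ∧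
      (∀ v, v ∉ M → s'.mem aCls v = s.mem aCls v) ∧
      Buckets (s'.mem aHch) (s'.mem aNch)
        (fun v => bucketsOf (s.mem aPar) (T ++ Q) v ++ C v) ∧
      (∀ k, s'.mem aStamp k ≤ s.reg rSt) ∧ t ≤ 40 * Q.length + 1 := by
  have hQ' : Q.Nodup := hQ.of_map
  refine (runs_walkProg (K := 30) (fun D s' =>
    Refining (fun v => b + rankIn M (keys kind (s.mem aPar) cls T) v) (fun v => cls (g v))
      (s.reg rSt) (D.map (s.mem aPar)) s' ∧
    (∀ v, v ∉ D.map (s.mem aPar) → s'.mem aCls v = s.mem aCls v) ∧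
    (∀ k, s'.mem aStamp k ≤ s.reg rSt) ∧
    Buckets (s'.mem aHch) (s'.mem aNch) (fun v => bucketsOf (s.mem aPar) (T ++ D) v ++ C v))
    (by decide) (by decide) (by decide) hz hl ?_ ?_ ?_).mono ?_
  · intro D s1 s2 h1 h2 hJ
    rw [h2]
    exact ⟨hJ.1.congr fun A _ => by rw [h2], hJ.2⟩
  · exact ⟨.nil fun k => (hst k).ne, by simp, fun k => (hst k).le, by simpa using hB⟩
  · rintro D c l' s1 hD hs1 ⟨hJ1, hJ2, hJ3, hJ4⟩ hv
    have e25 := hs1.reg rSt (by decide)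
    have m16 := hs1.mem aPar (by decide)
    have hcQ : c ∈ Q := by simp [hD]
    have hnd := hQ
    rw [hD, List.map_append, List.map_cons, List.nodup_append] at hnd
    rw [hD, List.pairwise_append] at hs
    have hpc : s.mem aPar c ∉ D.map (s.mem aPar) := fun h => hnd.2.2 _ h _ (by simp) rfl
    have hcD : c ∉ D := fun h => hpc (List.mem_map_of_mem h)
    have hcM : c ∉ D.map (s.mem aPar) := fun h => by
      obtain ⟨d, hd, he⟩ := List.mem_map.1 h
      exact (hclsQ c hcQ).2 (he ▸ hQM d (by simp [hD, hd]))
    simp only [runs_block_cons, runs_block_nil, runs_instr, Instr.apply]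
    refine (runs_refineProg (v := s.mem aPar c) (hJ1.congr (s' := _) fun A _ => ?_) hpc
      (fun u hu => ?_) ?_ ?_ ?_ ?_).mono ?_
    · simp
    · obtain ⟨d, hd, rfl⟩ := List.mem_map.1 hu
      rw [hg c hcQ, hg d (by simp [hD, hd])]
      exact hs.2.2 d hd c (by simp)
    · simp [hv, m16]
    · simp [hv, m16, hJ2 _ hpc, hcls _ (hQM c hcQ)]
    · simp [hv, hg c hcQ, hJ2 _ hcM, (hclsQ c hcQ).1]
    · simp [e25]
    · rintro s2 t2 hs2 ⟨h1, h2, h3, ht2⟩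
      refine (runs_pushProg (by decide) (by decide) (by decide)).mono ?_
      rintro s3 t3 hs3 ⟨h4, h5, ht3⟩
      have f5 := hs2.reg rV (by decide)
      have f19 := hs2.reg rC (by decide)
      have k27 := hs2.mem aHch (by decide)
      have k28 := hs2.mem aNch (by decide)
      have k29 := hs3.mem aCls (by decide)
      have k31 := hs3.mem aStamp (by decide)
      simp only [State.setReg_reg, State.setReg_mem, ↓reduceIte, Nat.reduceEqDiff, hv, m16] at h2 h3 f5 f19 k27 k28
      rw [f5, f19, k27] at h4
      rw [f5, f19, k27, k28] at h5
      refine ⟨⟨?_, fun u hu => ?_, fun k => ?_, ?_⟩, by omega⟩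
      · rw [List.map_append, List.map_singleton]
        exact h1.congr fun A hA => hs3.mem A (by revert hA A; decide)
      · simp only [List.map_append, List.map_singleton, List.mem_append, List.mem_singleton,
          not_or] at hu
        rw [k29, h2 u hu.2, hJ2 u hu.1]
      · rw [k31]
        rcases h3 k with h | h
        · exact h.le
        · exact h ▸ hJ3 k
      · rw [h4, h5]
        have := hJ4.push (v := c) (fun j hj => ?_) (s.mem aPar c)
        · rw [← List.append_assoc, bucketsOf_append]
          convert this using 1
          funext j
          by_cases hj : j = s.mem aPar c
          · subst hj
            simp
          · simp [hj]
        · rw [List.mem_append, mem_bucketsOf, List.mem_append] at hj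
          rcases hj with ⟨hj | hj, -⟩ | hj
          · exact (hQT c hcQ).1 hj
          · exact hcD hj
          · exact (hQT c hcQ).2 j hj
  · rintro s' t hs' ⟨⟨h1, h2, h3, h4⟩, ht⟩
    refine ⟨fun v hv => ?_, fun v hv => h2 v fun h => ?_, h4, h3, by omega⟩
    -- Members of a class without a child in `Q` keep their number, and a class is never split
    -- between vertices with and without such a child.
    · rw [rankIn_keys_append hM hQ hQM hg hlen hex hv]
      by_cases hvQ : v ∈ Q.map (s.mem aPar)
      · rw [h1.cls v hvQ, if_pos hvQ]
        simp only [Nat.add_left_cancel_iff]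
        omega
      · rw [if_neg hvQ, h2 v hvQ, hcls v hv, add_zero]
    · obtain ⟨c, hc, rfl⟩ := List.mem_map.1 h
      exact hv (hQM c hc)

end RAM

/-! ### Codes from sorted lists of children -/

namespace Siblings

variable {P : Parse ℕ} {par last cls : ℕ → ℕ} {M S T : List ℕ}

theorem mem_bucketsOf_par (h : Siblings P par last cls M S) (hP : P.Valid)
    (hT : Above par last S T 0) {v : ℕ} (hv : v ∈ M) {c : ℕ} :
    c ∈ bucketsOf par T v ↔ P.Child v c := by
  rw [mem_bucketsOf, hT.mem]
  constructor
  · rintro ⟨⟨hc, -⟩, h2⟩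
    exact (h.par_eq_iff hP hc).1 h2
  · intro hch
    have hc := h.mem v hv c hch
    have hp := (h.par_eq_iff hP hc).2 hch
    exact ⟨⟨hc, ((h.exists_place_iff hP hv).1 ⟨c, hc, hp, rfl⟩).1⟩, hp⟩

/-- The codes of the vertices in `M`, from lists of children in order of increasing place. -/
theorem codeFrom (h : Siblings P par last cls M S) (hP : P.Valid) {code : ℕ → List ℕ}
    (hc : P.IsCode code) (hr : Ranks (· ∈ S) cls code) (hT : Above par last S T 0) {v : ℕ}
    (hv : v ∈ M) : CodeFrom P code v (bucketsOf par T v) := by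
  have hmem := fun c => h.mem_bucketsOf_par hP hT hv (c := c)
  unfold CodeFrom
  by_cases hk : P.kd v = .trivial
  · have hnil : bucketsOf par T v = [] := by
      rw [List.eq_nil_iff_forall_not_mem]
      intro c hc'
      exact ((hmem c).1 hc').ne_trivial hk
    rw [hnil, if_pos (StatementKind.number_eq_one.2 hk), hc v, hk]
    rfl
  · have hS : ∀ c, P.Child v c → c ∈ S ∧ par c = v := fun c hch =>
      ⟨h.mem v hv c hch, (h.par_eq_iff hP (h.mem v hv c hch)).2 hch⟩
    have hnd : (bucketsOf par T v).Nodup := List.nodup_reverse.2 (hT.nodup.filter _)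
    have hpw : (bucketsOf par T v).Pairwise fun a b =>
        place par last S a ≤ place par last S b := by
      unfold bucketsOf
      rw [List.pairwise_reverse]
      exact hT.sorted.filter _
    have hlast : P.Child v _ := Parse.Valid.child_last hk
    have hl1 : place par last S (P.ch v ((P.kd v).order - 1)) = 1 := by
      rw [h.place_eq_one (hS _ hlast).1, (hS _ hlast).2]
    obtain ⟨x, l, hxl⟩ := List.exists_cons_of_ne_nil (List.ne_nil_of_mem ((hmem _).2 hlast))
    rw [hxl] at hnd hpw hmem
    -- The list runs by increasing place, so its head has place `1`, that of the last child.
    have hx : x = P.ch v ((P.kd v).order - 1) := by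
      have hx := (hmem x).1 (by simp)
      rcases List.mem_cons.1 ((hmem _).2 hlast) with he | hm
      · exact he.symm
      · have h1 := (List.pairwise_cons.1 hpw).1 _ hm
        have h0 := ((h.exists_place_iff hP hv).1 ⟨x, (hS x hx).1, (hS x hx).2, rfl⟩).1
        exact h.place_inj (hS x hx).1 (hS _ hlast).1 ((hS x hx).2.trans (hS _ hlast).2.symm)
          (by omega)
    rw [List.nodup_cons] at hnd
    have hml : ∀ c, c ∈ l ↔ P.Child v c ∧ c ≠ P.ch v ((P.kd v).order - 1) := by
      intro c
      rw [← hmem c, List.mem_cons, ← hx]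
      constructor
      · intro hcl
        exact ⟨.inr hcl, fun e => hnd.1 (e ▸ hcl)⟩
      · rintro ⟨h1 | h1, h2⟩
        · exact absurd h1 h2
        · exact h1
    -- Among alternatives a higher place means no larger class, hence no larger code because the
    -- classes are ranks.
    have hsort : l.Pairwise fun a b => code b ≤ code a := by
      refine ((List.pairwise_cons.1 hpw).2.and hnd.2).imp_of_mem fun {a b} ha hb hab => ?_
      obtain ⟨hab, hne⟩ := hab
      have ha' := (hml a).1 ha
      have hb' := (hml b).1 hb
      obtain ⟨sa, pa⟩ := hS a ha'.1
      obtain ⟨sb, pb⟩ := hS b hb'.1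
      have hlt : place par last S a < place par last S b := by
        refine lt_of_le_of_ne hab fun e => hne (h.place_inj sa sb (pa.trans pb.symm) e)
      have ha1 : place par last S a ≠ 1 := by
        rw [Ne, h.place_eq_one sa, pa]
        exact ha'.2
      rcases (h.cls_le sa sb (pa.trans pb.symm) ha1 hlt).lt_or_eq with h1 | h1
      · exact ((hr b a sb sa).1 h1).lt.le
      · exact ((hr b a sb sa).2 h1).le
    rw [hxl, if_neg (fun e => hk (StatementKind.number_eq_one.1 e)),
      hc.eq_of_sorted hP hk hnd.2 hml hsort, hx]
    rfl

end Siblings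

namespace RAM

open Program Instr Test

/-- Refine the classes by the children, in order of decreasing place. -/
def passesProg : Program := loop (lt rZ rM) (block [
  instr (load rP aHp rM),
  instr (store aHp rM rZ),
  instr (inc rSt),
  passProg,
  instr (dec rM)])

/-- Running the places downwards reads the children in order of emission, smallest code first and
last child at the end, so the keys collected are compared as the code prescribes. `T` collects the
children already used. A fresh value of `rSt` makes all old stamps stale, and emptying the place
lists prepares the next level. -/
theorem runs_passesProg {P : Parse ℕ} {M S : List ℕ} {cls : ℕ → ℕ} {C : ℕ → List ℕ} {s : State}
    {b : ℕ} (h : Siblings P (s.mem aPar) (s.mem aLast) cls M S) (hP : P.Valid)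
    (hz : s.reg rZ = 0) (hM : M.Nodup)
    (hp : Buckets (s.mem aHp) (s.mem aNp) (bucketsOf (place (s.mem aPar) (s.mem aLast) S) S))
    (hpm : ∀ c ∈ S, place (s.mem aPar) (s.mem aLast) S c ≤ s.reg rM)
    (hst : ∀ k, s.mem aStamp k ≤ s.reg rSt)
    (hcls : ∀ v ∈ M, s.mem aCls v =
      b + rankIn M (keys (fun v => (P.kd v).number) (s.mem aPar) cls []) v)
    (hclsS : ∀ c ∈ S, s.mem aCls c = cls c ∧ c ∉ M)
    (hB : Buckets (s.mem aHch) (s.mem aNch) C) (hSC : ∀ c ∈ S, ∀ v, c ∉ C v) :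
    Runs passesProg s fun s' t => ∃ T, Siblings.Above (s.mem aPar) (s.mem aLast) S T 0 ∧
      (∀ v ∈ M, s'.mem aCls v =
        b + rankIn M (keys (fun v => (P.kd v).number) (s.mem aPar) cls T) v) ∧
      (∀ v, v ∉ M → s'.mem aCls v = s.mem aCls v) ∧
      Buckets (s'.mem aHch) (s'.mem aNch) (fun v => bucketsOf (s.mem aPar) T v ++ C v) ∧
      Buckets (s'.mem aHp) (s'.mem aNp) (fun _ => []) ∧
      (∀ k, s'.mem aStamp k ≤ s'.reg rSt) ∧ t ≤ 40 * S.length + 12 * s.reg rM + 1 := by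
  set pl := place (s.mem aPar) (s.mem aLast) S with hpl
  have hpos : ∀ c ∈ S, 0 < pl c := fun c hc =>
    ((h.exists_place_iff hP (h.par_mem c hc)).1 ⟨c, hc, rfl, rfl⟩).1
  refine runs_loop_of_inv (m₀ := 40 * S.length + 12 * s.reg rM)
    (fun s' m => ∃ T, Siblings.Above (s.mem aPar) (s.mem aLast) S T (s'.reg rM) ∧
      (∀ v ∈ M, s'.mem aCls v =
        b + rankIn M (keys (fun v => (P.kd v).number) (s.mem aPar) cls T) v) ∧
      (∀ v, v ∉ M → s'.mem aCls v = s.mem aCls v) ∧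
      Buckets (s'.mem aHch) (s'.mem aNch) (fun v => bucketsOf (s.mem aPar) T v ++ C v) ∧
      Buckets (s'.mem aHp) (s'.mem aNp)
        (fun i => if i ≤ s'.reg rM then bucketsOf pl S i else []) ∧
      (∀ k, s'.mem aStamp k ≤ s'.reg rSt) ∧
      m = 40 * (S.length - T.length) + 12 * s'.reg rM) ?_ ?_ ?_
  · refine ⟨[], ⟨List.nodup_nil, fun c => ?_, List.Pairwise.nil⟩, hcls, fun _ _ => rfl, ?_, ?_,
      hst, rfl⟩
    · simp only [List.not_mem_nil, false_iff, not_and, not_lt]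
      exact hpm c
    · simpa [bucketsOf] using hB
    · convert hp using 1
      funext i
      split_ifs with hi
      · rfl
      · refine (List.eq_nil_iff_forall_not_mem.2 fun c hc => ?_).symm
        have := mem_bucketsOf.1 hc
        exact hi (this.2 ▸ hpm c this.1)
  · rintro s1 _ hs1 ⟨T, hT, h1, h2, h3, h4, h5, rfl⟩ hb
    have e0 := (hs1.reg rZ (by decide)).trans hz
    have m16 := hs1.mem aPar (by decide)
    simp only [Test.Holds, e0] at hb
    obtain ⟨j, hj⟩ : ∃ j, s1.reg rM = j + 1 := ⟨s1.reg rM - 1, by omega⟩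
    rw [hj] at hT h4
    have hlk := h4.linked (j + 1)
    rw [if_pos le_rfl] at hlk
    have hQmem : ∀ c, c ∈ bucketsOf pl S (j + 1) ↔ c ∈ S ∧ pl c = j + 1 := fun c => mem_bucketsOf
    have hQnd : ((bucketsOf pl S (j + 1)).map (s.mem aPar)).Nodup := by
      refine List.Nodup.map_on (fun a ha c hc hac => ?_) (hp.nodup _)
      rw [hQmem] at ha hc
      exact h.place_inj ha.1 hc.1 hac (ha.2.trans hc.2.symm)
    -- Children with equal place and equal parent coincide, so the parent map is invertible on one
    -- place.
    have hg : ∃ g : ℕ → ℕ, ∀ c ∈ bucketsOf pl S (j + 1), g (s.mem aPar c) = c := by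
      have hi : Set.InjOn (s.mem aPar) {c | c ∈ bucketsOf pl S (j + 1)} := by
        intro a ha c hc hac
        have ha' := (hQmem a).1 ha
        have hc' := (hQmem c).1 hc
        exact h.place_inj ha'.1 hc'.1 hac (ha'.2.trans hc'.2.symm)
      exact ⟨Function.invFunOn (s.mem aPar) {c | c ∈ bucketsOf pl S (j + 1)},
        fun c hc => hi.leftInvOn_invFunOn hc⟩
    obtain ⟨g, hg⟩ := hg
    simp only [runs_block_cons, runs_block_nil, runs_instr, Instr.apply]
    refine (runs_passProg (kind := fun v => (P.kd v).number) (cls := cls) (g := g) (M := M)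
      (T := T) (Q := bucketsOf pl S (j + 1)) (C := C) (b := b) ?_ ?_ ?_ hM ?_ ?_ ?_ ?_ ?_ ?_ ?_ ?_
      ?_ ?_).mono ?_
    · simp [e0]
    · simpa [hj] using hlk
    · intro k
      simpa [Nat.lt_succ_iff] using h5 k
    · simpa [m16] using hQnd
    · simp only [State.setReg_mem, State.setMem_mem, Nat.reduceEqDiff, ↓reduceIte, m16]
      exact fun c hc => h.par_mem c ((hQmem c).1 hc).1
    · simpa [m16] using hg
    · simp only [State.setReg_mem, State.setMem_mem, Nat.reduceEqDiff, ↓reduceIte, m16]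
      exact fun u hu v hv he => h.length_filter_eq hP hT hu hv (StatementKind.number_injective he)
    · simp only [State.setReg_mem, State.setMem_mem, Nat.reduceEqDiff, ↓reduceIte, m16]
      intro u hu v hv he huQ
      obtain ⟨c, hc, rfl⟩ := List.mem_map.1 huQ
      rw [hQmem] at hc
      have := (h.exists_place_iff hP hu).1 ⟨c, hc.1, rfl, hc.2⟩
      rw [StatementKind.number_injective he] at this
      obtain ⟨c', hc', hp', he'⟩ := (h.exists_place_iff hP hv).2 this
      exact List.mem_map.2 ⟨c', (hQmem c').2 ⟨hc', he'⟩, hp'⟩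
    · simpa [m16] using h1
    · intro c hc
      rw [hQmem] at hc
      have := hclsS c hc.1
      simp [h2 c this.2, this.1, this.2]
    · unfold bucketsOf
      rw [List.pairwise_reverse]
      exact h.sorted.filter _
    · simpa [m16] using h3
    · intro c hc
      rw [hQmem] at hc
      refine ⟨fun hcT => ?_, hSC c hc.1⟩
      have := ((hT.mem c).1 hcT).2
      have := hc.2
      rw [hpl] at this
      omega
    · rintro s2 t2 hs2 ⟨g1, g2, g3, g4, ht2⟩
      have f21 := hs2.reg rM (by decide)
      have f25 := hs2.reg rSt (by decide)
      have k25 := hs2.mem aHp (by decide)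
      have k26 := hs2.mem aNp (by decide)
      simp only [State.setReg_reg, State.setReg_mem, State.setMem_reg, State.setMem_mem,
        Nat.reduceEqDiff, ↓reduceIte, m16, hj, e0] at g1 g2 g3 g4 f21 f25 k25 k26
      have hT' : Siblings.Above (s.mem aPar) (s.mem aLast) S (T ++ bucketsOf pl S (j + 1)) j := by
        constructor
        · rw [List.nodup_append]
          refine ⟨hT.nodup, hp.nodup _, fun a ha c hc => ?_⟩
          rintro rfl
          have h6 := ((hT.mem a).1 ha).2
          have h7 := ((hQmem a).1 hc).2
          rw [hpl] at h7
          omega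
        · intro c
          rw [List.mem_append, hT.mem, hQmem, ← hpl]
          constructor
          · rintro (⟨h6, h7⟩ | ⟨h6, h7⟩)
            · exact ⟨h6, by omega⟩
            · exact ⟨h6, by omega⟩
          · rintro ⟨h6, h7⟩
            rcases Nat.lt_or_ge (j + 1) (pl c) with h8 | h8
            · exact .inl ⟨h6, h8⟩
            · exact .inr ⟨h6, by omega⟩
        · rw [List.pairwise_append]
          refine ⟨hT.sorted, List.pairwise_of_forall_mem_list fun a ha c hc => ?_,
            fun a ha c hc => ?_⟩
          · exact (((hQmem c).1 hc).2.trans ((hQmem a).1 ha).2.symm).le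
          · have h6 := ((hT.mem a).1 ha).2
            have h7 := ((hQmem c).1 hc).2
            rw [hpl] at h7
            omega
      have hlen : (T ++ bucketsOf pl S (j + 1)).length ≤ S.length :=
        (List.subperm_of_subset hT'.nodup fun c hc => ((hT'.mem c).1 hc).1).length_le
      refine ⟨_, ⟨T ++ bucketsOf pl S (j + 1), ?_, g1, fun v hv => ?_, g3, ?_, ?_, rfl⟩, ?_⟩
      · simpa [f21] using hT'
      · rw [State.setReg_mem, g2 v hv, h2 v hv]
      · simp only [State.setReg_mem, State.setReg_reg, ↓reduceIte, f21, k25, k26,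
          Nat.add_sub_cancel]
        convert h4.clear (j + 1) using 1
        funext i
        by_cases hi : i = j + 1
        · subst hi
          simp
        · rw [Function.update_of_ne hi]
          split_ifs <;> first | rfl | omega
      · simpa [f25] using g4
      · rw [List.length_append] at hlen ⊢
        simp only [State.setReg_reg, ↓reduceIte, f21]
        omega
  · rintro s1 t _ hs1 ⟨T, hT, h1, h2, h3, h4, h5, rfl⟩ hb ht
    have e0 := (hs1.reg rZ (by decide)).trans hz
    simp only [Test.Holds, e0, not_lt, Nat.le_zero] at hb
    rw [hb] at hT h4
    refine ⟨T, hT, h1, h2, h3, ?_, h5, by omega⟩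
    convert h4 using 1
    funext i
    split_ifs with hi
    · refine (List.eq_nil_iff_forall_not_mem.2 fun c hc => ?_).symm
      obtain ⟨hc, he⟩ := mem_bucketsOf.1 hc
      have := hpos c hc
      omega
    · rfl

/-- Sort the vertices of one depth into lists by their classes. -/
def bucketProg : Program := walkProg rP rV aNl (block [
  instr (load rK aCls rV),
  pushProg aHc aNc rK rV])

theorem runs_bucketProg {M : List ℕ} {s : State} (hz : s.reg rZ = 0)
    (hl : Linked (s.mem aNl) (s.reg rP) M) (hM : M.Nodup)
    (hB : Buckets (s.mem aHc) (s.mem aNc) fun _ => []) :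
    Runs bucketProg s fun s' t =>
      Buckets (s'.mem aHc) (s'.mem aNc) (bucketsOf (s.mem aCls) M) ∧ t ≤ 20 * M.length + 1 := by
  refine (runs_walkProg (K := 8) (fun D s' =>
    Buckets (s'.mem aHc) (s'.mem aNc) (bucketsOf (s.mem aCls) D))
    (by decide) (by decide) (by decide) hz hl ?_ ?_ ?_).mono ?_
  · intro D s1 s2 h1 h2 hJ
    rwa [h2]
  · exact hB
  · rintro D v l' s1 hD hs1 hJ hv
    have m29 := hs1.mem aCls (by decide)
    have hnd := hM
    rw [hD, List.nodup_append] at hnd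
    simp only [runs_block_cons, runs_block_nil, runs_instr, Instr.apply]
    refine (runs_pushProg (by decide) (by decide) (by decide)).mono ?_
    rintro s2 t2 hs2 ⟨h1, h2, ht2⟩
    simp only [State.setReg_reg, State.setReg_mem, ↓reduceIte, Nat.reduceEqDiff, m29, hv] at h1 h2
    refine ⟨?_, by omega⟩
    rw [h1, h2]
    exact hJ.push_bucketsOf (fun h => hnd.2.2 v h v (by simp) rfl) rfl
  · rintro s' t hs' ⟨hJ, ht⟩
    exact ⟨hJ, by omega⟩

end RAM

/-! ### From one depth to the one above -/

namespace RAM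

open Program Instr Test

theorem HasTree.congr {P : Parse ℕ} {n : ℕ} {L : ℕ → List ℕ} {dep : ℕ → ℕ} {s s' : State}
    (h : HasTree P n L dep s)
    (hm : ∀ A ∈ [aPar, aLast, aKind, aNl, aHl], s'.mem A = s.mem A) :
    HasTree P n L dep s' := by
  simp only [List.mem_cons, List.not_mem_nil, or_false, forall_eq_or_imp, forall_eq] at hm
  obtain ⟨h1, h2, h3, h4, h5⟩ := hm
  refine { h with par := ?_, last := ?_, kind := ?_, level := ?_ }
  · rw [h1]; exact h.par
  · rw [h2]; exact h.last
  · rw [h3]; exact h.kind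
  · rw [h4, h5]; exact h.level

/-- The classification of the vertices of one depth, given the one of the next depth. -/
def levelStep : Program := block [
  instr (dec rE),
  instr (const rM 0),
  instr (copy rI rTop),
  drainProg rP rC rI rBase aHc aNc placeProg,
  instr (copy rBase rTop),
  instr (copy rW rTop),
  instr (inc rW),
  instr (inc rSt),
  instr (load rP aHl rE),
  classProg,
  passesProg,
  instr (load rP aHl rE),
  bucketProg]

/-- The state when the vertices of depth at least `d` have been dealt with; `C` gives their
lists of children. -/
structure LevelInv (P : Parse ℕ) (n : ℕ) (L : ℕ → List ℕ) (dep : ℕ → ℕ) (code : ℕ → List ℕ)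
    (d : ℕ) (C : ℕ → List ℕ) (s : State) : Prop where
  top : s.reg rTop = s.reg rBase + (L d).length
  cls : ∀ v ∈ L d, s.reg rBase < s.mem aCls v ∧ s.mem aCls v ≤ s.reg rTop
  classes : Buckets (s.mem aHc) (s.mem aNc) (bucketsOf (s.mem aCls) (L d))
  ranks : Ranks (· ∈ L d) (s.mem aCls) code
  places : Buckets (s.mem aHp) (s.mem aNp) fun _ => []
  children : Buckets (s.mem aHch) (s.mem aNch) C
  cnt : ∀ v, dep v < d → s.mem aCnt v = 0
  stamp : ∀ k, s.mem aStamp k ≤ s.reg rSt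
  mem_iff : ∀ v c, c ∈ C v ↔ P.Child v c ∧ d < dep c
  codeFrom : ∀ v, v < n → d ≤ dep v → CodeFrom P code v (C v)

/-- The classes of depth `d + 1` occupy an interval as long as that level, so draining their buckets
costs time linear in it. The new classes are placed in the interval just above, as long as level
`d`. `Ranks.of_children` turns the ranks of the key sequences into ranks of the codes at depth `d`.
-/
theorem runs_levelStep {P : Parse ℕ} {n : ℕ} {adj : ℕ → List ℕ} {L : ℕ → List ℕ} {dep : ℕ → ℕ}
    {code : ℕ → List ℕ} {d : ℕ} {C : ℕ → List ℕ} {s : State} (hP : P.OnRange n adj)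
    (hc : P.IsCode code) (hT : HasTree P n L dep s) (hz : s.reg rZ = 0) (ho : s.reg rOne = 1)
    (hd : s.reg rE = d + 1) (h : LevelInv P n L dep code (d + 1) C s) :
    Runs levelStep s fun s' t => s'.reg rE = d ∧ (∃ C', LevelInv P n L dep code d C' s') ∧
      t ≤ 110 * (L (d + 1)).length + 100 * (L d).length + 50 := by
  have hBmem : ∀ c i, c ∈ bucketsOf (s.mem aCls) (L (d + 1)) i ↔
      c ∈ L (d + 1) ∧ s.mem aCls c = i := fun c i => mem_bucketsOf
  have hSmem : ∀ c, c ∈ drainList (bucketsOf (s.mem aCls) (L (d + 1))) (s.reg rBase)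
      (L (d + 1)).length ↔ c ∈ L (d + 1) := by
    intro c
    rw [mem_drainList]
    constructor
    · rintro ⟨i, -, -, hi⟩
      exact ((hBmem c i).1 hi).1
    · intro hcL
      have h1 := h.cls c hcL
      have h2 := h.top
      exact ⟨_, h1.1, by omega, (hBmem c _).2 ⟨hcL, rfl⟩⟩
  have hSnd := h.classes.nodup_drainList (s.reg rBase) (L (d + 1)).length
  have hSs := pairwise_drainList (f := s.mem aCls) (lo := s.reg rBase) (k := (L (d + 1)).length)
    (fun i v hv => ((hBmem v i).1 hv).2)
  have hlt : ∀ {v c}, P.Child v c → v < n ∧ c < n := by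
    rintro v _ ⟨i, h0, hi, rfl⟩
    have hv := hP.lt_of_kd v (StatementKind.ne_trivial_of_lt_order h0 hi)
    exact ⟨hv, hP.ch_lt v i hv⟩
  have hsib : Siblings P (s.mem aPar) (s.mem aLast) (s.mem aCls) (L d)
      (drainList (bucketsOf (s.mem aCls) (L (d + 1))) (s.reg rBase) (L (d + 1)).length) := by
    have hchild : ∀ c ∈ L (d + 1), P.Child (s.mem aPar c) c := by
      intro c hcL
      obtain ⟨hcn, hcd⟩ := (hT.mem_level _ _).1 hcL
      rcases hP.full c hcn with rfl | ⟨w, hw⟩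
      · rw [hT.dep_root] at hcd
        omega
      · rwa [hT.par w c hw]
    refine ⟨hSnd, fun c hcS => hchild c ((hSmem c).1 hcS), fun c hcS => ?_, fun c hcS => ?_,
      fun v hv c hvc => ?_, hSs⟩
    · have hch := hchild c ((hSmem c).1 hcS)
      have h1 := hT.dep_child _ _ hch
      rw [((hT.mem_level _ _).1 ((hSmem c).1 hcS)).2] at h1
      exact (hT.mem_level _ _).2 ⟨(hlt hch).1, by omega⟩
    · exact hT.last _ _ (hchild c ((hSmem c).1 hcS))
    · rw [hSmem, hT.mem_level, hT.dep_child _ _ hvc, ((hT.mem_level _ _).1 hv).2]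
      exact ⟨(hlt hvc).2, rfl⟩
  have hslen : (drainList (bucketsOf (s.mem aCls) (L (d + 1))) (s.reg rBase)
      (L (d + 1)).length).length = (L (d + 1)).length :=
    ((List.perm_ext_iff_of_nodup hSnd (hT.nodup_level _)).2 hSmem).length_eq
  have hdisj : ∀ c ∈ L (d + 1), c ∉ L d := fun c h1 h2 => by
    have := ((hT.mem_level _ _).1 h1).2
    have := ((hT.mem_level _ _).1 h2).2
    omega
  unfold levelStep
  simp only [runs_block_cons, runs_block_nil, runs_instr, Instr.apply]
  -- the places of the children
  refine (runs_drainProg_placeProg (P := P) (M := L d) (k := (L (d + 1)).length)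
    (cls := s.mem aCls) (B := bucketsOf (s.mem aCls) (L (d + 1))) ?_ ?_ ?_ ?_ ?_ ?_ ?_ ?_).mono ?_
  · simpa using hsib
  · simp [hz]
  · simp [ho]
  · simp
  · simp [h.top]
  · simpa using h.classes
  · simpa using h.places
  · exact fun v hv => h.cnt v (by rw [((hT.mem_level _ _).1 hv).2]; omega)
  rintro s1 t1 hs1 ⟨a1, a2, a3, a4, a5, ht1⟩
  simp only [State.setReg_reg, State.setReg_mem, ↓reduceIte, Nat.reduceEqDiff] at a1 a2 a3 a4 a5 ht1
  generalize hSe : drainList (bucketsOf (s.mem aCls) (L (d + 1))) (s.reg rBase)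
    (L (d + 1)).length = S at *
  have a5' : Buckets (s1.mem aHc) (s1.mem aNc) fun _ => [] := by
    convert a5 using 1
    funext j
    split_ifs with hj
    · rfl
    · refine (List.eq_nil_iff_forall_not_mem.2 fun c hc => ?_).symm
      obtain ⟨hcL, he⟩ := (hBmem c j).1 hc
      have h1 := h.cls c hcL
      have h2 := h.top
      omega
  have e1 := hs1.reg rZ (by decide)
  have e26 := hs1.reg rE (by decide)
  have e22 := hs1.reg rTop (by decide)
  have e25 := hs1.reg rSt (by decide)
  have p16 := hs1.mem aPar (by decide)
  have p18 := hs1.mem aLast (by decide)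
  have p13 := hs1.mem aKind (by decide)
  have p21 := hs1.mem aHl (by decide)
  have p22 := hs1.mem aNl (by decide)
  have p27 := hs1.mem aHch (by decide)
  have p28 := hs1.mem aNch (by decide)
  have p29 := hs1.mem aCls (by decide)
  have p31 := hs1.mem aStamp (by decide)
  simp only [State.setReg_reg, State.setReg_mem, ↓reduceIte, Nat.reduceEqDiff, hz, hd,
    Nat.add_sub_cancel] at e1 e26 e22 e25 p16 p18 p13 p21 p22 p27 p28 p29 p31
  -- the kinds
  refine (runs_classProg (M := L d) (b := s.reg rTop + 1) ?_ ?_ (hT.nodup_level d) ?_ ?_ ?_).mono ?_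
  · simp [e1]
  · simpa [e26, p21, p22] using hT.level d
  · simp only [State.setReg_mem, p13]
    refine (hT.sorted d).imp_of_mem fun {a b} ha hb hab => ?_
    rwa [hT.kind a ((hT.mem_level _ _).1 ha).1, hT.kind b ((hT.mem_level _ _).1 hb).1]
  · intro k
    simpa [e25, p31, Nat.lt_succ_iff] using h.stamp k
  · simp [e22]
  rintro s2 t2 hs2 ⟨b1, b2, b3, b4, ht2⟩
  have f1 := hs2.reg rZ (by decide)
  have f26 := hs2.reg rE (by decide)
  have f23 := hs2.reg rBase (by decide)
  have f25 := hs2.reg rSt (by decide)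
  have f21 := hs2.reg rM (by decide)
  have q16 := hs2.mem aPar (by decide)
  have q18 := hs2.mem aLast (by decide)
  have q21 := hs2.mem aHl (by decide)
  have q22 := hs2.mem aNl (by decide)
  have q23 := hs2.mem aHc (by decide)
  have q24 := hs2.mem aNc (by decide)
  have q25 := hs2.mem aHp (by decide)
  have q26 := hs2.mem aNp (by decide)
  have q27 := hs2.mem aHch (by decide)
  have q28 := hs2.mem aNch (by decide)
  have q30 := hs2.mem aCnt (by decide)
  simp only [State.setReg_reg, State.setReg_mem, ↓reduceIte, Nat.reduceEqDiff, e1, e26, e22, e25,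
    p16, p18, p13, p21, p22, p27, p28, p29] at f1 f26 f23 f25 f21 q16 q18 q21 q22 q27 q28 b1 b2 b3 b4
  -- the children
  have hkeys : ∀ v ∈ L d, rankIn (L d) (s.mem aKind) v =
      rankIn (L d) (keys (fun v => (P.kd v).number) (s.mem aPar) (s.mem aCls) []) v := by
    intro v hv
    refine List.countP_congr fun u hu => ?_
    rw [hT.kind v ((hT.mem_level _ _).1 hv).1, hT.kind u ((hT.mem_level _ _).1 hu).1]
    simp [keys, List.cons_lt_cons_iff]
  refine (runs_passesProg (P := P) (M := L d) (S := S) (cls := s.mem aCls) (C := C)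
    (b := s.reg rTop + 1) ?_ hP.valid f1 (hT.nodup_level d) ?_ ?_ ?_ ?_ ?_ ?_ ?_).mono ?_
  · rw [q16, q18]; exact hsib
  · rw [q16, q18, q25, q26]; exact a1
  · rw [q16, q18, f21]; exact a2
  · rw [f25]; exact b4
  · intro v hv
    rw [q16, b1 v hv, hkeys v hv]
  · intro c hcS
    have := hdisj c ((hSmem c).1 hcS)
    exact ⟨b2 c this, this⟩
  · rw [q27, q28]; exact h.children
  · intro c hcS v hcv
    have h1 := ((h.mem_iff v c).1 hcv).2
    rw [((hT.mem_level _ _).1 ((hSmem c).1 hcS)).2] at h1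
    omega
  rintro s3 t3 hs3 ⟨T, c1, c2, c3, c4, c5, c6, ht3⟩
  have g1 := hs3.reg rZ (by decide)
  have g26 := hs3.reg rE (by decide)
  have g23 := hs3.reg rBase (by decide)
  have g22 := hs3.reg rTop (by decide)
  have r21 := hs3.mem aHl (by decide)
  have r22 := hs3.mem aNl (by decide)
  have r23 := hs3.mem aHc (by decide)
  have r24 := hs3.mem aNc (by decide)
  have r30 := hs3.mem aCnt (by decide)
  rw [q16, q18] at c1
  rw [q16] at c2 c4
  -- the lists of the classes
  refine (runs_bucketProg (M := L d) ?_ ?_ (hT.nodup_level d) ?_).mono ?_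
  · simp [g1, f1]
  · simpa [g26, f26, r21, r22, q21, q22] using hT.level d
  · simp only [State.setReg_mem, r23, r24, q23, q24]
    exact a5'
  rintro s4 t4 hs4 ⟨d1, ht4⟩
  have k26 := hs4.reg rE (by decide)
  have k23 := hs4.reg rBase (by decide)
  have k22 := hs4.reg rTop (by decide)
  have k25 := hs4.reg rSt (by decide)
  have l25 := hs4.mem aHp (by decide)
  have l26 := hs4.mem aNp (by decide)
  have l27 := hs4.mem aHch (by decide)
  have l28 := hs4.mem aNch (by decide)
  have l29 := hs4.mem aCls (by decide)
  have l30 := hs4.mem aCnt (by decide)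
  have l31 := hs4.mem aStamp (by decide)
  simp only [State.setReg_reg, State.setReg_mem, ↓reduceIte, Nat.reduceEqDiff, g26, f26, g23, f23,
    g22, b3, r30, q30] at k26 k23 k22 k25 l25 l26 l27 l28 l29 l30 l31 d1
  -- Up to now only children of depth greater than `d + 1` have been listed, so the lists at depth
  -- `d` come entirely from this step.
  have hCnil : ∀ v ∈ L d, C v = [] := by
    intro v hv
    rw [List.eq_nil_iff_forall_not_mem]
    intro c hcv
    obtain ⟨h1, h2⟩ := (h.mem_iff v c).1 hcv
    rw [hT.dep_child v c h1, ((hT.mem_level _ _).1 hv).2] at h2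
    omega
  have hBnil : ∀ v, v ∉ L d → bucketsOf (s.mem aPar) T v = [] := by
    intro v hv
    rw [List.eq_nil_iff_forall_not_mem]
    intro c hcv
    obtain ⟨h1, rfl⟩ := mem_bucketsOf.1 hcv
    exact hv (hsib.par_mem c ((c1.mem c).1 h1).1)
  have hranksS : Ranks (· ∈ S) (s.mem aCls) code := fun a b ha hb =>
    h.ranks a b ((hSmem a).1 ha) ((hSmem b).1 hb)
  have hcode : ∀ v ∈ L d, CodeFrom P code v (bucketsOf (s.mem aPar) T v) := fun v hv =>
    hsib.codeFrom hP.valid hc hranksS c1 hv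
  have hbm : ∀ v ∈ L d, ∀ c, c ∈ bucketsOf (s.mem aPar) T v ↔ P.Child v c := fun v hv c =>
    hsib.mem_bucketsOf_par hP.valid c1 hv
  refine ⟨k26, ⟨fun v => bucketsOf (s.mem aPar) T v ++ C v, ?_⟩, ?_⟩
  · constructor
    · omega
    · intro v hv
      have := rankIn_lt_length (f := keys (fun v => (P.kd v).number) (s.mem aPar) (s.mem aCls) T) hv
      rw [l29, c2 v hv]
      omega
    · rw [l29]
      exact d1
    · refine Ranks.of_children (P := P) (p := (· ∈ S)) (f := s.mem aCls)
        (C := bucketsOf (s.mem aPar) T) hc.headD hranksS hcode (fun v hv c hcv =>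
          hsib.mem v hv c ((hbm v hv c).1 hcv)) (fun a b ha hb he => ?_)
        (fun v hv h1 => ?_)
        (fun a b ha hb => ?_)
      · unfold bucketsOf
        rw [List.length_reverse, List.length_reverse]
        exact hsib.length_filter_eq hP.valid c1 ha hb he
      · rw [List.eq_nil_iff_forall_not_mem]
        intro c hcv
        exact ((hbm v hv c).1 hcv).ne_trivial (StatementKind.number_eq_one.1 h1)
      · have hrk : ∀ v, (P.kd v).number :: ((bucketsOf (s.mem aPar) T v).map (s.mem aCls)).reverse =
            keys (fun v => (P.kd v).number) (s.mem aPar) (s.mem aCls) T v := by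
          intro v
          simp [keys, bucketsOf]
        rw [l29, c2 a ha, c2 b hb, hrk, hrk, Nat.add_left_cancel_iff, Nat.add_lt_add_iff_left]
        exact ⟨(rankIn_lt_iff ha hb).1, (rankIn_eq_iff ha hb).1⟩
    · rw [l25, l26]
      exact c5
    · rw [l27, l28]
      exact c4
    · intro v hv
      have hvL : v ∉ L d := fun hm => by
        have := ((hT.mem_level _ _).1 hm).2
        omega
      rw [l30, a4 v hvL]
      exact h.cnt v (by omega)
    · rw [l31, k25]
      exact c6
    · intro v c
      rw [List.mem_append, h.mem_iff]
      by_cases hv : v ∈ L d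
      · rw [hbm v hv]
        constructor
        · rintro (h1 | ⟨h1, h2⟩)
          · have := hT.dep_child v c h1
            have := ((hT.mem_level _ _).1 hv).2
            exact ⟨h1, by omega⟩
          · exact ⟨h1, by omega⟩
        · exact fun h1 => .inl h1.1
      · rw [hBnil v hv]
        simp only [List.not_mem_nil, false_or]
        refine ⟨fun h1 => ⟨h1.1, by omega⟩, fun ⟨h1, h2⟩ => ⟨h1, ?_⟩⟩
        rw [hT.mem_level, not_and] at hv
        have := hv (hlt h1).1
        have := hT.dep_child v c h1
        omega
    · intro v hvn hvd
      by_cases hv : v ∈ L d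
      · rw [hCnil v hv, List.append_nil]
        exact hcode v hv
      · rw [hBnil v hv, List.nil_append]
        refine h.codeFrom v hvn ?_
        rw [hT.mem_level, not_and] at hv
        have := hv hvn
        omega
  · omega

/-- The classification of all vertices, by decreasing depth. -/
def rankProg : Program := block [
  instr (copy rE rN),
  instr (const rTop 0),
  instr (const rBase 0),
  instr (const rSt 0),
  loop (lt rZ rE) levelStep]

/-- The lists of children, in reverse order of their codes. -/
structure HasChildren (P : Parse ℕ) (n : ℕ) (code : ℕ → List ℕ) (C : ℕ → List ℕ) (s : State) :
    Prop where
  kind : ∀ v, v < n → s.mem aKind v = (P.kd v).number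
  children : Buckets (s.mem aHch) (s.mem aNch) C
  mem_iff : ∀ v c, c ∈ C v ↔ P.Child v c
  codeFrom : ∀ v, v < n → CodeFrom P code v (C v)

/-- The loop starts at depth `n`, where the level is empty because all depths are below `n`. Each
level is paid for at most twice, once as the level of children and once as that of parents, and the
levels are disjoint. -/
theorem runs_rankProg {P : Parse ℕ} {n : ℕ} {adj : ℕ → List ℕ} {L : ℕ → List ℕ} {dep : ℕ → ℕ}
    {code : ℕ → List ℕ} {s : State} (hP : P.OnRange n adj) (hc : P.IsCode code)
    (hT : HasTree P n L dep s) (hz : s.reg rZ = 0) (ho : s.reg rOne = 1) (hn : s.reg rN = n)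
    (hm : ∀ A ∈ [aHc, aNc, aHp, aNp, aHch, aNch, aCls, aCnt, aStamp], s.mem A = fun _ => 0) :
    Runs rankProg s fun s' t => (∃ C, HasChildren P n code C s') ∧ t ≤ 270 * n + 10 := by
  simp only [List.mem_cons, List.not_mem_nil, or_false, forall_eq_or_imp, forall_eq] at hm
  obtain ⟨m1, m2, m3, m4, m5, m6, m7, m8, m9⟩ := hm
  have hLn : L n = [] := by
    rw [List.eq_nil_iff_forall_not_mem]
    intro v hv
    have h1 := (hT.mem_level _ _).1 hv
    have := hT.dep_lt v h1.1
    omega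
  have hlt : ∀ {v c}, P.Child v c → v < n ∧ c < n := by
    rintro v _ ⟨i, h0, hi, rfl⟩
    have hv := hP.lt_of_kd v (StatementKind.ne_trivial_of_lt_order h0 hi)
    exact ⟨hv, hP.ch_lt v i hv⟩
  have hsum : ∑ d ∈ Finset.range (n + 1), (L d).length ≤ n := by
    have h1 : ∀ d, (L d).length = (L d).toFinset.card := fun d =>
      (List.toFinset_card_of_nodup (hT.nodup_level d)).symm
    simp only [h1]
    rw [← Finset.card_biUnion]
    · conv_rhs => rw [← Finset.card_range n]
      refine Finset.card_le_card fun v hv => ?_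
      obtain ⟨d, -, hd⟩ := Finset.mem_biUnion.1 hv
      rw [List.mem_toFinset, hT.mem_level] at hd
      exact Finset.mem_range.2 hd.1
    · intro a _ b _ hab
      rw [Function.onFun, Finset.disjoint_left]
      intro v hv hv'
      rw [List.mem_toFinset, hT.mem_level] at hv hv'
      exact hab (hv.2.symm.trans hv'.2)
  unfold rankProg
  simp only [runs_block_cons, runs_block_nil, runs_instr, Instr.apply]
  -- The factor `210` is `110 + 100`, the costs of a level in its two roles; `51` covers the fixed
  -- cost of a step and the test.
  refine runs_loop_of_inv (m₀ := 210 * ∑ d ∈ Finset.range (n + 1), (L d).length + 51 * n)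
    (fun s' m => s'.reg rE ≤ n ∧ (∃ C, LevelInv P n L dep code (s'.reg rE) C s') ∧
      m = 110 * ∑ d ∈ Finset.range (s'.reg rE + 1), (L d).length +
        100 * ∑ d ∈ Finset.range (s'.reg rE), (L d).length + 51 * s'.reg rE) ?_ ?_ ?_
  · simp only [State.setReg_reg, Nat.reduceEqDiff, ↓reduceIte, hn]
    refine ⟨le_rfl, ⟨fun _ => [], ?_⟩, ?_⟩
    · constructor
      · simp [hLn]
      · simp [hLn]
      · simp only [State.setReg_mem, hLn, m1, bucketsOf_nil]
        exact Buckets.empty _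
      · intro a b ha
        simp [hLn] at ha
      · simp only [State.setReg_mem, m3]
        exact Buckets.empty _
      · simp only [State.setReg_mem, m5]
        exact Buckets.empty _
      · simp [m8]
      · simp [m9]
      · intro v c
        simp only [List.not_mem_nil, false_iff, not_and, not_lt]
        intro hvc
        exact (hT.dep_lt c (hlt hvc).2).le
      · intro v hv hd
        exact absurd (hT.dep_lt v hv) hd.not_gt
    · rw [Finset.sum_range_succ, hLn, List.length_nil]
      omega
  · rintro s1 _ hs1 ⟨hle, ⟨C, hI⟩, rfl⟩ hb
    have e0 := hs1.reg rZ (by decide)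
    have e1 := hs1.reg rOne (by decide)
    simp only [State.setReg_reg, Nat.reduceEqDiff, ↓reduceIte, hz, ho] at e0 e1
    simp only [Test.Holds, e0] at hb
    obtain ⟨d, hd⟩ : ∃ d, s1.reg rE = d + 1 := ⟨s1.reg rE - 1, by omega⟩
    rw [hd] at hI hle ⊢
    have hT1 : HasTree P n L dep s1 := hT.congr fun A hA => by
      rw [hs1.mem A (by revert hA A; decide)]
      rfl
    refine (runs_levelStep hP hc hT1 e0 e1 hd hI).mono ?_
    rintro s2 t2 hs2 ⟨h1, h2, ht2⟩
    refine ⟨_, ⟨by omega, by rw [h1]; exact h2, rfl⟩, ?_⟩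
    rw [h1]
    simp only [Finset.sum_range_succ]
    omega
  · rintro s1 t _ hs1 ⟨hle, ⟨C, hI⟩, rfl⟩ hb ht
    have e0 := hs1.reg rZ (by decide)
    have m13 := hs1.mem aKind (by decide)
    simp only [State.setReg_reg, State.setReg_mem, Nat.reduceEqDiff, ↓reduceIte, hz] at e0 m13
    simp only [Test.Holds, e0, not_lt, Nat.le_zero] at hb
    rw [hb] at hI
    refine ⟨⟨C, by rw [m13]; exact hT.kind, hI.children, fun v c => ?_,
      fun v hv => hI.codeFrom v hv (Nat.zero_le _)⟩, by omega⟩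
    rw [hI.mem_iff]
    exact ⟨fun h => h.1, fun h => ⟨h, by rw [hT.dep_child v c h]; omega⟩⟩

end RAM

-- Output of the code

notation "aSn" => (35 : ℕ)

namespace RAM

open Program Instr Test

theorem State.output_congr {s s' : State} (h0 : s'.reg 0 = s.reg 0) (h1 : s'.mem 1 = s.mem 1) :
    s'.output = s.output := by
  rw [State.output, State.output, h0, h1]

/-- Append the content of a register to the output. -/
def emitProg (a : ℕ) : Program := block [instr (store 1 0 a), instr (inc 0)]

theorem runs_emitProg {a : ℕ} {s : State} :
    Runs (emitProg a) s fun s' t => s'.output = s.output ++ [s.reg a] ∧ t ≤ 3 := by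
  unfold emitProg
  simp only [runs_block_cons, runs_block_nil, runs_instr, Instr.apply]
  refine ⟨?_, by omega⟩
  simp only [State.output, State.setReg_reg, State.setMem_reg, State.setReg_mem, State.setMem_mem,
    ↓reduceIte, List.range_succ, List.map_append, List.map_cons, List.map_nil,
    Function.update_self]
  congr 1
  refine List.map_congr_left fun i hi => ?_
  rw [Function.update_of_ne (List.mem_range.1 hi).ne]

/-- Put the vertex in `rC` on the stack. -/
def stackProg : Program := block [
  instr (store aSn rC rH),
  instr (copy rH rC),
  instr (inc rH)]

theorem runs_stackProg {s : State} {st : List ℕ} (hl : Linked (s.mem aSn) (s.reg rH) st)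
    (hv : s.reg rC ∉ st) :
    Runs stackProg s fun s' t => Linked (s'.mem aSn) (s'.reg rH) (s.reg rC :: st) ∧ t ≤ 4 := by
  unfold stackProg
  simp only [runs_block_cons, runs_block_nil, runs_instr, Instr.apply, State.setReg_reg,
    State.setReg_mem, State.setMem_reg, State.setMem_mem, ↓reduceIte]
  exact ⟨hl.push hv, by omega⟩

/-- Output of the code of the root, by a traversal of the parse tree. -/
def outputProg : Program := block [
  instr (copy rH rS),
  instr (inc rH),
  instr (store aSn rS rZ),
  loop (lt rZ rH) (block [
    instr (copy rV rH),
    instr (dec rV),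
    instr (load rH aSn rV),
    emitProg rOne,
    instr (load rK aKind rV),
    ite (lt rOne rK) (emitProg rK) skip,
    instr (load rP aHch rV),
    walkProg rP rC aNch stackProg])]

/-- The vertices in `D` have been dealt with, those in `st` are waiting. -/
structure OutputInv (P : Parse ℕ) (n : ℕ) (code : ℕ → List ℕ) (st D : List ℕ) (s : State) :
    Prop where
  linked : Linked (s.mem aSn) (s.reg rH) st
  nodup : (D ++ st).Nodup
  lt : ∀ v ∈ D ++ st, v < n
  child : ∀ v w, P.Child v w → w ∈ D ++ st → v ∈ D
  output : s.output ++ st.flatMap code = code P.root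

/-- What has been printed, followed by the codes of the stacked vertices, always makes up the code
of the root. Treating `v` replaces its code by `1`, its kind if it is inner, and the codes of its
children; pushing the list of children reverses it, so the child to be printed first ends on top. -/
theorem runs_outputProg {P : Parse ℕ} {n : ℕ} {adj : ℕ → List ℕ} {code : ℕ → List ℕ}
    {C : ℕ → List ℕ} {s : State} (hP : P.OnRange n adj) (h : HasChildren P n code C s)
    (hz : s.reg rZ = 0) (ho : s.reg rOne = 1) (hs : s.reg rS = P.root) (h0 : s.output = []) :
    Runs outputProg s fun s' t => s'.output = code P.root ∧ t ≤ 40 * n + 10 := by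
  have hlen : ∀ {l : List ℕ}, l.Nodup → (∀ v ∈ l, v < n) → l.length ≤ n := by
    intro l h1 h2
    rw [← List.toFinset_card_of_nodup h1]
    conv_rhs => rw [← Finset.card_range n]
    exact Finset.card_le_card fun v hv => Finset.mem_range.2 (h2 v (List.mem_toFinset.1 hv))
  unfold outputProg
  simp only [runs_block_cons, runs_block_nil, runs_instr, Instr.apply]
  refine runs_loop_of_inv (m₀ := 40 * n)
    (fun s' m => ∃ st D, OutputInv P n code st D s' ∧
      -- Every vertex pays `10` when it is stacked, which covers the visit by its parent's walk, and
      -- `30` when it is dealt with.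
      m + 10 * (D.length + st.length) + 30 * D.length = 10 + 40 * n) ?_ ?_ ?_
  · refine ⟨[P.root], [], ⟨?_, by simp, ?_, ?_, ?_⟩, by simp; omega⟩
    · simp [hs, hz, Linked]
    · simpa using hP.root_lt
    · rintro v w ⟨i, hi, hi', rfl⟩ hw
      rw [List.nil_append, List.mem_singleton] at hw
      exact absurd hw (hP.valid.ch_ne_root v i hi hi')
    · rw [State.output_congr (s := s) (by simp) (by simp), h0]
      simp
  · rintro s1 m hs1 ⟨st, D, hI, hm⟩ hb
    have e0 := hs1.reg rZ (by decide)
    have e1 := hs1.reg rOne (by decide)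
    have m13 := hs1.mem aKind (by decide)
    have m27 := hs1.mem aHch (by decide)
    have m28 := hs1.mem aNch (by decide)
    simp only [State.setReg_reg, State.setReg_mem, State.setMem_reg, State.setMem_mem,
      Nat.reduceEqDiff, ↓reduceIte, hz, ho] at e0 e1 m13 m27 m28
    simp only [Test.Holds, e0] at hb
    obtain ⟨v, st, rfl, hv, hst⟩ := hI.linked.exists_cons hb
    have hvn : v < n := hI.lt v (by simp)
    have hnd := hI.nodup
    have hnd' := (List.nodup_append.1 hnd).2.1
    have hlt' : ∀ w ∈ (D ++ [v]) ++ ((C v).reverse ++ st), w < n := by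
      intro w hw
      by_cases hw' : w ∈ D ++ v :: st
      · exact hI.lt w hw'
      · have hwC : w ∈ C v := by
          simp only [List.mem_append, List.mem_cons, List.mem_reverse] at hw hw'
          tauto
        obtain ⟨i, -, -, rfl⟩ := (h.mem_iff v w).1 hwC
        exact hP.ch_lt v i hvn
    -- Parents of listed vertices are already in `D`, whereas `v` is not.
    have hnew : ∀ c ∈ C v, c ∉ D ++ v :: st := by
      intro c hc hcm
      have := hI.child v c ((h.mem_iff v c).1 hc) hcm
      exact (List.nodup_append.1 hnd).2.2 v this v (by simp) rfl
    have hnodup : ((D ++ [v]) ++ ((C v).reverse ++ st)).Nodup := by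
      have h1 : ((C v).reverse ++ (D ++ v :: st)).Nodup :=
        List.nodup_append.2 ⟨List.nodup_reverse.2 (h.children.nodup v), hnd, fun a ha b hb hab =>
          hnew a (List.mem_reverse.1 ha) (hab ▸ hb)⟩
      refine (List.Perm.nodup_iff ?_).1 h1
      rw [List.append_cons, ← List.append_assoc _ (D ++ [v]) st,
        ← List.append_assoc (D ++ [v]) _ st]
      exact List.perm_append_comm.append_right st
    simp only [runs_block_cons, runs_block_nil, runs_instr, runs_ite, runs_skip, Instr.apply]
    refine runs_emitProg.mono ?_
    rintro s2 t2 hs2 ⟨ho2, ht2⟩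
    have f0 := hs2.reg rZ (by decide)
    have f1 := hs2.reg rOne (by decide)
    have fV := hs2.reg rV (by decide)
    have fH := hs2.reg rH (by decide)
    have n13 := hs2.mem aKind (by decide)
    have n27 := hs2.mem aHch (by decide)
    have n28 := hs2.mem aNch (by decide)
    have n35 := hs2.mem aSn (by decide)
    simp only [State.setReg_reg, State.setReg_mem, Nat.reduceEqDiff, ↓reduceIte, hv,
      Nat.add_sub_cancel, e0, e1, m13, m27, m28] at f0 f1 fV fH n13 n27 n28 n35
    have ho2' : s2.output = s1.output ++ [1] := by
      rw [ho2, State.output_congr (s := s1) (by simp) (by simp)]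
      simp [e1]
    have hkv := h.kind v hvn
    -- Printing the kind is conditional; what follows is stated for both branches at once.
    have walk : ∀ s3 : State, s3.reg rZ = 0 → s3.reg rV = v → s3.reg rH = s1.mem aSn v →
        s3.mem aSn = s1.mem aSn → s3.mem aHch = s.mem aHch → s3.mem aNch = s.mem aNch →
        s3.output = s1.output ++ 1 ::
          (if (P.kd v).number = 1 then [] else [(P.kd v).number]) →
        Runs (walkProg rP rC aNch stackProg) (s3.setReg rP (s3.mem aHch (s3.reg rV)))
          fun s' t' => OutputInv P n code ((C v).reverse ++ st) (D ++ [v]) s' ∧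
            t' ≤ 9 * (C v).length + 1 := by
      intro s3 w0 wV wH w35 w27 w28 hout
      refine (runs_walkProg (l := C v) (K := 4)
        (fun E s' => Linked (s'.mem aSn) (s'.reg rH) (E.reverse ++ st)) (by decide) (by decide)
        (by decide) ?_ ?_ ?_ ?_ ?_).mono ?_
      · simpa using w0
      · simpa [wV, w27, w28] using h.children.linked v
      · intro E s4 s5 h1 h2 h3
        rw [h1 rH (by decide) (by decide), h2]
        exact h3
      · simpa [wH, w35] using hst
      · intro E c l' s4 hE _ h3 hc
        refine (runs_stackProg h3 ?_).mono ?_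
        · rw [hc]
          intro hm
          rcases List.mem_append.1 hm with hm | hm
          · have := h.children.nodup v
            rw [hE] at this
            exact (List.nodup_append.1 this).2.2 c (List.mem_reverse.1 hm) c (by simp) rfl
          · exact hnew c (by rw [hE]; simp) (by simp [hm])
        · rintro s5 t5 - ⟨h4, ht5⟩
          rw [hc] at h4
          exact ⟨by simpa using h4, ht5⟩
      · rintro s4 t4 hs4 ⟨h4, ht4⟩
        refine ⟨⟨h4, hnodup, hlt', ?_, ?_⟩, ht4⟩
        · intro u w huw hw
          by_cases hwC : w ∈ C v
          · obtain rfl := hP.valid.child_unique huw ((h.mem_iff v w).1 hwC)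
            simp
          · have hw' : w ∈ D ++ v :: st := by
              simp only [List.mem_append, List.mem_cons, List.mem_reverse] at hw ⊢
              tauto
            exact List.mem_append_left _ (hI.child u w huw hw')
        · have h5 := hI.output
          have h6 := h.codeFrom v hvn
          unfold CodeFrom at h6
          rw [List.flatMap_cons, h6] at h5
          rw [State.output_congr (s := s3) (by rw [hs4.reg 0 (by decide)]; simp)
            (by rw [hs4.mem 1 (by decide)]; rfl), hout, List.flatMap_append, ← h5]
          simp
    have hlen1 := hlen hnodup hlt'
    simp only [List.length_append, List.length_reverse, List.length_singleton] at hlen1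
    have fin : ∀ (s' : State) (t' : ℕ), OutputInv P n code ((C v).reverse ++ st) (D ++ [v]) s' →
        t' ≤ 9 * (C v).length + 25 → ∃ m', (∃ st D, OutputInv P n code st D s' ∧
          m' + 10 * (D.length + st.length) + 30 * D.length = 10 + 40 * n) ∧ t' + 1 + m' ≤ m := by
      intro s' t' h1 h2
      refine ⟨m - 10 * (C v).length - 30, ⟨_, _, h1, ?_⟩, ?_⟩ <;>
      · simp only [List.length_append, List.length_reverse, List.length_nil,
          List.length_cons] at hm ⊢
        omega
    have hpos := (P.kd v).number_pos
    constructor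
    · intro hk
      simp only [Test.Holds, State.setReg_reg, Nat.reduceEqDiff, ↓reduceIte, f1, fV, n13, hkv] at hk
      refine runs_emitProg.mono ?_
      rintro s3 t3 hs3 ⟨ho3, ht3⟩
      refine (walk s3 ?_ ?_ ?_ ?_ ?_ ?_ ?_).mono ?_
      · rw [hs3.reg rZ (by decide)]
        simpa using f0
      · rw [hs3.reg rV (by decide)]
        simpa using fV
      · rw [hs3.reg rH (by decide)]
        simpa using fH
      · rw [hs3.mem aSn (by decide)]
        simpa using n35
      · rw [hs3.mem aHch (by decide)]
        simpa using n27
      · rw [hs3.mem aNch (by decide)]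
        simpa using n28
      · rw [ho3, State.output_congr (s := s2) (by simp) (by simp), ho2', if_neg (by omega)]
        simp [n13, fV, hkv]
      · rintro s4 t4 - ⟨h1, ht4⟩
        exact fin _ _ h1 (by omega)
    · intro hk
      simp only [Test.Holds, State.setReg_reg, Nat.reduceEqDiff, ↓reduceIte, f1, fV, n13, hkv] at hk
      refine (walk _ ?_ ?_ ?_ ?_ ?_ ?_ ?_).mono ?_
      · simpa using f0
      · simpa using fV
      · simpa using fH
      · simpa using n35
      · simpa using n27
      · simpa using n28
      · rw [State.output_congr (s := s2) (by simp) (by simp), ho2', if_pos (by omega)]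
      · rintro s4 t4 - ⟨h1, ht4⟩
        exact fin _ _ h1 (by omega)
  · rintro s1 t m hs1 ⟨st, D, hI, hm⟩ hb ht
    have e0 := hs1.reg rZ (by decide)
    simp only [State.setReg_reg, State.setMem_reg, Nat.reduceEqDiff, ↓reduceIte, hz] at e0
    simp only [Test.Holds, e0, not_lt, Nat.le_zero] at hb
    have h1 := hI.linked
    rw [hb] at h1
    obtain rfl := h1.eq_nil
    have h2 := hI.output
    rw [List.flatMap_nil, List.append_nil] at h2
    exact ⟨h2, by omega⟩

end RAM

/-! ### Assembly of the program -/

theorem List.flatMap_finRange_dite {α : Type*} {n : ℕ} (f : Fin n → List α) :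
    (List.finRange n).flatMap f =
      (List.range' 0 n).flatMap fun v => if h : v < n then f ⟨v, h⟩ else [] := by
  rw [← List.range_eq_range', ← List.map_coe_finRange_eq_range, List.flatMap_map]
  simp

/-- The adjacency lists, as lists of numbers. -/
def natAdj {n : ℕ} (adj : Fin n → List (Fin n)) (v : ℕ) : List ℕ :=
  if h : v < n then (adj ⟨v, h⟩).map Fin.val else []

theorem natAdj_val {n : ℕ} (adj : Fin n → List (Fin n)) (v : Fin n) :
    natAdj adj v = (adj v).map Fin.val := by
  simp [natAdj]

theorem RootedDigraph.inputWord_eq {n : ℕ} (G : RootedDigraph (Fin n))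
    (adj : Fin n → List (Fin n)) :
    G.inputWord adj = n :: (G.source : ℕ) :: RAM.inputFrom n (natAdj adj) 0 := by
  unfold inputWord RAM.inputFrom
  congr 2
  rw [List.flatMap_finRange_dite]
  refine List.flatMap_congr fun v hv => ?_
  have hv : v < n := by simpa using hv
  simp only [natAdj, hv, ↓reduceDIte, List.length_map]
  simp [List.map_eq_flatMap]

namespace Parse

theorem onRange_map {n : ℕ} {P : Parse (Fin n)} {adj : Fin n → List (Fin n)} (hP : P.Valid)
    (hF : P.Full) (ha : P.graph.IsAdjacencyList adj) :
    (P.map Fin.val).OnRange n (natAdj adj) := by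
  have he := Fin.val_injective (n := n)
  refine ⟨hP.map he, P.root.2, ?_, ?_, ?_, ?_, ?_, ?_⟩
  · intro v i hv
    have := map_ch (P := P) he ⟨v, hv⟩ i
    exact this ▸ Fin.is_lt _
  · intro v hv
    have := map_snk (P := P) he ⟨v, hv⟩
    exact this ▸ Fin.is_lt _
  · intro v hv
    obtain ⟨v, rfl⟩ := exists_of_map_kd hv
    exact v.2
  · exact fun v hv => (hF.map he ⟨v, hv⟩).2
  · intro v hv
    rw [natAdj_val adj ⟨v, hv⟩]
    exact (ha _).1.map he
  · intro v hv w
    rw [natAdj_val adj ⟨v, hv⟩, map_arc he, List.mem_map]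
    constructor
    · rintro ⟨w, hw, rfl⟩
      exact ⟨⟨v, hv⟩, w, ((ha _).2 w).1 hw, rfl, rfl⟩
    · rintro ⟨v, w, h, rfl, rfl⟩
      exact ⟨w, ((ha _).2 w).2 h, rfl⟩

theorem IsCode.of_map {V W : Type} {P : Parse V} {e : V → W} (he : Function.Injective e)
    {code : W → List ℕ} (hc : (P.map e).IsCode code) : P.IsCode (code ∘ e) := by
  intro v
  have := hc (e v)
  rw [map_kd he] at this
  simpa [map_ch he] using this

end Parse

namespace RAM

open Program Instr Test

/-- The encoding algorithm. -/
def encodeProg : Program :=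
  block [readProg, dfsProg, parseProg, treeProg, levelProg, rankProg, outputProg]

theorem HasGraph.congr {n root : ℕ} {adj : ℕ → List ℕ} {s s' : State} (h : HasGraph n root adj s)
    (hr : ∀ r ∈ [rZ, rOne, rN, rS], s'.reg r = s.reg r)
    (hm : ∀ A ∈ [0, aDeg, aStart, aFst, aSnd], s'.mem A = s.mem A) : HasGraph n root adj s' := by
  simp only [List.mem_cons, List.not_mem_nil, or_false, forall_eq_or_imp, forall_eq] at hr hm
  obtain ⟨r1, r2, r3, r4⟩ := hr
  obtain ⟨m1, m2, m3, m4, m5⟩ := hm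
  refine ⟨r1 ▸ h.zero, r2 ▸ h.one, r3 ▸ h.num, r4 ▸ h.src, ?_, ?_, ?_, ?_⟩
  · rw [m2]; exact h.deg
  · rw [m1, m3]; exact h.start
  · rw [m4]; exact h.fst
  · rw [m5]; exact h.snd

theorem HasOrder.congr {P : Parse ℕ} {n : ℕ} {O : List ℕ} {s s' : State} (h : HasOrder P n O s)
    (hm : ∀ A ∈ [aOrd, aFin, aBack], s'.mem A = s.mem A) : HasOrder P n O s' := by
  simp only [List.mem_cons, List.not_mem_nil, or_false, forall_eq_or_imp, forall_eq] at hm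
  obtain ⟨m1, m2, m3⟩ := hm
  refine { h with ord := ?_, back := ?_, fin := ?_ }
  · rw [m1]; exact h.ord
  · rw [m3]; exact h.back
  · rw [m2]; exact h.fin

theorem HasParse.congr {P : Parse ℕ} {n : ℕ} {s s' : State} (h : HasParse P n s)
    (hm : ∀ A ∈ [aKind, aTl], s'.mem A = s.mem A) : HasParse P n s' := by
  simp only [List.mem_cons, List.not_mem_nil, or_false, forall_eq_or_imp, forall_eq] at hm
  obtain ⟨m1, m2⟩ := hm
  refine ⟨?_, ?_⟩
  · rw [m1]; exact h.kind
  · rw [m2]; exact h.last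

theorem runs_encodeProg {P : Parse ℕ} {n : ℕ} {adj : ℕ → List ℕ} {code : ℕ → List ℕ}
    {l : List ℕ} (hP : P.OnRange n adj) (hc : P.IsCode code)
    (hl : l = n :: P.root :: inputFrom n adj 0) :
    Runs encodeProg (initial l) fun s' t => s'.output = code P.root ∧ t ≤ 1000 * n := by
  have hzero : ∀ A, A ≠ 0 → (initial l).mem A = fun _ => 0 := by
    intro A hA
    simp [initial, hA]
  have hdeg : degSum n adj 0 ≤ 3 * n := by
    have := hP.sum_length_adj_le
    rwa [degSum, ← Finset.range_eq_Ico]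
  -- The root forces `n ≥ 1`, so additive constants are absorbed by `1000 * n`.
  have hpos := hP.root_lt
  unfold encodeProg
  simp only [runs_block_cons, runs_block_nil]
  refine (runs_readProg (n := n) (root := P.root) (adj := adj) (fun _ => rfl) ?_ hzero).mono ?_
  · rw [← hl]
    simpa [initial] using reads_getD l
  rintro s1 t1 hs1 ⟨hG1, hr, ht1⟩
  refine (runs_dfsProg hP hG1 hr ?_).mono ?_
  · intro A hA
    rw [hs1.mem A (by revert hA A; decide), hzero A (by revert hA A; decide)]
  rintro s2 t2 hs2 ⟨⟨O, hO2⟩, ht2⟩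
  have hG2 : HasGraph n P.root adj s2 :=
    hG1.congr (fun r h => hs2.reg r (by revert h r; decide))
      (fun A h => hs2.mem A (by revert h A; decide))
  refine (runs_parseProg hP hG2 hO2).mono ?_
  rintro s3 t3 hs3 ⟨hT3, ht3⟩
  have hG3 : HasGraph n P.root adj s3 :=
    hG2.congr (fun r h => hs3.reg r (by revert h r; decide))
      (fun A h => hs3.mem A (by revert h A; decide))
  have hO3 : HasOrder P n O s3 :=
    hO2.congr fun A h => hs3.mem A (by revert h A; decide)
  refine (runs_treeProg hP hG3 hO3 hT3 ?_).mono ?_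
  · intro A hA
    rw [hs3.mem A (by revert hA A; decide), hs2.mem A (by revert hA A; decide), 
      hs1.mem A (by revert hA A; decide), hzero A (by revert hA A; decide)]
  rintro s4 t4 hs4 ⟨hI4, ht4⟩
  have hO4 : HasOrder P n O s4 :=
    hO3.congr fun A h => hs4.mem A (by revert h A; decide)
  have hT4 : HasParse P n s4 :=
    hT3.congr fun A h => hs4.mem A (by revert h A; decide)
  refine (runs_levelProg hP ?_ ?_ hO4 hT4 hI4 ?_).mono ?_
  · rw [hs4.reg rZ (by decide), hG3.zero]
  · rw [hs4.reg rN (by decide), hG3.num]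
  · intro A hA
    rw [hs4.mem A (by revert hA A; decide), hs3.mem A (by revert hA A; decide),
      hs2.mem A (by revert hA A; decide), hs1.mem A (by revert hA A; decide),
      hzero A (by revert hA A; decide)]
  rintro s5 t5 hs5 ⟨⟨L, dep, hT5⟩, ht5⟩
  refine (runs_rankProg hP hc hT5 ?_ ?_ ?_ ?_).mono ?_
  · rw [hs5.reg rZ (by decide), hs4.reg rZ (by decide), hG3.zero]
  · rw [hs5.reg rOne (by decide), hs4.reg rOne (by decide), hG3.one]
  · rw [hs5.reg rN (by decide), hs4.reg rN (by decide), hG3.num]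
  · intro A hA
    rw [hs5.mem A (by revert hA A; decide), hs4.mem A (by revert hA A; decide),
      hs3.mem A (by revert hA A; decide), hs2.mem A (by revert hA A; decide),
      hs1.mem A (by revert hA A; decide), hzero A (by revert hA A; decide)]
  rintro s6 t6 hs6 ⟨⟨C, hC⟩, ht6⟩
  refine (runs_outputProg hP hC ?_ ?_ ?_ ?_).mono ?_
  · rw [hs6.reg rZ (by decide), hs5.reg rZ (by decide), hs4.reg rZ (by decide), hG3.zero]
  · rw [hs6.reg rOne (by decide), hs5.reg rOne (by decide), hs4.reg rOne (by decide), hG3.one]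
  · rw [hs6.reg rS (by decide), hs5.reg rS (by decide), hs4.reg rS (by decide), hG3.src]
  · rw [State.output, hs6.reg 0 (by decide), hs5.reg 0 (by decide), hs4.reg 0 (by decide),
      hs3.reg 0 (by decide), hs2.reg 0 (by decide), hs1.reg 0 (by decide)]
    rfl
  rintro s7 t7 - ⟨h7, ht7⟩
  exact ⟨h7, by omega⟩

end RAM

theorem mainTheorem4 :
    ∃ (P : RAM.Program) (c : ℕ),
      ∀ (n : ℕ) (G : RootedDigraph (Fin n)) (adj : Fin n → List (Fin n)),
        G.IsDijkstra → G.IsAdjacencyList adj →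
        ∃ (s : RAM.State) (t : ℕ),
          RAM.Run P (RAM.initial (G.inputWord adj)) s t ∧ t ≤ c * n ∧
            G.Encodes s.output := by
  refine ⟨RAM.encodeProg, 1000, fun n G adj hG ha => ?_⟩
  obtain ⟨P, hP, hF, rfl⟩ := hG.exists_parse
  have hR := Parse.onRange_map hP hF ha
  -- One code function links both halves: the machine prints its value at the root, and the sweep on
  -- the graph produces the same string.
  obtain ⟨code, hc⟩ := hR.valid.exists_isCode
  obtain ⟨s, t, h1, h2, h3⟩ := RAM.runs_encodeProg hR hc (P.graph.inputWord_eq adj)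
  refine ⟨s, t, h1, h3, ?_⟩
  rw [h2]
  exact hP.encodes (hc.of_map Fin.val_injective)
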